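/- Let $\mathfrak{g}$ be a finite-dimensional complex semisimple Lie algebra with Cartan subalgebra $\mathfrak{h}$, root system $\Delta$ and a choice of simple roots $\Pi$ with positive roots $\Delta^+$; put $\mathfrak{n}=\bigoplus_{\beta\in\Delta^+}\mathfrak{g}_\beta$. Let $\mathcal{O}(\mathfrak{g})$ be the full subcategory of the category of left $U(\mathfrak{g})$-modules consisting of the finitely generated modules that are direct sums of their $\mathfrak{h}$-weight spaces and on which $\mathfrak{n}$ acts locally finitely. Let $\alpha\in\Delta^+$, let $e_\alpha\in\mathfrak{g}_\alpha$ and $f_\alpha\in\mathfrak{g}_{-\alpha}$ satisfy $[e_\alpha,f_\alpha]=h_\alpha$, where $h_\alpha$ is the coroot of $\alpha$, and put $\mathfrak{s}_\alpha^-=\mathbb{C}f_\alpha$. Let $U(\mathfrak{g})_{(f_\alpha)}$ be the left ring of fractions of $U(\mathfrak{g})$ with respect to $\{f_\alpha^n : n\ge 0\}$, and let $$T_\alpha(M)=\bigl(U(\mathfrak{g})_{(f_\alpha)}/U(\mathfrak{g})\bigr)\otimes_{U(\mathfrak{g})}M$$ be the twisting functor on $\mathfrak{g}$-modules. Then the left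 derived functors $L_iT_\alpha$ of the restriction of $T_\alpha$ to $\mathcal{O}(\mathfrak{g})$ are defined, i.e. every object of $\mathcal{O}(\mathfrak{g})$ has a resolution by projective objects of $\mathcal{O}(\mathfrak{g})$, and, $L_iT_\alpha(M)$ being the $i$-th homology of $T_\alpha(P_\bullet)$ for a projective resolution $P_\bullet\to M$ in $\mathcal{O}(\mathfrak{g})$ (for any choice of it): 1. $L_iT_\alpha(M)=0$ for all $M\in\mathcal{O}(\mathfrak{g})$ and all $i>1$; 2. $L_1T_\alpha(M)=0$ for every $M\in\mathcal{O}(\mathfrak{g})$ that is free as a $U(\mathfrak{s}_\alpha^-)$-module. -/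

import Mathlib

open CategoryTheory MulOpposite
open scoped TensorProduct ModuleCat

universe u v

/-! ## Twisting functors for rings -/

section LocallyAdNilpotent

variable {R : Type u} [Ring R]

/-- The map `ad t : r ↦ t r - r t` of a ring. -/
def adMap (t : R) : R →+ R := AddMonoidHom.mulLeft t - AddMonoidHom.mulRight t

/-- `t` is locally ad-nilpotent: every `r` is killed by some power of `ad t`. -/
def IsLocallyAdNilpotent (t : R) : Prop := ∀ r : R, ∃ n : ℕ, (adMap t)^[n] r = 0

theorem adMap_apply (t r : R) : adMap t r = t * r - r * t := rfl

theorem adMap_iterate_zero (t : R) (n : ℕ) : (adMap t)^[n] 0 = 0 :=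
  Function.iterate_fixed (map_zero _) n

theorem adMap_iterate_add (t : R) (n : ℕ) (x y : R) :
    (adMap t)^[n] (x + y) = (adMap t)^[n] x + (adMap t)^[n] y :=
  Function.Semiconj₂.iterate (fun x y => map_add (adMap t) x y) n x y

theorem adMap_iterate_eq_zero_of_le {t : R} {n m : ℕ} (h : n ≤ m) {x : R}
    (hx : (adMap t)^[n] x = 0) : (adMap t)^[m] x = 0 := by
  obtain ⟨k, rfl⟩ := Nat.exists_eq_add_of_le' h
  rw [Function.iterate_add_apply, hx, adMap_iterate_zero]

theorem adMap_mul (t x y : R) : adMap t (x * y) = adMap t x * y + x * adMap t y := by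
  simp only [adMap_apply]; noncomm_ring

theorem adMap_iterate_mul (t : R) (N : ℕ) : ∀ (n m : ℕ) (x y : R), n + m = N →
    (adMap t)^[n] x = 0 → (adMap t)^[m] y = 0 → (adMap t)^[N] (x * y) = 0 := by
  induction N with
  | zero =>
    intro n m x y h hx hy
    obtain rfl : n = 0 := by omega
    have : x = 0 := hx
    simp [this]
  | succ N ih =>
    intro n m x y h hx hy
    rcases n with _ | n
    · have : x = 0 := hx
      rw [this, zero_mul, adMap_iterate_zero]
    rcases m with _ | m
    · have : y = 0 := hy
      rw [this, mul_zero, adMap_iterate_zero]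
    rw [Function.iterate_succ_apply, adMap_mul, adMap_iterate_add,
      ih n (m + 1) _ _ (by omega) (by rwa [Function.iterate_succ_apply] at hx) hy,
      ih (n + 1) m _ _ (by omega) hx (by rwa [Function.iterate_succ_apply] at hy), add_zero]

/-- If `(ad t)^n r = 0`, then `t^n r` is a left multiple of `t`. -/
theorem exists_pow_mul_eq_mul (t : R) (n : ℕ) : ∀ r : R, (adMap t)^[n] r = 0 →
    ∃ r' : R, t ^ n * r = r' * t := by
  induction n with
  | zero =>
    intro r hr
    have : r = 0 := hr
    exact ⟨0, by simp [this]⟩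
  | succ n ih =>
    intro r hr
    obtain ⟨r', h⟩ := ih (adMap t r) (by rwa [Function.iterate_succ_apply] at hr)
    refine ⟨r' + t ^ n * r, ?_⟩
    rw [adMap_apply, mul_sub] at h
    rw [pow_succ, mul_assoc, add_mul, ← h]
    noncomm_ring

theorem exists_pow_mul_eq_mul_pow {t : R} (ht : IsLocallyAdNilpotent t) (k : ℕ) (r : R) :
    ∃ (n : ℕ) (r' : R), t ^ n * r = r' * t ^ k := by
  induction k with
  | zero => exact ⟨0, r, by simp⟩
  | succ k ih =>
    obtain ⟨n, r', h⟩ := ih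
    obtain ⟨m, hm⟩ := ht r'
    obtain ⟨r'', h'⟩ := exists_pow_mul_eq_mul t m r' hm
    refine ⟨m + n, r'', ?_⟩
    rw [pow_add, mul_assoc, h, ← mul_assoc, h', pow_succ', mul_assoc]

theorem exists_pow_mul_eq_zero (t : R) (n : ℕ) : ∀ r : R, (adMap t)^[n] r = 0 → r * t = 0 →
    t ^ n * r = 0 := by
  induction n with
  | zero =>
    intro r hr _
    have : r = 0 := hr
    simp [this]
  | succ n ih =>
    intro r hr h0
    have h1 : adMap t r = t * r := by rw [adMap_apply, h0, sub_zero]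
    have := ih (t * r) (by rwa [Function.iterate_succ_apply, h1] at hr)
      (by rw [mul_assoc, h0, mul_zero])
    rwa [← mul_assoc, ← pow_succ] at this

theorem exists_pow_mul_eq_zero_of_mul_pow {t : R} (ht : IsLocallyAdNilpotent t) (k : ℕ) :
    ∀ r : R, r * t ^ k = 0 → ∃ n : ℕ, t ^ n * r = 0 := by
  induction k with
  | zero => intro r hr; exact ⟨0, by simpa using hr⟩
  | succ k ih =>
    intro r hr
    obtain ⟨n, hn⟩ := ih (r * t) (by rwa [mul_assoc, ← pow_succ'])
    obtain ⟨m, hm⟩ := ht (t ^ n * r)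
    refine ⟨m + n, ?_⟩
    rw [pow_add, mul_assoc]
    exact exists_pow_mul_eq_zero t m _ hm (by rw [mul_assoc, hn])

/-- The powers of a locally ad-nilpotent element form a left denominator set. -/
theorem nonempty_oreSet_powers {t : R} (ht : IsLocallyAdNilpotent t) :
    Nonempty (OreLocalization.OreSet (Submonoid.powers t)) := by
  rw [OreLocalization.nonempty_oreSet_iff]
  constructor
  · rintro r₁ r₂ ⟨_, k, rfl⟩ h
    obtain ⟨n, hn⟩ := exists_pow_mul_eq_zero_of_mul_pow ht k (r₁ - r₂)
      (by rw [sub_mul]; exact sub_eq_zero.2 h)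
    exact ⟨⟨t ^ n, n, rfl⟩, sub_eq_zero.1 (by rw [← mul_sub]; exact hn)⟩
  · rintro r ⟨_, k, rfl⟩
    obtain ⟨n, r', h⟩ := exists_pow_mul_eq_mul_pow ht k r
    exact ⟨r', ⟨t ^ n, n, rfl⟩, h⟩

/-- The left Ore data on `{tⁿ}` for a locally ad-nilpotent `t`. -/
@[reducible]
noncomputable def oreSetPowers {t : R} (ht : IsLocallyAdNilpotent t) :
    OreLocalization.OreSet (Submonoid.powers t) :=
  (nonempty_oreSet_powers ht).some

end LocallyAdNilpotent

section Bimodule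

variable {R : Type u} [Ring R] (S : Submonoid R) [OreLocalization.OreSet S]

/-- The canonical map `R → S⁻¹R` as a map of left `R`-modules. -/
def toFractions : R →ₗ[R] OreLocalization S R where
  toFun r := OreLocalization.numeratorRingHom r
  map_add' := map_add _
  map_smul' r x := (OreLocalization.smul_oreDiv_one r x).symm

/-- The `(R, R)`-bimodule `S⁻¹R / R`. -/
def FractionsQuotient : Type u := OreLocalization S R ⧸ LinearMap.range (toFractions S)

instance : AddCommGroup (FractionsQuotient S) :=
  inferInstanceAs (AddCommGroup (OreLocalization S R ⧸ LinearMap.range (toFractions S)))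

instance : Module R (FractionsQuotient S) :=
  inferInstanceAs (Module R (OreLocalization S R ⧸ LinearMap.range (toFractions S)))

/-- Right multiplication by `r` on `S⁻¹R`. -/
def fractionsMulRight (r : R) : OreLocalization S R →ₗ[R] OreLocalization S R where
  toFun x := x * OreLocalization.numeratorRingHom r
  map_add' _ _ := add_mul _ _ _
  map_smul' a x := smul_mul_assoc a x _

theorem range_le_comap_fractionsMulRight (r : R) : LinearMap.range (toFractions S) ≤
    (LinearMap.range (toFractions S)).comap (fractionsMulRight S r) := by
  rintro _ ⟨x, rfl⟩
  exact ⟨x * r, map_mul OreLocalization.numeratorRingHom x r⟩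

/-- The right action of `r` on `S⁻¹R / R`, induced by right multiplication on `S⁻¹R`. -/
def fractionsQuotientMulRight (r : R) : FractionsQuotient S →ₗ[R] FractionsQuotient S :=
  Submodule.mapQ _ _ (fractionsMulRight S r) (range_le_comap_fractionsMulRight S r)

instance : Module Rᵐᵒᵖ (FractionsQuotient S) where
  smul r x := fractionsQuotientMulRight S (unop r) x
  one_smul x := by
    obtain ⟨x, rfl⟩ := Submodule.mkQ_surjective _ x
    change Submodule.mkQ _ (x * OreLocalization.numeratorRingHom (1 : R)) = _
    rw [map_one, mul_one]
  mul_smul r s x := by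
    obtain ⟨x, rfl⟩ := Submodule.mkQ_surjective _ x
    change Submodule.mkQ _ (x * OreLocalization.numeratorRingHom (unop s * unop r)) =
      Submodule.mkQ _ (x * OreLocalization.numeratorRingHom (unop s) *
        OreLocalization.numeratorRingHom (unop r))
    rw [mul_assoc, ← map_mul OreLocalization.numeratorRingHom]
  smul_zero r := map_zero _
  smul_add r x y := map_add _ _ _
  add_smul r s x := by
    obtain ⟨x, rfl⟩ := Submodule.mkQ_surjective _ x
    change Submodule.mkQ _ (x * OreLocalization.numeratorRingHom (unop r + unop s)) =
      Submodule.mkQ _ (x * OreLocalization.numeratorRingHom (unop r)) +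
        Submodule.mkQ _ (x * OreLocalization.numeratorRingHom (unop s))
    rw [map_add, mul_add, map_add]
    rfl
  zero_smul x := by
    obtain ⟨x, rfl⟩ := Submodule.mkQ_surjective _ x
    change Submodule.mkQ _ (x * OreLocalization.numeratorRingHom (0 : R)) = _
    rw [map_zero, mul_zero, map_zero]
    rfl

instance : SMulCommClass R Rᵐᵒᵖ (FractionsQuotient S) where
  smul_comm a r x := (map_smul (fractionsQuotientMulRight S (unop r)) a x).symm

end Bimodule

section BalancedTensor

variable {R : Type u} [Ring R]
variable (B : Type u) [AddCommGroup B] [Module R B] [Module Rᵐᵒᵖ B] [SMulCommClass R Rᵐᵒᵖ B]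

/-- The relations `(b · r) ⊗ m = b ⊗ (r · m)` in `B ⊗_ℤ M`. -/
def balancedRelations (M : Type v) [AddCommGroup M] [Module R M] : Submodule R (B ⊗[ℤ] M) :=
  Submodule.span R {x | ∃ (b : B) (r : R) (m : M), x = (op r • b) ⊗ₜ[ℤ] m - b ⊗ₜ[ℤ] (r • m)}

/-- The tensor product `B ⊗_R M` of an `(R, R)`-bimodule with a left `R`-module over a not
necessarily commutative ring, as a left `R`-module. -/
abbrev BalancedTensor (M : Type v) [AddCommGroup M] [Module R M] : Type (max u v) :=
  (B ⊗[ℤ] M) ⧸ balancedRelations (R := R) B M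

variable {M N P : Type v} [AddCommGroup M] [Module R M] [AddCommGroup N] [Module R N]
  [AddCommGroup P] [Module R P]

/-- The map `b ⊗ m ↦ b ⊗ φ m` on `B ⊗_ℤ M`, as a map of left `R`-modules. -/
noncomputable def tensorMapInt (φ : M →ₗ[R] N) : B ⊗[ℤ] M →ₗ[R] B ⊗[ℤ] N :=
  TensorProduct.AlgebraTensorModule.map LinearMap.id φ.toAddMonoidHom.toIntLinearMap

theorem tensorMapInt_tmul (φ : M →ₗ[R] N) (b : B) (m : M) :
    tensorMapInt B φ (b ⊗ₜ[ℤ] m) = b ⊗ₜ[ℤ] φ m := rfl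

theorem balancedRelations_le_comap (φ : M →ₗ[R] N) :
    balancedRelations (R := R) B M ≤ (balancedRelations (R := R) B N).comap (tensorMapInt B φ) := by
  refine Submodule.span_le.2 ?_
  rintro _ ⟨b, r, m, rfl⟩
  refine Submodule.subset_span ⟨b, r, φ m, ?_⟩
  rw [map_sub, tensorMapInt_tmul, tensorMapInt_tmul, map_smul]

/-- The map `B ⊗_R M → B ⊗_R N` induced by `φ : M → N`. -/
noncomputable def balancedTensorMap (φ : M →ₗ[R] N) :
    BalancedTensor (R := R) B M →ₗ[R] BalancedTensor (R := R) B N :=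
  Submodule.mapQ _ _ (tensorMapInt B φ) (balancedRelations_le_comap B φ)

theorem balancedTensor_hom_ext {Q : Type*} [AddCommGroup Q] [Module R Q]
    {f g : BalancedTensor (R := R) B M →ₗ[R] Q}
    (h : ∀ (b : B) (m : M), f (Submodule.Quotient.mk (b ⊗ₜ[ℤ] m)) =
      g (Submodule.Quotient.mk (b ⊗ₜ[ℤ] m))) : f = g := by
  refine Submodule.linearMap_qext _ (LinearMap.ext fun x => ?_)
  induction x using TensorProduct.induction_on with
  | zero => rw [map_zero, map_zero]
  | tmul b m => exact h b m
  | add x y hx hy => rw [map_add, map_add, hx, hy]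

end BalancedTensor

section TwistingFunctor

variable {R : Type u} [Ring R]

/-- The functor `M ↦ (S⁻¹R / R) ⊗_R M`. -/
noncomputable def fractionsTensorFunctor (S : Submonoid R) [OreLocalization.OreSet S] :
    ModuleCat.{u} R ⥤ ModuleCat.{u} R where
  obj M := ModuleCat.of R (BalancedTensor (R := R) (FractionsQuotient S) M)
  map φ := ModuleCat.ofHom (balancedTensorMap (FractionsQuotient S) φ.hom)
  map_id _ := ModuleCat.hom_ext (balancedTensor_hom_ext _ fun _ _ => rfl)
  map_comp _ _ := ModuleCat.hom_ext (balancedTensor_hom_ext _ fun _ _ => rfl)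

instance (S : Submonoid R) [OreLocalization.OreSet S] : (fractionsTensorFunctor S).Additive where
  map_add {M N φ ψ} := ModuleCat.hom_ext (balancedTensor_hom_ext _ fun b m => by
    change (balancedRelations (R := R) (FractionsQuotient S) N).mkQ
        (b ⊗ₜ[ℤ] (φ.hom m + ψ.hom m)) =
      (balancedRelations (R := R) (FractionsQuotient S) N).mkQ (b ⊗ₜ[ℤ] φ.hom m) +
        (balancedRelations (R := R) (FractionsQuotient S) N).mkQ (b ⊗ₜ[ℤ] ψ.hom m)
    rw [TensorProduct.tmul_add, map_add])

/-- The twisting functor `T_t(M) = (R_(t) / R) ⊗_R M` of a locally ad-nilpotent `t`. -/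
noncomputable def twistingFunctor {t : R} (ht : IsLocallyAdNilpotent t) :
    ModuleCat.{u} R ⥤ ModuleCat.{u} R :=
  letI := oreSetPowers ht
  fractionsTensorFunctor (Submonoid.powers t)

instance {t : R} (ht : IsLocallyAdNilpotent t) : (twistingFunctor ht).Additive :=
  letI := oreSetPowers ht
  inferInstanceAs (fractionsTensorFunctor (Submonoid.powers t)).Additive

end TwistingFunctor

/-! ## The category `𝒪` and the twisting functor of a root -/

section LieAlgebra

open LieAlgebra LieModule

attribute [local instance 100] LieRing.ofAssociativeRing

variable {𝔤 : Type u} [LieRing 𝔤] [LieAlgebra ℂ 𝔤]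

local notation "U(" x ")" => UniversalEnvelopingAlgebra ℂ x

/-- If `ad f` is nilpotent on `𝔤`, then `f` is locally ad-nilpotent in `U(𝔤)`. -/
theorem isLocallyAdNilpotent_ι {f : 𝔤} (hf : IsNilpotent (LieAlgebra.ad ℂ 𝔤 f)) :
    IsLocallyAdNilpotent (UniversalEnvelopingAlgebra.ι ℂ f) := by
  set t := UniversalEnvelopingAlgebra.ι ℂ f with ht
  let K : Subalgebra ℂ U(𝔤) :=
    { carrier := {r | ∃ n : ℕ, (adMap t)^[n] r = 0}
      mul_mem' := by
        rintro x y ⟨n, hn⟩ ⟨m, hm⟩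
        exact ⟨n + m, adMap_iterate_mul t _ n m x y rfl hn hm⟩
      add_mem' := by
        rintro x y ⟨n, hn⟩ ⟨m, hm⟩
        refine ⟨n + m, ?_⟩
        rw [adMap_iterate_add, adMap_iterate_eq_zero_of_le (Nat.le_add_right n m) hn,
          adMap_iterate_eq_zero_of_le (Nat.le_add_left m n) hm, add_zero]
      algebraMap_mem' := fun c => ⟨1, by
        rw [Function.iterate_one, adMap_apply, Algebra.commutes, sub_self]⟩ }
  have hK : ∀ x : 𝔤, UniversalEnvelopingAlgebra.ι ℂ x ∈ K := by
    intro x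
    have key : ∀ n : ℕ, (adMap t)^[n] (UniversalEnvelopingAlgebra.ι ℂ x) =
        UniversalEnvelopingAlgebra.ι ℂ ((LieAlgebra.ad ℂ 𝔤 f ^ n) x) := by
      intro n
      induction n with
      | zero => rfl
      | succ n ih =>
        rw [Function.iterate_succ_apply', ih, pow_succ', Module.End.mul_apply,
          LieAlgebra.ad_apply, LieHom.map_lie, adMap_apply, LieRing.of_associative_ring_bracket]
    obtain ⟨n, hn⟩ := hf
    exact ⟨n, by rw [key, hn, LinearMap.zero_apply, map_zero]⟩
  let g₀ : 𝔤 →ₗ⁅ℂ⁆ K :=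
    { toFun := fun x => ⟨UniversalEnvelopingAlgebra.ι ℂ x, hK x⟩
      map_add' := fun x y => Subtype.ext (map_add _ x y)
      map_smul' := fun c x => Subtype.ext (map_smul _ c x)
      map_lie' := fun {x y} => Subtype.ext (LieHom.map_lie _ x y) }
  have hg : K.val.comp (UniversalEnvelopingAlgebra.lift ℂ g₀) = AlgHom.id ℂ U(𝔤) := by
    apply UniversalEnvelopingAlgebra.hom_ext
    ext x
    change ((UniversalEnvelopingAlgebra.lift ℂ g₀ (UniversalEnvelopingAlgebra.ι ℂ x) : K) : U(𝔤)) =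
      UniversalEnvelopingAlgebra.ι ℂ x
    rw [UniversalEnvelopingAlgebra.lift_ι_apply]
    rfl
  intro r
  have := DFunLike.congr_fun hg r
  rw [← show _ = r from this]
  exact (UniversalEnvelopingAlgebra.lift ℂ g₀ r).2

section Free

/-- The one-dimensional Lie subalgebra `ℂ f` of `𝔤`. -/
def lineSubalgebra (f : 𝔤) : LieSubalgebra ℂ 𝔤 where
  __ := Submodule.span ℂ {f}
  lie_mem' := by
    intro x y hx hy
    obtain ⟨a, rfl⟩ := Submodule.mem_span_singleton.1 hx
    obtain ⟨b, rfl⟩ := Submodule.mem_span_singleton.1 hy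
    simp

/-- The algebra map `U(𝔞) → U(𝔤)` induced by the inclusion of a Lie subalgebra `𝔞`. -/
noncomputable def envelopingIncl (𝔞 : LieSubalgebra ℂ 𝔤) : U(𝔞) →ₐ[ℂ] U(𝔤) :=
  UniversalEnvelopingAlgebra.lift ℂ ((UniversalEnvelopingAlgebra.ι ℂ).comp 𝔞.incl)

/-- The `𝔤`-module `M` is free as a `U(𝔞)`-module. -/
def IsFreeOver (𝔞 : LieSubalgebra ℂ 𝔤) (M : ModuleCat.{u} U(𝔤)) : Prop :=
  letI : Module U(𝔞) M := Module.compHom M (envelopingIncl 𝔞).toRingHom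
  Module.Free U(𝔞) M

end Free

/-- The weight space `M_μ` of a `𝔤`-module, for `μ ∈ 𝔥*`. -/
def weightSubspace (𝔥 : LieSubalgebra ℂ 𝔤) (M : ModuleCat.{u} U(𝔤)) (μ : Module.Dual ℂ 𝔥) :
    Submodule ℂ M where
  carrier := {m | ∀ h : 𝔥, UniversalEnvelopingAlgebra.ι ℂ (h : 𝔤) • m = μ h • m}
  add_mem' := fun {x y} hx hy h => by rw [smul_add, smul_add, hx h, hy h]
  zero_mem' := fun h => by rw [smul_zero, smul_zero]
  smul_mem' := fun c x hx h => by
    rw [← algebraMap_smul U(𝔤) c x, ← mul_smul, ← Algebra.commutes, mul_smul, hx h,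
      algebraMap_smul, algebraMap_smul, smul_comm]

/-- `M` is a weight module: it is the sum of its weight spaces. (Such a sum is always direct.) -/
def IsWeightModule (𝔥 : LieSubalgebra ℂ 𝔤) (M : ModuleCat.{u} U(𝔤)) : Prop :=
  ⨆ μ : Module.Dual ℂ 𝔥, weightSubspace 𝔥 M μ = ⊤

/-- `M` is locally `𝔞`-finite: every vector lies in a finite-dimensional `𝔞`-stable subspace. -/
def IsLocallyFinite (𝔞 : LieSubalgebra ℂ 𝔤) (M : ModuleCat.{u} U(𝔤)) : Prop :=
  ∀ m : M, ∃ V : Submodule ℂ M, m ∈ V ∧ FiniteDimensional ℂ V ∧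
    ∀ x ∈ 𝔞, ∀ w ∈ V, UniversalEnvelopingAlgebra.ι ℂ x • w ∈ V

variable [FiniteDimensional ℂ 𝔤] [IsKilling ℂ 𝔤] {𝔥 : LieSubalgebra ℂ 𝔤} [𝔥.IsCartanSubalgebra]

/-- The nilradical `𝔫` of the Borel subalgebra attached to a base of the root system: the Lie
subalgebra generated by (equivalently, the sum of) the root spaces of the positive roots. -/
noncomputable def borelNilradical (b : (IsKilling.rootSystem 𝔥).Base) : LieSubalgebra ℂ 𝔤 :=
  LieSubalgebra.lieSpan ℂ 𝔤
    {x | ∃ β : 𝔥.root, b.IsPos β ∧ x ∈ rootSpace 𝔥 (β : Weight ℂ 𝔥 𝔤)}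

/-- The objects of the category `𝒪(𝔤)`: finitely generated weight modules that are locally
`𝔫`-finite. -/
def categoryO (b : (IsKilling.rootSystem 𝔥).Base) : ObjectProperty (ModuleCat.{u} U(𝔤)) :=
  fun M => Module.Finite U(𝔤) M ∧ IsWeightModule 𝔥 M ∧ IsLocallyFinite (borelNilradical b) M

instance (b : (IsKilling.rootSystem 𝔥).Base) : (categoryO b).ContainsZero where
  exists_zero := by
    refine ⟨ModuleCat.of U(𝔤) PUnit, ModuleCat.isZero_of_subsingleton _, ?_, ?_, ?_⟩
    · exact inferInstanceAs (Module.Finite U(𝔤) PUnit.{u + 1})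
    · refine eq_top_iff.2 fun x _ => ?_
      rw [show x = 0 from Subsingleton.elim (α := PUnit) _ _]
      exact zero_mem _
    · intro m
      refine ⟨⊥, ?_, inferInstance, ?_⟩
      · exact Subsingleton.elim (α := PUnit) _ _
      · intro x _ w _
        exact Subsingleton.elim (α := PUnit) _ _

/-- A root vector of a nonzero weight is locally ad-nilpotent in `U(𝔤)`. -/
theorem isLocallyAdNilpotent_of_mem_rootSpace (α : 𝔥.root) {f : 𝔤}
    (hf : f ∈ rootSpace 𝔥 (-(α : Weight ℂ 𝔥 𝔤))) :
    IsLocallyAdNilpotent (UniversalEnvelopingAlgebra.ι ℂ f) := by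
  have hα : (α : Weight ℂ 𝔥 𝔤).IsNonZero :=
    (Finset.mem_filter.1 α.2).2
  refine isLocallyAdNilpotent_ι (LieAlgebra.isNilpotent_ad_of_mem_rootSpace 𝔥 ?_ hf)
  intro h
  exact hα (neg_eq_zero.1 h)

/-- The twisting functor `T_α = T_{f_α}` on `𝔤`-modules, where `f_α ∈ 𝔤_{-α}`. -/
noncomputable def rootTwistingFunctor (α : 𝔥.root) {f : 𝔤}
    (hf : f ∈ rootSpace 𝔥 (-(α : Weight ℂ 𝔥 𝔤))) : ModuleCat.{u} U(𝔤) ⥤ ModuleCat.{u} U(𝔤) :=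
  twistingFunctor (isLocallyAdNilpotent_of_mem_rootSpace α hf)

instance (α : 𝔥.root) {f : 𝔤} (hf : f ∈ rootSpace 𝔥 (-(α : Weight ℂ 𝔥 𝔤))) :
    (rootTwistingFunctor α hf).Additive :=
  inferInstanceAs (twistingFunctor _).Additive

/-- `L_i T_α (M)` for `M` in `𝒪(𝔤)`, computed from a resolution `P` of `M` by projective objects
of `𝒪(𝔤)`: the `i`-th homology of `T_α (P)`, where `T_α` is restricted to `𝒪(𝔤)`. -/
noncomputable def leftDerivedTwisting (b : (IsKilling.rootSystem 𝔥).Base) (α : 𝔥.root) {f : 𝔤}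
    (hf : f ∈ rootSpace 𝔥 (-(α : Weight ℂ 𝔥 𝔤))) {M : (categoryO b).FullSubcategory}
    (P : ProjectiveResolution M) (i : ℕ) : ModuleCat.{u} U(𝔤) :=
  ((((categoryO b).ι ⋙ rootTwistingFunctor α hf).mapHomologicalComplex _).obj P.complex).homology i

end LieAlgebra

/-! ## The twisting functor on torsion-free modules -/

/-! Write t = f_α. Every element of (R_(t)/R) ⊗ M has the form t⁻ⁿ ⊗ m, and it vanishes only if t⁻ⁿm
comes from M in the localization. Hence (`twistingFunctor_exact`) exactness of A → B → C at B
survives twisting as soon as C and the cokernel of B → C have no t-torsion. In a projective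
resolution P of M, the cokernel of P_(i+1) → P_i embeds into P_(i-1) for i ≥ 1 and is M for i = 0.
So everything follows once f_α acts injectively on the projective objects of 𝒪; for the second
vanishing statement it must also act injectively on M, which freeness over U(ℂf_α) provides.

For projectives, `IsO.exists_injective_cover` writes each object of 𝒪 as a quotient of some Q in 𝒪
on which f_α is injective; a projective object is then a direct summand of such a Q. The
construction uses neither the PBW theorem nor Verma flags. Let 𝔤 act by vector fields on a chart of
a Grassmannian of 𝔤, with base point the subspace 𝔫. The Borel subalgebra fixes this point and f_α
moves it. Then Q is generated by the M-valued point masses at the base point, inside the M-valued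
distributions supported there. Differentiating such a distribution along a vector field that does
not vanish at the point is injective (`eq_zero_of_mem_jets`), and integrating the constant function
1 maps Q onto M.

Enough projectives come from the Casimir element Ω. On a coset of the root lattice, Ω takes a given
value on highest weight vectors only at boundedly many heights (`exists_norm_apply_le`), because the
Killing form is positive definite on coroot coordinates. This gives noetherianity (`isNoetherian`),
so 𝒪 is closed under subobjects. It also bounds, uniformly over 𝒪, the length of raising words
acting nontrivially on the vectors of a fixed weight killed by powers of a fixed polynomial r(Ω).
The universal module on a weight vector killed by long raising words thus maps onto every such
vector. The component of its generator in the generalized kernel of r(Ω) generates a projective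
object (`exists_projective_generator`). -/

section TwistingExactness

variable {R : Type u} [Ring R]

section FractionTensor

variable {t : R} [OreLocalization.OreSet (Submonoid.powers t)]

/-- The class of `t⁻ⁿ` in `R_(t) / R`. -/
noncomputable def inversePow (t : R) [OreLocalization.OreSet (Submonoid.powers t)] (n : ℕ) :
    FractionsQuotient (Submonoid.powers t) :=
  Submodule.mkQ (LinearMap.range (toFractions (Submonoid.powers t)))
    (OreLocalization.oreDiv 1 (⟨t ^ n, n, rfl⟩ : Submonoid.powers t))

theorem op_smul_inversePow (n : ℕ) (r : R) : op r • inversePow t n =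
    Submodule.mkQ (LinearMap.range (toFractions (Submonoid.powers t)))
      (OreLocalization.oreDiv r (⟨t ^ n, n, rfl⟩ : Submonoid.powers t)) := by
  change Submodule.mkQ _ (OreLocalization.oreDiv 1 _ * OreLocalization.numeratorRingHom r) = _
  congr 1
  change OreLocalization.oreDiv 1 _ * OreLocalization.oreDiv r 1 = _
  rw [OreLocalization.mul_div_one, one_mul]

theorem op_pow_smul_inversePow (n k : ℕ) : op (t ^ k) • inversePow t (k + n) = inversePow t n := by
  rw [op_smul_inversePow, inversePow]
  congr 1
  rw [OreLocalization.expand' (1 : R) (⟨t ^ n, n, rfl⟩ : Submonoid.powers t) ⟨t ^ k, k, rfl⟩]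
  congr 1
  · change _ = t ^ k * 1
    rw [mul_one]
  · exact Subtype.ext (pow_add t k n)

theorem exists_op_smul_inversePow (b : FractionsQuotient (Submonoid.powers t)) :
    ∃ (n : ℕ) (r : R), b = op r • inversePow t n := by
  obtain ⟨x, rfl⟩ := Submodule.mkQ_surjective _ b
  induction x using OreLocalization.ind with
  | _ r s =>
    obtain ⟨_, n, rfl⟩ := s
    exact ⟨n, r, (op_smul_inversePow n r).symm⟩

variable {M N : Type u} [AddCommGroup M] [Module R M] [AddCommGroup N] [Module R N]

/-- The element `t⁻ⁿ ⊗ m` of `(R_(t) / R) ⊗_R M`. -/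
noncomputable def fractionTensor (t : R) [OreLocalization.OreSet (Submonoid.powers t)]
    (n : ℕ) (m : M) : BalancedTensor (R := R) (FractionsQuotient (Submonoid.powers t)) M :=
  Submodule.mkQ _ (inversePow t n ⊗ₜ[ℤ] m)

theorem mkQ_op_smul_tmul (b : FractionsQuotient (Submonoid.powers t)) (r : R) (m : M) :
    (balancedRelations (R := R) (FractionsQuotient (Submonoid.powers t)) M).mkQ
      ((op r • b) ⊗ₜ[ℤ] m) = Submodule.mkQ _ (b ⊗ₜ[ℤ] (r • m)) :=
  (Submodule.Quotient.eq _).2 (Submodule.subset_span ⟨b, r, m, rfl⟩)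

theorem fractionTensor_add (n : ℕ) (x y : M) :
    fractionTensor t n (x + y) = fractionTensor t n x + fractionTensor t n y := by
  rw [fractionTensor, TensorProduct.tmul_add, map_add]; rfl

theorem fractionTensor_sub (n : ℕ) (x y : M) :
    fractionTensor t n (x - y) = fractionTensor t n x - fractionTensor t n y := by
  rw [fractionTensor, TensorProduct.tmul_sub, map_sub]; rfl

theorem fractionTensor_pow_smul (n k : ℕ) (m : M) :
    fractionTensor t (k + n) (t ^ k • m) = fractionTensor t n m := by
  rw [fractionTensor, ← mkQ_op_smul_tmul, op_pow_smul_inversePow]; rfl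

theorem inversePow_zero : inversePow t 0 = 0 := by
  refine (Submodule.Quotient.mk_eq_zero _).2 ⟨1, ?_⟩
  change OreLocalization.numeratorHom (1 : R) = _
  rw [OreLocalization.numeratorHom_apply]
  congr 1
  exact Subtype.ext (pow_zero t).symm

theorem fractionTensor_zero_left (m : M) : fractionTensor t 0 m = 0 := by
  rw [fractionTensor, inversePow_zero, TensorProduct.zero_tmul, map_zero]

/-- Two elements t⁻ⁿ ⊗ a and t⁻ᵏ ⊗ b can be brought to the common denominator t^(k+n), so elements
of this shape are closed under addition. -/
theorem exists_eq_fractionTensor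
    (z : BalancedTensor (R := R) (FractionsQuotient (Submonoid.powers t)) M) :
    ∃ (n : ℕ) (m : M), z = fractionTensor t n m := by
  obtain ⟨z, rfl⟩ := Submodule.mkQ_surjective _ z
  induction z using TensorProduct.induction_on with
  | zero => exact ⟨0, 0, by rw [fractionTensor_zero_left, map_zero]⟩
  | tmul b m =>
    obtain ⟨n, r, rfl⟩ := exists_op_smul_inversePow b
    exact ⟨n, r • m, mkQ_op_smul_tmul _ _ _⟩
  | add x y hx hy =>
    obtain ⟨n, a, ha⟩ := hx
    obtain ⟨k, b, hb⟩ := hy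
    refine ⟨k + n, t ^ k • a + t ^ n • b, ?_⟩
    rw [map_add, ha, hb, fractionTensor_add, fractionTensor_pow_smul, add_comm k n,
      fractionTensor_pow_smul]

variable (t M) in
/-- The image of `M` in its localization. -/
def localizationImage : Submodule R (OreLocalization (Submonoid.powers t) M) where
  carrier := Set.range fun m : M => OreLocalization.oreDiv m 1
  add_mem' := by
    rintro _ _ ⟨a, rfl⟩ ⟨b, rfl⟩
    exact ⟨a + b, OreLocalization.add_oreDiv.symm⟩
  zero_mem' := ⟨0, OreLocalization.zero_oreDiv _⟩
  smul_mem' := by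
    rintro r _ ⟨a, rfl⟩
    exact ⟨r • a, (OreLocalization.smul_oreDiv_one r a).symm⟩

theorem mem_localizationImage {x : OreLocalization (Submonoid.powers t) M} :
    x ∈ localizationImage t M ↔ ∃ m : M, OreLocalization.oreDiv m 1 = x := Iff.rfl

/-- The map `R_(t) / R → M_(t) / M`, `x ↦ x m`. -/
def fractionsQuotientSMul (m : M) : FractionsQuotient (Submonoid.powers t) →ₗ[R]
    OreLocalization (Submonoid.powers t) M ⧸ localizationImage t M :=
  Submodule.mapQ _ _
    ({ toFun := fun x => x • (OreLocalization.oreDiv m 1 :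
          OreLocalization (Submonoid.powers t) M)
       map_add' := fun x y => add_smul x y _
       map_smul' := fun r x => smul_assoc r x _ } :
      OreLocalization (Submonoid.powers t) R →ₗ[R] OreLocalization (Submonoid.powers t) M) (by
    rintro _ ⟨r, rfl⟩
    exact mem_localizationImage.2 ⟨r • m, (OreLocalization.smul_div_one (p := r) (r := m)
      (s := (1 : Submonoid.powers t))).symm⟩)

theorem fractionsQuotientSMul_mkQ (m : M) (x : OreLocalization (Submonoid.powers t) R) :
    fractionsQuotientSMul (t := t) m (Submodule.mkQ _ x) =
      Submodule.mkQ (localizationImage t M) (x • OreLocalization.oreDiv m 1) := rfl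

/-- The map x ⊗ m ↦ xm into M_(t)/M respects the balancing relations and therefore detects nonzero
elements. If t⁻ⁿ ⊗ m is zero, then m/tⁿ equals some m'/1; the extra power tᵏ is the price of
equality of fractions when M has torsion. -/
theorem exists_pow_smul_eq_of_fractionTensor_eq_zero {n : ℕ} {m : M}
    (h : fractionTensor t n m = 0) : ∃ (k : ℕ) (m' : M), t ^ k • m = t ^ (k + n) • m' := by
  let g : FractionsQuotient (Submonoid.powers t) ⊗[ℤ] M →+
      OreLocalization (Submonoid.powers t) M ⧸ localizationImage t M :=
    TensorProduct.liftAddHom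
      (AddMonoidHom.flip
        { toFun := fun m => (fractionsQuotientSMul (t := t) m).toAddMonoidHom
          map_zero' := by
            ext x
            obtain ⟨x, rfl⟩ := Submodule.mkQ_surjective _ x
            change Submodule.mkQ (localizationImage t M) (x • OreLocalization.oreDiv (0 : M) 1) = 0
            rw [OreLocalization.zero_oreDiv, smul_zero, map_zero]
          map_add' := fun a b => by
            ext x
            obtain ⟨x, rfl⟩ := Submodule.mkQ_surjective _ x
            change Submodule.mkQ (localizationImage t M) (x • OreLocalization.oreDiv (a + b) 1) =
              Submodule.mkQ (localizationImage t M) (x • OreLocalization.oreDiv a 1) +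
              Submodule.mkQ (localizationImage t M) (x • OreLocalization.oreDiv b 1)
            rw [← OreLocalization.add_oreDiv, smul_add, map_add] })
      (fun r b m => by rw [map_zsmul, map_zsmul]; rfl)
  have hg : ∀ b (m : M), g (b ⊗ₜ[ℤ] m) = fractionsQuotientSMul m b := fun b m => rfl
  have hsmul : ∀ (r : R) z, g (r • z) = r • g z := by
    intro r z
    induction z using TensorProduct.induction_on with
    | zero => rw [smul_zero, map_zero, smul_zero]
    | tmul b m => rw [TensorProduct.smul_tmul', hg, hg, map_smul]
    | add x y hx hy => rw [smul_add, map_add, map_add, hx, hy, smul_add]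
  let K : Submodule R (FractionsQuotient (Submonoid.powers t) ⊗[ℤ] M) :=
    { carrier := {z | g z = 0}
      add_mem' := fun {x y} hx hy => by
        change g (x + y) = 0
        rw [map_add, show g x = 0 from hx, show g y = 0 from hy, add_zero]
      zero_mem' := map_zero g
      smul_mem' := fun r x hx => by
        change g (r • x) = 0
        rw [hsmul, show g x = 0 from hx, smul_zero] }
  have hK : balancedRelations (R := R) (FractionsQuotient (Submonoid.powers t)) M ≤ K := by
    refine Submodule.span_le.2 ?_
    rintro _ ⟨b, r, m, rfl⟩
    change g _ = 0
    rw [map_sub, hg, hg, sub_eq_zero]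
    obtain ⟨x, rfl⟩ := Submodule.mkQ_surjective _ b
    change Submodule.mkQ (localizationImage t M)
      ((x * OreLocalization.oreDiv r 1) • OreLocalization.oreDiv m 1) =
      Submodule.mkQ (localizationImage t M) (x • OreLocalization.oreDiv (r • m) 1)
    rw [mul_smul, OreLocalization.smul_div_one]
  have h0 : g (inversePow t n ⊗ₜ[ℤ] m) = 0 := hK ((Submodule.Quotient.mk_eq_zero _).1 h)
  rw [hg, inversePow, fractionsQuotientSMul_mkQ, OreLocalization.smul_div_one, one_smul] at h0
  obtain ⟨m', hm'⟩ := mem_localizationImage.1 <| (Submodule.Quotient.mk_eq_zero _).1 h0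
  obtain ⟨u, v, h1, h2⟩ := OreLocalization.oreDiv_eq_iff.1 hm'
  obtain ⟨_, k, rfl⟩ := u
  have h3 : t ^ k * t ^ n = v := by simpa using h2
  refine ⟨k, m', ?_⟩
  rw [pow_add, h3]
  exact h1

end FractionTensor

variable {t : R} (ht : IsLocallyAdNilpotent t)

/-- If `A → B → C` is exact at `B`, and both `C` and the cokernel of `B → C` are torsion-free, then
the twisting functor keeps the exactness at `B`. -/
theorem twistingFunctor_exact {A B C : ModuleCat.{u} R} (φ : A ⟶ B) (ψ : B ⟶ C)
    (hAB : ∀ b : B, ψ.hom b = 0 → ∃ a : A, φ.hom a = b)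
    (hC : ∀ (n : ℕ) (c : C) (b : B), t ^ n • c = ψ.hom b → ∃ b' : B, ψ.hom b' = c)
    (hinj : ∀ c : C, t • c = 0 → c = 0)
    (z : (twistingFunctor ht).obj B) (hz : ((twistingFunctor ht).map ψ).hom z = 0) :
    ∃ y, ((twistingFunctor ht).map φ).hom y = z := by
  let := oreSetPowers ht
  have hpow : ∀ (n : ℕ) (c : C), t ^ n • c = 0 → c = 0 := by
    intro n
    induction n with
    | zero => intro c hc; simpa using hc
    | succ n ih =>
      intro c hc
      exact ih c (hinj _ (by rw [← mul_smul, ← pow_succ']; exact hc))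
  obtain ⟨n, b, rfl⟩ := exists_eq_fractionTensor (t := t) (M := B) z
  have h1 : fractionTensor t n (ψ.hom b) = 0 := hz
  obtain ⟨k, c, hc⟩ := exists_pow_smul_eq_of_fractionTensor_eq_zero h1
  -- The factor tᵏ is cancelled because C has no t-torsion.
  have h2 : t ^ n • c = ψ.hom b := by
    refine (sub_eq_zero.1 (hpow k _ ?_)).symm
    rw [smul_sub, hc, ← mul_smul, ← pow_add, sub_self]
  obtain ⟨b', hb'⟩ := hC n c b h2
  -- Subtracting tⁿb' does not change t⁻ⁿ ⊗ b: the correction t⁻ⁿ ⊗ tⁿb' equals 1 ⊗ b', and 1 is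
  -- zero in R_(t)/R.
  obtain ⟨a, ha⟩ := hAB (b - t ^ n • b') (by
    rw [map_sub, map_smul, hb', h2, sub_self])
  refine ⟨fractionTensor t n a, ?_⟩
  change fractionTensor t n (φ.hom a) = _
  have h0 := fractionTensor_pow_smul (t := t) 0 n b'
  rw [add_zero] at h0
  rw [ha, fractionTensor_sub, h0, fractionTensor_zero_left, sub_zero]

end TwistingExactness

/-! ## Weight modules and locally finite modules over a triangular decomposition -/

section TriangularDecomposition

attribute [local instance 100] LieRing.ofAssociativeRing

local notation "U(" x ")" => UniversalEnvelopingAlgebra ℂ x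

open UniversalEnvelopingAlgebra (ι)

variable {𝔤 : Type u} [LieRing 𝔤] [LieAlgebra ℂ 𝔤]

section Stable

variable {M : Type*} [AddCommGroup M] [Module ℂ M] [Module U(𝔤) M] [IsScalarTower ℂ U(𝔤) M]

/-- Lifting 𝔤 → K to U(𝔤) and including back into U(𝔤) gives an endomorphism that fixes 𝔤, hence the
identity by uniqueness of lifts. -/
theorem UniversalEnvelopingAlgebra.eq_top_of_ι_mem (K : Subalgebra ℂ U(𝔤))
    (hK : ∀ x : 𝔤, ι ℂ x ∈ K) : K = ⊤ := by
  let g₀ : 𝔤 →ₗ⁅ℂ⁆ K :=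
    { toFun := fun x => ⟨ι ℂ x, hK x⟩
      map_add' := fun x y => Subtype.ext (map_add _ x y)
      map_smul' := fun c x => Subtype.ext (map_smul _ c x)
      map_lie' := fun {x y} => Subtype.ext (LieHom.map_lie _ x y) }
  have hg : K.val.comp (UniversalEnvelopingAlgebra.lift ℂ g₀) = AlgHom.id ℂ U(𝔤) := by
    apply UniversalEnvelopingAlgebra.hom_ext
    ext x
    change ((UniversalEnvelopingAlgebra.lift ℂ g₀ (ι ℂ x) : K) : U(𝔤)) = ι ℂ x
    rw [UniversalEnvelopingAlgebra.lift_ι_apply]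
    rfl
  refine eq_top_iff.2 fun r _ => ?_
  rw [← show _ = r from DFunLike.congr_fun hg r]
  exact (UniversalEnvelopingAlgebra.lift ℂ g₀ r).2

/-- A subspace of a `𝔤`-module that is stable under `𝔤`, as a `U(𝔤)`-submodule. -/
def stableSubmodule (S : Submodule ℂ M) (hS : ∀ (x : 𝔤), ∀ m ∈ S, ι ℂ x • m ∈ S) :
    Submodule U(𝔤) M where
  carrier := S
  add_mem' := S.add_mem
  zero_mem' := S.zero_mem
  smul_mem' := by
    let K : Subalgebra ℂ U(𝔤) :=
      { carrier := {r | ∀ m ∈ S, r • m ∈ S}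
        mul_mem' := fun {a b} ha hb m hm => by
          rw [mul_smul]; exact ha _ (hb m hm)
        add_mem' := fun {a b} ha hb m hm => by
          rw [add_smul]; exact S.add_mem (ha m hm) (hb m hm)
        algebraMap_mem' := fun c m hm => by
          rw [algebraMap_smul]; exact S.smul_mem c hm }
    have : K = ⊤ := UniversalEnvelopingAlgebra.eq_top_of_ι_mem K hS
    intro r m hm
    exact (this ▸ Algebra.mem_top : r ∈ K) m hm

theorem mem_stableSubmodule {S : Submodule ℂ M} {hS : ∀ (x : 𝔤), ∀ m ∈ S, ι ℂ x • m ∈ S} {m : M} :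
    m ∈ stableSubmodule S hS ↔ m ∈ S := Iff.rfl

variable (M) in
/-- The action map `𝔤 → End M`. -/
noncomputable def lieAct : 𝔤 →ₗ[ℂ] Module.End ℂ M :=
  (Algebra.lsmul ℂ ℂ M).toLinearMap ∘ₗ (ι ℂ : 𝔤 →ₗ⁅ℂ⁆ U(𝔤)).toLinearMap

theorem lieAct_apply (x : 𝔤) (m : M) : lieAct M x m = ι ℂ x • m := rfl

omit [Module ℂ M] [IsScalarTower ℂ U(𝔤) M] in
theorem ι_smul_smul (x y : 𝔤) (m : M) :
    ι ℂ x • ι ℂ y • m = ι ℂ ⁅x, y⁆ • m + ι ℂ y • ι ℂ x • m := by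
  rw [LieHom.map_lie, LieRing.of_associative_ring_bracket, sub_smul, mul_smul, mul_smul,
    sub_add_cancel]

theorem ι_smul_smul_eq (c : ℂ) (x : 𝔤) (m : M) : ι ℂ (c • x) • m = c • ι ℂ x • m := by
  rw [map_smul, smul_assoc]

end Stable

/-! ### Weight spaces and their independence. -/

section Weights

variable (𝔥 : LieSubalgebra ℂ 𝔤)
variable (M : Type*) [AddCommGroup M] [Module ℂ M] [Module U(𝔤) M] [IsScalarTower ℂ U(𝔤) M]

/-- The space of vectors of weight `μ` of a `𝔤`-module. -/
def wtSpace (μ : Module.Dual ℂ 𝔥) : Submodule ℂ M where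
  carrier := {m | ∀ h : 𝔥, ι ℂ (h : 𝔤) • m = μ h • m}
  add_mem' := fun {x y} hx hy h => by rw [smul_add, smul_add, hx h, hy h]
  zero_mem' := fun h => by rw [smul_zero, smul_zero]
  smul_mem' := fun c x hx h => by rw [smul_comm, hx h, smul_comm]

/-- The module is the sum of its weight spaces. -/
def IsWeight : Prop := ⨆ μ : Module.Dual ℂ 𝔥, wtSpace 𝔥 M μ = ⊤

variable {𝔥 M}

theorem ι_smul_mem_wtSpace {μ ν : Module.Dual ℂ 𝔥} {x : 𝔤}
    (hx : ∀ h : 𝔥, ⁅(h : 𝔤), x⁆ = ν h • x) {m : M} (hm : m ∈ wtSpace 𝔥 M μ) :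
    ι ℂ x • m ∈ wtSpace 𝔥 M (μ + ν) := fun h => by
  rw [ι_smul_smul, hx, ι_smul_smul_eq, hm h, smul_comm (ι ℂ x), ← add_smul, LinearMap.add_apply,
    add_comm]

theorem central_smul_mem_wtSpace {μ : Module.Dual ℂ 𝔥} {z : U(𝔤)}
    (hz : ∀ x : 𝔤, ι ℂ x * z = z * ι ℂ x) {m : M} (hm : m ∈ wtSpace 𝔥 M μ) :
    z • m ∈ wtSpace 𝔥 M μ := fun h => by
  rw [← mul_smul, hz, mul_smul, hm h, smul_comm]

/-- Two distinct weights ν and a differ at some h; then h - a(h) kills the component of weight a and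
rescales that of weight ν by a nonzero number. For `K = ⊥` this is the linear independence of the
weight spaces. -/
theorem mem_of_sum_mem (K : Submodule U(𝔤) M) (s : Finset (Module.Dual ℂ 𝔥))
    (c : Module.Dual ℂ 𝔥 → M) (hc : ∀ μ ∈ s, c μ ∈ wtSpace 𝔥 M μ) (hs : ∑ μ ∈ s, c μ ∈ K) :
    ∀ μ ∈ s, c μ ∈ K := by
  classical
  induction s using Finset.induction_on generalizing c with
  | empty => simp
  | insert a s ha ih =>
    have key : ∀ ν ∈ s, c ν ∈ K := by
      intro ν hν
      obtain ⟨h, hh⟩ : ∃ h, ν h ≠ a h := by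
        by_contra hcon
        push Not at hcon
        exact ha (LinearMap.ext hcon ▸ hν)
      have h1 : ∑ μ ∈ s, (μ h - a h) • c μ ∈ K := by
        have h2 : ι ℂ (h : 𝔤) • ∑ μ ∈ insert a s, c μ -
            algebraMap ℂ U(𝔤) (a h) • ∑ μ ∈ insert a s, c μ ∈ K :=
          K.sub_mem (K.smul_mem _ hs) (K.smul_mem _ hs)
        convert h2 using 1
        rw [algebraMap_smul, Finset.sum_insert ha, smul_add, smul_add, Finset.smul_sum,
          Finset.smul_sum, hc a (Finset.mem_insert_self a s) h, add_sub_add_left_eq_sub,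
          ← Finset.sum_sub_distrib]
        refine Finset.sum_congr rfl fun μ hμ => ?_
        rw [hc μ (Finset.mem_insert_of_mem hμ) h, sub_smul]
      have h3 := ih (fun μ => (μ h - a h) • c μ)
        (fun μ hμ => Submodule.smul_mem _ _ (hc μ (Finset.mem_insert_of_mem hμ))) h1 ν hν
      have h4 := K.smul_mem (algebraMap ℂ U(𝔤) (ν h - a h)⁻¹) h3
      rwa [algebraMap_smul, smul_smul, inv_mul_cancel₀ (sub_ne_zero.2 hh), one_smul] at h4
    intro μ hμ
    rcases Finset.mem_insert.1 hμ with rfl | hμ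
    · rw [Finset.sum_insert ha] at hs
      exact (K.add_mem_iff_left (K.sum_mem key)).1 hs
    · exact key μ hμ

theorem exists_sum_of_mem_iSup_wtSpace {p : Module.Dual ℂ 𝔥 → Prop} {m : M}
    (hm : m ∈ ⨆ (μ : Module.Dual ℂ 𝔥) (_ : p μ), wtSpace 𝔥 M μ) :
    ∃ (s : Finset (Module.Dual ℂ 𝔥)) (c : Module.Dual ℂ 𝔥 → M),
      (∀ μ ∈ s, p μ) ∧ (∀ μ ∈ s, c μ ∈ wtSpace 𝔥 M μ) ∧ ∑ μ ∈ s, c μ = m := by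
  classical
  rw [Submodule.mem_iSup_iff_exists_finsupp] at hm
  obtain ⟨f, hf, rfl⟩ := hm
  refine ⟨f.support, f, fun μ hμ => ?_, fun μ hμ => ?_, rfl⟩
  · by_contra hp
    have := hf μ
    rw [iSup_neg hp] at this
    exact Finsupp.mem_support_iff.1 hμ this
  · exact (iSup_le fun _ => le_rfl : (⨆ _ : p μ, wtSpace 𝔥 M μ) ≤ _) (hf μ)

theorem IsWeight.exists_sum (hM : IsWeight 𝔥 M) (m : M) :
    ∃ (s : Finset (Module.Dual ℂ 𝔥)) (c : Module.Dual ℂ 𝔥 → M),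
      (∀ μ ∈ s, c μ ∈ wtSpace 𝔥 M μ) ∧ ∑ μ ∈ s, c μ = m := by
  obtain ⟨s, c, -, h⟩ := exists_sum_of_mem_iSup_wtSpace (𝔥 := 𝔥) (p := fun _ => True) (m := m) (by
    simp only [iSup_pos]
    rw [show ⨆ μ : Module.Dual ℂ 𝔥, wtSpace 𝔥 M μ = ⊤ from hM]
    trivial)
  exact ⟨s, c, h⟩

/-- In a weight module, an element of a submodule is the sum of weight vectors of it. -/
theorem IsWeight.exists_sum_mem (hM : IsWeight 𝔥 M) {K : Submodule U(𝔤) M} {m : M} (hm : m ∈ K) :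
    ∃ (s : Finset (Module.Dual ℂ 𝔥)) (c : Module.Dual ℂ 𝔥 → M),
      (∀ μ ∈ s, c μ ∈ K) ∧ (∀ μ ∈ s, c μ ∈ wtSpace 𝔥 M μ) ∧ ∑ μ ∈ s, c μ = m := by
  obtain ⟨s, c, hc, rfl⟩ := hM.exists_sum m
  exact ⟨s, c, mem_of_sum_mem K s c hc hm, hc, rfl⟩

variable {N : Type*} [AddCommGroup N] [Module ℂ N] [Module U(𝔤) N] [IsScalarTower ℂ U(𝔤) N]

theorem map_mem_wtSpace (φ : M →ₗ[U(𝔤)] N) {μ : Module.Dual ℂ 𝔥} {m : M}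
    (hm : m ∈ wtSpace 𝔥 M μ) : φ m ∈ wtSpace 𝔥 N μ := fun h => by
  rw [← map_smul, hm h, ← algebraMap_smul U(𝔤), map_smul, algebraMap_smul]

theorem mem_wtSpace_of_map_mem (φ : M →ₗ[U(𝔤)] N) (hφ : Function.Injective φ)
    {μ : Module.Dual ℂ 𝔥} {m : M} (hm : φ m ∈ wtSpace 𝔥 N μ) : m ∈ wtSpace 𝔥 M μ := fun h => by
  refine hφ ?_
  rw [map_smul, hm h, ← algebraMap_smul U(𝔤), ← map_smul, algebraMap_smul]

theorem isWeight_of_forall (h : ∀ m : M, m ∈ ⨆ μ : Module.Dual ℂ 𝔥, wtSpace 𝔥 M μ) :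
    IsWeight 𝔥 M := eq_top_iff.2 fun m _ => h m

theorem IsWeight.of_injective (hN : IsWeight 𝔥 N) (φ : M →ₗ[U(𝔤)] N)
    (hφ : Function.Injective φ) : IsWeight 𝔥 M := by
  refine isWeight_of_forall fun m => ?_
  obtain ⟨s, c, hcK, hc, h⟩ := hN.exists_sum_mem (LinearMap.mem_range_self φ m)
  choose! d hd using hcK
  have : m = ∑ μ ∈ s, d μ := hφ (by rw [map_sum, ← h]; exact Finset.sum_congr rfl fun μ hμ =>
    (hd μ hμ).symm)
  rw [this]
  refine Submodule.sum_mem _ fun μ hμ => Submodule.mem_iSup_of_mem μ ?_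
  exact mem_wtSpace_of_map_mem φ hφ (by rw [hd μ hμ]; exact hc μ hμ)

theorem IsWeight.of_surjective (hM : IsWeight 𝔥 M) (φ : M →ₗ[U(𝔤)] N)
    (hφ : Function.Surjective φ) : IsWeight 𝔥 N := by
  refine isWeight_of_forall fun n => ?_
  obtain ⟨m, rfl⟩ := hφ n
  obtain ⟨s, c, hc, rfl⟩ := hM.exists_sum m
  rw [map_sum]
  exact Submodule.sum_mem _ fun μ hμ => Submodule.mem_iSup_of_mem μ (map_mem_wtSpace φ (hc μ hμ))

/-- A weight vector has a preimage of the same weight. -/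
theorem IsWeight.exists_lift (hM : IsWeight 𝔥 M) (φ : M →ₗ[U(𝔤)] N)
    (hφ : Function.Surjective φ) {μ : Module.Dual ℂ 𝔥} {n : N} (hn : n ∈ wtSpace 𝔥 N μ) :
    ∃ m ∈ wtSpace 𝔥 M μ, φ m = n := by
  classical
  obtain ⟨m, rfl⟩ := hφ n
  obtain ⟨s, c, hc, rfl⟩ := hM.exists_sum m
  let c' : Module.Dual ℂ 𝔥 → M := fun ν => if ν ∈ s then c ν else 0
  have hc' : ∀ ν, c' ν ∈ wtSpace 𝔥 M ν := fun ν => by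
    by_cases h : ν ∈ s
    · simpa [c', h] using hc ν h
    · simp [c', h]
  -- The weight μ may be missing from `s`; extension by zero lets it be added as an index without
  -- changing the sum.
  have hsum : ∑ ν ∈ insert μ s, c' ν = ∑ ν ∈ s, c ν := by
    have h1 : ∑ ν ∈ s, c ν = ∑ ν ∈ s, c' ν :=
      Finset.sum_congr rfl fun ν hν => by simp [c', hν]
    rw [h1]
    exact (Finset.sum_subset (Finset.subset_insert μ s) fun ν _ h => by simp [c', h]).symm
  refine ⟨c' μ, hc' μ, ?_⟩
  rw [← hsum, map_sum] at hn ⊢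
  -- Subtracting n from the μ-component of its own decomposition gives weight vectors with sum zero,
  -- so each of them vanishes; the μ-th one says φ(c' μ) = n.
  have := mem_of_sum_mem (⊥ : Submodule U(𝔤) N) (insert μ s)
    (fun ν => φ (c' ν) - if ν = μ then ∑ ν ∈ insert μ s, φ (c' ν) else 0) (fun ν _ => by
      refine Submodule.sub_mem _ (map_mem_wtSpace φ (hc' ν)) ?_
      split_ifs with h
      · rw [h]; exact hn
      · exact Submodule.zero_mem _) (by
      rw [Finset.sum_sub_distrib, Finset.sum_ite_eq', if_pos (Finset.mem_insert_self μ s),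
        sub_self]
      exact Submodule.zero_mem _) μ (Finset.mem_insert_self μ s)
  rw [if_pos rfl] at this
  exact sub_eq_zero.1 ((Submodule.mem_bot _).1 this)

end Weights

end TriangularDecomposition

/-! ### Abstract triangular decompositions and highest weight vectors. -/

section TriangularData

attribute [local instance 100] LieRing.ofAssociativeRing

local notation "U(" x ")" => UniversalEnvelopingAlgebra ℂ x

open UniversalEnvelopingAlgebra (ι)

/-- A triangular decomposition `𝔤 = 𝔫⁻ ⊕ 𝔥 ⊕ 𝔫` with root vectors `E i`, `F i` of weights
`± wt i`, an element `ρ` of `𝔥` measuring the heights of the `wt i`, and a Casimir element `Ω`. -/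
structure TriangularData {𝔤 : Type u} [LieRing 𝔤] [LieAlgebra ℂ 𝔤] (𝔥 : LieSubalgebra ℂ 𝔤) where
  /-- the index type of the positive roots -/
  I : Type u
  [fintype : Fintype I]
  /-- the positive roots -/
  wt : I → Module.Dual ℂ 𝔥
  /-- the positive root vectors -/
  E : I → 𝔤
  /-- the negative root vectors -/
  F : I → 𝔤
  lie_E : ∀ i (h : 𝔥), ⁅(h : 𝔤), E i⁆ = wt i h • E i
  lie_F : ∀ i (h : 𝔥), ⁅(h : 𝔤), F i⁆ = (-wt i) h • F i
  lie_cartan : ∀ h h' : 𝔥, ⁅(h : 𝔤), (h' : 𝔤)⁆ = 0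
  -- Spanning is all that is required; linear independence of the root vectors plays no role.
  span_eq_top : ∀ S : Submodule ℂ 𝔤, (∀ h : 𝔥, (h : 𝔤) ∈ S) → (∀ i, E i ∈ S) → (∀ i, F i ∈ S) →
    S = ⊤
  /-- the grading element -/
  ρ : 𝔥
  /-- the heights of the positive roots -/
  ht : I → ℕ
  ht_pos : ∀ i, 0 < ht i
  wt_ρ : ∀ i, wt i ρ = ht i
  /-- the Casimir element -/
  Ω : U(𝔤)
  central : ∀ x : 𝔤, ι ℂ x * Ω = Ω * ι ℂ x
  /-- the number of terms in the Cartan part of the Casimir element -/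
  n : ℕ
  /-- first factors of the Cartan part of the Casimir element -/
  c : Fin n → 𝔥
  /-- second factors of the Cartan part of the Casimir element -/
  c' : Fin n → 𝔥
  /-- the linear part of the Casimir element -/
  τ : 𝔥
  /-- the left factors of the nilpotent part of the Casimir element -/
  G : I → 𝔤
  Ω_eq : Ω = ∑ j, ι ℂ (c j : 𝔤) * ι ℂ (c' j : 𝔤) + ι ℂ (τ : 𝔤) + ∑ i, ι ℂ (G i) * ι ℂ (E i)
  -- The finiteness input: on a coset of the root lattice, the Casimir scalar takes a given value
  -- only at bounded heights. It stands in for finiteness statements about central characters.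
  bound : ∀ (lam : Module.Dual ℂ 𝔥) (a : ℂ), ∃ N : ℕ,
    ∀ γ ∈ AddSubgroup.closure (Set.range wt),
      ∑ j, (lam + γ) (c j) * (lam + γ) (c' j) + (lam + γ) τ = a → ‖γ ρ‖ ≤ N

namespace TriangularData

attribute [instance] TriangularData.fintype

variable {𝔤 : Type u} [LieRing 𝔤] [LieAlgebra ℂ 𝔤] {𝔥 : LieSubalgebra ℂ 𝔤} (D : TriangularData 𝔥)
variable {M : Type*} [AddCommGroup M] [Module ℂ M] [Module U(𝔤) M] [IsScalarTower ℂ U(𝔤) M]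

/-- The scalar by which the Casimir element acts on a highest weight vector. -/
noncomputable def χ (μ : Module.Dual ℂ 𝔥) : ℂ := ∑ j, μ (D.c j) * μ (D.c' j) + μ D.τ

theorem ι_smul_mem_of {S T : Submodule ℂ M} (h : ∀ h : 𝔥, ∀ m ∈ S, ι ℂ (h : 𝔤) • m ∈ T)
    (hE : ∀ i, ∀ m ∈ S, ι ℂ (D.E i) • m ∈ T) (hF : ∀ i, ∀ m ∈ S, ι ℂ (D.F i) • m ∈ T)
    (x : 𝔤) : ∀ m ∈ S, ι ℂ x • m ∈ T := by
  let A : Submodule ℂ 𝔤 :=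
    { carrier := {x | ∀ m ∈ S, ι ℂ x • m ∈ T}
      add_mem' := fun {x y} hx hy m hm => by
        rw [map_add, add_smul]; exact T.add_mem (hx m hm) (hy m hm)
      zero_mem' := fun m _ => by rw [map_zero, zero_smul]; exact T.zero_mem
      smul_mem' := fun c x hx m hm => by
        rw [ι_smul_smul_eq]; exact T.smul_mem c (hx m hm) }
  have : A = ⊤ := D.span_eq_top A h hE hF
  exact (this ▸ Submodule.mem_top : x ∈ A)

theorem E_smul_mem_wtSpace (i : D.I) {μ : Module.Dual ℂ 𝔥} {m : M} (hm : m ∈ wtSpace 𝔥 M μ) :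
    ι ℂ (D.E i) • m ∈ wtSpace 𝔥 M (μ + D.wt i) :=
  ι_smul_mem_wtSpace (D.lie_E i) hm

theorem F_smul_mem_wtSpace (i : D.I) {μ : Module.Dual ℂ 𝔥} {m : M} (hm : m ∈ wtSpace 𝔥 M μ) :
    ι ℂ (D.F i) • m ∈ wtSpace 𝔥 M (μ + -D.wt i) :=
  ι_smul_mem_wtSpace (D.lie_F i) hm

/-- The sum of the weight spaces for a set of weights stable under `± wt i` is a submodule. -/
noncomputable def wtSubmodule (M : Type*) [AddCommGroup M] [Module ℂ M] [Module U(𝔤) M]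
    [IsScalarTower ℂ U(𝔤) M] (p : Module.Dual ℂ 𝔥 → Prop) (hp : ∀ μ i, p μ → p (μ + D.wt i))
    (hp' : ∀ μ i, p μ → p (μ + -D.wt i)) : Submodule U(𝔤) M :=
  stableSubmodule (⨆ (μ : Module.Dual ℂ 𝔥) (_ : p μ), wtSpace 𝔥 M μ) fun x => by
    refine D.ι_smul_mem_of ?_ ?_ ?_ x
    · intro h m hm
      obtain ⟨s, c, hs, hc, rfl⟩ := exists_sum_of_mem_iSup_wtSpace hm
      rw [Finset.smul_sum]
      refine Submodule.sum_mem _ fun μ hμ => ?_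
      rw [hc μ hμ h]
      exact Submodule.smul_mem _ _
        (Submodule.mem_iSup_of_mem μ (Submodule.mem_iSup_of_mem (hs μ hμ) (hc μ hμ)))
    · intro i m hm
      obtain ⟨s, c, hs, hc, rfl⟩ := exists_sum_of_mem_iSup_wtSpace hm
      rw [Finset.smul_sum]
      exact Submodule.sum_mem _ fun μ hμ => Submodule.mem_iSup_of_mem _
        (Submodule.mem_iSup_of_mem (hp μ i (hs μ hμ)) (D.E_smul_mem_wtSpace i (hc μ hμ)))
    · intro i m hm
      obtain ⟨s, c, hs, hc, rfl⟩ := exists_sum_of_mem_iSup_wtSpace hm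
      rw [Finset.smul_sum]
      exact Submodule.sum_mem _ fun μ hμ => Submodule.mem_iSup_of_mem _
        (Submodule.mem_iSup_of_mem (hp' μ i (hs μ hμ)) (D.F_smul_mem_wtSpace i (hc μ hμ)))

theorem isWeight_of_span_eq_top (D : TriangularData 𝔥) {s : Set M} (hs : Submodule.span U(𝔤) s = ⊤)
    (h : ∀ m ∈ s, m ∈ ⨆ μ : Module.Dual ℂ 𝔥, wtSpace 𝔥 M μ) : IsWeight 𝔥 M := by
  refine isWeight_of_forall fun m => ?_
  have h1 : Submodule.span U(𝔤) s ≤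
      D.wtSubmodule M (fun _ => True) (fun _ _ _ => trivial) (fun _ _ _ => trivial) := by
    refine Submodule.span_le.2 fun m hm => mem_stableSubmodule.2 ?_
    simpa only [iSup_pos] using h m hm
  have h2 := mem_stableSubmodule.1 (h1 (hs ▸ Submodule.mem_top : m ∈ Submodule.span U(𝔤) s))
  simpa only [iSup_pos] using h2

/-- `m` lies in a finite-dimensional subspace stable under the `E i`. -/
def IsLFVector (m : M) : Prop :=
  ∃ V : Submodule ℂ M, m ∈ V ∧ FiniteDimensional ℂ V ∧ ∀ i, ∀ w ∈ V, ι ℂ (D.E i) • w ∈ V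

variable (M) in
/-- Every vector lies in a finite-dimensional subspace stable under the `E i`. -/
def IsLF : Prop := ∀ m : M, D.IsLFVector m

section LocallyFinite

variable [FiniteDimensional ℂ 𝔤]

variable (M) in
/-- The submodule of locally finite vectors. -/
noncomputable def lfSubmodule : Submodule U(𝔤) M :=
  stableSubmodule
    { carrier := {m | D.IsLFVector m}
      add_mem' := by
        rintro a b ⟨V, ha, hV, hVE⟩ ⟨W, hb, hW, hWE⟩
        refine ⟨V ⊔ W, Submodule.add_mem_sup ha hb, inferInstance, fun i w hw => ?_⟩
        obtain ⟨v, hv, w', hw', rfl⟩ := Submodule.mem_sup.1 hw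
        rw [smul_add]
        exact Submodule.add_mem_sup (hVE i v hv) (hWE i w' hw')
      zero_mem' := ⟨⊥, Submodule.zero_mem _, inferInstance, fun i w hw => by
        rw [(Submodule.mem_bot ℂ).1 hw, smul_zero]; exact Submodule.zero_mem _⟩
      smul_mem' := by
        rintro c m ⟨V, hm, hV⟩
        exact ⟨V, V.smul_mem c hm, hV⟩ } (by
    rintro x m ⟨V, hm, hV, hVE⟩
    -- If V is stable under the E i, then so is V + 𝔤V, because E(yv) = [E, y]v + y(Ev).
    refine ⟨V ⊔ Submodule.map₂ (lieAct M) (⊤ : Submodule ℂ 𝔤) V,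
      Submodule.mem_sup_right (Submodule.apply_mem_map₂ _ Submodule.mem_top hm), ?_, ?_⟩
    · have h1 : V.FG := Module.Finite.iff_fg.1 hV
      exact Module.Finite.iff_fg.2 (h1.sup (Submodule.FG.map₂ _ Module.Finite.fg_top h1))
    · intro i w hw
      obtain ⟨v, hv, w', hw', rfl⟩ := Submodule.mem_sup.1 hw
      rw [smul_add]
      refine Submodule.add_mem _ (Submodule.mem_sup_left (hVE i v hv)) ?_
      have : Submodule.map₂ (lieAct M) (⊤ : Submodule ℂ 𝔤) V ≤
          (V ⊔ Submodule.map₂ (lieAct M) (⊤ : Submodule ℂ 𝔤) V).comap (lieAct M (D.E i)) := by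
        refine Submodule.map₂_le.2 fun y _ v hv => ?_
        change ι ℂ (D.E i) • ι ℂ y • v ∈ V ⊔ Submodule.map₂ (lieAct M) (⊤ : Submodule ℂ 𝔤) V
        rw [ι_smul_smul]
        exact Submodule.mem_sup_right (Submodule.add_mem _
          (Submodule.apply_mem_map₂ _ Submodule.mem_top hv)
          (Submodule.apply_mem_map₂ _ Submodule.mem_top (hVE i v hv)))
      exact this hw')

theorem isLF_of_span_eq_top {s : Set M} (hs : Submodule.span U(𝔤) s = ⊤)
    (h : ∀ m ∈ s, D.IsLFVector m) : D.IsLF M := by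
  have h1 : Submodule.span U(𝔤) s ≤ D.lfSubmodule M :=
    Submodule.span_le.2 fun m hm => mem_stableSubmodule.2 (h m hm)
  exact fun m => mem_stableSubmodule.1 (h1 (hs ▸ Submodule.mem_top : m ∈ Submodule.span U(𝔤) s))

end LocallyFinite

section Functoriality

variable {N : Type*} [AddCommGroup N] [Module ℂ N] [Module U(𝔤) N] [IsScalarTower ℂ U(𝔤) N]

/-- A map of `𝔤`-modules as a `ℂ`-linear map. -/
def _root_.LinearMap.toComplex (φ : M →ₗ[U(𝔤)] N) : M →ₗ[ℂ] N where
  toFun := φ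
  map_add' := map_add φ
  map_smul' c m := by
    rw [RingHom.id_apply, ← algebraMap_smul U(𝔤) c m, map_smul, algebraMap_smul]

variable {D}

theorem IsLFVector.map {m : M} (hm : D.IsLFVector m) (φ : M →ₗ[U(𝔤)] N) :
    D.IsLFVector (φ m) := by
  obtain ⟨V, hm, hV, hVE⟩ := hm
  refine ⟨V.map φ.toComplex, Submodule.mem_map_of_mem hm, inferInstance, ?_⟩
  rintro i _ ⟨w, hw, rfl⟩
  exact ⟨_, hVE i w hw, map_smul φ _ _⟩

theorem IsLF.of_injective (hN : D.IsLF N) (φ : M →ₗ[U(𝔤)] N) (hφ : Function.Injective φ) :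
    D.IsLF M := by
  intro m
  obtain ⟨V, hm, hV, hVE⟩ := hN (φ m)
  refine ⟨V.comap φ.toComplex, hm, ?_, ?_⟩
  · exact Module.Finite.of_injective
      (φ.toComplex.restrict (p := V.comap φ.toComplex) (q := V) fun _ h => h)
      fun a b hab => Subtype.ext (hφ (congrArg Subtype.val hab))
  · intro i w hw
    change φ _ ∈ V
    rw [map_smul]
    exact hVE i _ hw

theorem IsLF.of_surjective (hM : D.IsLF M) (φ : M →ₗ[U(𝔤)] N) (hφ : Function.Surjective φ) :
    D.IsLF N := by
  intro n
  obtain ⟨m, rfl⟩ := hφ n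
  exact (hM m).map φ

end Functoriality

section HighestWeight

variable {D}

theorem exists_nat_of_mem_closure {γ : Module.Dual ℂ 𝔥}
    (hγ : γ ∈ AddSubmonoid.closure (Set.range D.wt)) : ∃ n : ℕ, γ D.ρ = n := by
  induction hγ using AddSubmonoid.closure_induction with
  | mem x hx =>
    obtain ⟨i, rfl⟩ := hx
    exact ⟨D.ht i, D.wt_ρ i⟩
  | zero => exact ⟨0, by simp⟩
  | add x y _ _ hx hy =>
    obtain ⟨a, ha⟩ := hx
    obtain ⟨b, hb⟩ := hy
    exact ⟨a + b, by rw [LinearMap.add_apply, ha, hb, Nat.cast_add]⟩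

theorem exists_int_of_mem_closure {γ : Module.Dual ℂ 𝔥}
    (hγ : γ ∈ AddSubgroup.closure (Set.range D.wt)) : ∃ n : ℤ, γ D.ρ = n := by
  induction hγ using AddSubgroup.closure_induction with
  | mem x hx =>
    obtain ⟨i, rfl⟩ := hx
    exact ⟨D.ht i, by simpa using D.wt_ρ i⟩
  | zero => exact ⟨0, by simp⟩
  | add x y _ _ hx hy =>
    obtain ⟨a, ha⟩ := hx
    obtain ⟨b, hb⟩ := hy
    exact ⟨a + b, by rw [LinearMap.add_apply, ha, hb, Int.cast_add]⟩
  | neg x _ hx =>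
    obtain ⟨a, ha⟩ := hx
    exact ⟨-a, by rw [LinearMap.neg_apply, ha, Int.cast_neg]⟩

theorem mem_closure_group_of_mem_closure {γ : Module.Dual ℂ 𝔥}
    (hγ : γ ∈ AddSubmonoid.closure (Set.range D.wt)) :
    γ ∈ AddSubgroup.closure (Set.range D.wt) :=
  AddSubgroup.le_closure_toAddSubmonoid _ hγ

/-- Eigenvectors for distinct eigenvalues are independent, and V has room for only finitely many.
Neither finite dimension of W nor stability of V under T is needed. -/
theorem _root_.Module.End.finite_eigenvalues_of_finiteDimensional {W : Type*} [AddCommGroup W]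
    [Module ℂ W] (T : Module.End ℂ W) (V : Submodule ℂ W) [FiniteDimensional ℂ V] :
    {z : ℂ | ∃ v ∈ V, v ≠ 0 ∧ T v = z • v}.Finite := by
  set S := {z : ℂ | ∃ v ∈ V, v ≠ 0 ∧ T v = z • v} with hS
  have h : ∀ z : S, ∃ v ∈ V, v ≠ 0 ∧ T v = (z : ℂ) • v := fun z => z.2
  choose v hv hv0 hTv using h
  have hli : LinearIndependent ℂ v := Module.End.eigenvectors_linearIndependent T S v
    fun z => Module.End.hasEigenvector_iff.2 ⟨Module.End.mem_eigenspace_iff.2 (hTv z), hv0 z⟩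
  have hli' : LinearIndependent ℂ (fun z => (⟨v z, hv z⟩ : V)) :=
    LinearIndependent.of_comp V.subtype hli
  have := hli'.finite
  exact Set.toFinite S

variable (D) in
/-- A weight vector `w` outside of a submodule `K` can be raised to a vector that is a highest
weight vector modulo `K`. -/
theorem exists_highest_weight (K : Submodule U(𝔤) M) (V : Submodule ℂ M) [FiniteDimensional ℂ V]
    (hV : ∀ i, ∀ w ∈ V, ι ℂ (D.E i) • w ∈ V) {lam : Module.Dual ℂ 𝔥} {w : M} (hwV : w ∈ V)
    (hw : w ∈ wtSpace 𝔥 M lam) (hwK : w ∉ K) :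
    ∃ γ ∈ AddSubmonoid.closure (Set.range D.wt), ∃ v ∈ V, v ∈ wtSpace 𝔥 M (lam + γ) ∧ v ∉ K ∧
      ∀ i, ι ℂ (D.E i) • v ∈ K := by
  let S : Set ℕ := {n | ∃ γ ∈ AddSubmonoid.closure (Set.range D.wt), γ D.ρ = n ∧
    ∃ v ∈ V, v ∈ wtSpace 𝔥 M (lam + γ) ∧ v ∉ K}
  -- The heights in `S` are, up to the shift by lam(ρ), eigenvalues of ρ with eigenvectors in the
  -- finite-dimensional V. At the largest one no E i can lead outside K again, since each raises the
  -- height.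
  have hS : S.Finite := by
    refine ((Module.End.finite_eigenvalues_of_finiteDimensional (lieAct M (D.ρ : 𝔤)) V).preimage
      (f := fun n : ℕ => lam D.ρ + n) (fun a _ b _ h => by simpa using h)).subset ?_
    rintro n ⟨γ, hγ, hn, v, hv, hvw, hvK⟩
    refine ⟨v, hv, fun h => hvK (h ▸ K.zero_mem), ?_⟩
    rw [lieAct_apply, hvw D.ρ, LinearMap.add_apply, hn]
  obtain ⟨n, ⟨γ, hγ, hn, v, hv, hvw, hvK⟩, hmax⟩ := Set.exists_max_image S id hS
    ⟨0, 0, AddSubmonoid.zero_mem _, by simp, w, hwV, by simpa using hw, hwK⟩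
  refine ⟨γ, hγ, v, hv, hvw, hvK, fun i => ?_⟩
  by_contra hcon
  have := hmax (n + D.ht i) ⟨γ + D.wt i, AddSubmonoid.add_mem _ hγ
    (AddSubmonoid.subset_closure ⟨i, rfl⟩), by
      rw [LinearMap.add_apply, hn, D.wt_ρ, Nat.cast_add],
    _, hV i v hv, by rw [← add_assoc]; exact D.E_smul_mem_wtSpace i hvw, hcon⟩
  have hpos := D.ht_pos i
  simp only [id] at this
  omega

variable (D) in
/-- The Casimir element acts by a scalar on highest weight vectors modulo a submodule. -/
theorem Ω_smul_sub_mem (K : Submodule U(𝔤) M) {μ : Module.Dual ℂ 𝔥} {v : M}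
    (hv : v ∈ wtSpace 𝔥 M μ) (hE : ∀ i, ι ℂ (D.E i) • v ∈ K) :
    D.Ω • v - D.χ μ • v ∈ K := by
  -- In `Ω_eq` the raising operators stand on the right, so the nilpotent part of Ω sends v into K.
  have : D.Ω • v - D.χ μ • v = ∑ i, ι ℂ (D.G i) • ι ℂ (D.E i) • v := by
    rw [D.Ω_eq, χ, add_smul, add_smul, add_smul, Finset.sum_smul, Finset.sum_smul, Finset.sum_smul,
      hv D.τ]
    have : ∀ j, (ι ℂ (D.c j : 𝔤) * ι ℂ (D.c' j : 𝔤)) • v = (μ (D.c j) * μ (D.c' j)) • v := by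
      intro j
      rw [mul_smul, hv, smul_comm, hv, smul_smul, mul_comm]
    simp only [this, mul_smul]
    abel
  rw [this]
  exact K.sum_mem fun i _ => K.smul_mem _ (hE i)

variable (D) in
theorem central_aeval (r : Polynomial ℂ) (x : 𝔤) :
    ι ℂ x * Polynomial.aeval D.Ω r = Polynomial.aeval D.Ω r * ι ℂ x := by
  have h : Polynomial.aeval D.Ω r ∈ Subalgebra.centralizer ℂ {ι ℂ x} := by
    have : D.Ω ∈ Subalgebra.centralizer ℂ {ι ℂ x} := by
      rw [Subalgebra.mem_centralizer_iff]
      rintro _ rfl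
      exact D.central x
    exact Algebra.adjoin_le (Set.singleton_subset_iff.2 this)
      (Polynomial.aeval_mem_adjoin_singleton ℂ D.Ω)
  exact (Subalgebra.mem_centralizer_iff ℂ).1 h _ rfl

variable (D) in
theorem aeval_smul_sub_mem (r : Polynomial ℂ) (K : Submodule U(𝔤) M) {μ : Module.Dual ℂ 𝔥} {v : M}
    (hv : v ∈ wtSpace 𝔥 M μ) (hE : ∀ i, ι ℂ (D.E i) • v ∈ K) :
    Polynomial.aeval D.Ω r • v - r.eval (D.χ μ) • v ∈ K := by
  induction r using Polynomial.induction_on' with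
  | add p q hp hq =>
    rw [map_add, Polynomial.eval_add, add_smul, add_smul, add_sub_add_comm]
    exact K.add_mem hp hq
  | monomial n a =>
    induction n generalizing a with
    | zero =>
      rw [Polynomial.monomial_zero_left, Polynomial.aeval_C, Polynomial.eval_C, algebraMap_smul,
        sub_self]
      exact K.zero_mem
    | succ n ih =>
      have h1 := K.smul_mem (Polynomial.aeval D.Ω (Polynomial.monomial n a))
        (D.Ω_smul_sub_mem K hv hE)
      have h2 := K.smul_mem (algebraMap ℂ U(𝔤) (D.χ μ)) (ih a)
      convert K.add_mem h1 h2 using 1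
      rw [← Polynomial.monomial_mul_X, map_mul, Polynomial.aeval_X, Polynomial.eval_mul,
        Polynomial.eval_X, smul_sub, algebraMap_smul, smul_sub, mul_smul,
        mul_comm, mul_smul, smul_comm (Polynomial.aeval D.Ω _) (D.χ μ) v]
      abel

end HighestWeight

end TriangularData

end TriangularData

/-! ### Finite-dimensional weight spaces, Casimir torsion and noetherianity. -/

section FiniteLength

attribute [local instance 100] LieRing.ofAssociativeRing

local notation "U(" x ")" => UniversalEnvelopingAlgebra ℂ x

open UniversalEnvelopingAlgebra (ι)

namespace TriangularData

variable {𝔤 : Type u} [LieRing 𝔤] [LieAlgebra ℂ 𝔤] {𝔥 : LieSubalgebra ℂ 𝔤} (D : TriangularData 𝔥)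
variable {M : Type*} [AddCommGroup M] [Module ℂ M] [Module U(𝔤) M] [IsScalarTower ℂ U(𝔤) M]

/-- A finite-dimensional subspace that is stable under the Borel subalgebra and spanned by
weight vectors. -/
structure IsBorelStable (V : Submodule ℂ M) : Prop where
  finiteDimensional : FiniteDimensional ℂ V
  E_smul_mem : ∀ i, ∀ w ∈ V, ι ℂ (D.E i) • w ∈ V
  le_span : V ≤ Submodule.span ℂ {w | w ∈ V ∧ ∃ μ : Module.Dual ℂ 𝔥, w ∈ wtSpace 𝔥 M μ}

variable {D}

theorem IsBorelStable.h_smul_mem {V : Submodule ℂ M} (hV : D.IsBorelStable V) (h : 𝔥) :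
    ∀ w ∈ V, ι ℂ (h : 𝔤) • w ∈ V := by
  have : V ≤ V.comap (lieAct M (h : 𝔤)) := by
    refine hV.le_span.trans (Submodule.span_le.2 ?_)
    rintro w ⟨hw, μ, hμ⟩
    change ι ℂ (h : 𝔤) • w ∈ V
    rw [hμ h]
    exact V.smul_mem _ hw
  exact this

theorem IsBorelStable.sup {V W : Submodule ℂ M} (hV : D.IsBorelStable V)
    (hW : D.IsBorelStable W) : D.IsBorelStable (V ⊔ W) where
  finiteDimensional := by
    have := hV.finiteDimensional
    have := hW.finiteDimensional
    infer_instance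
  E_smul_mem i w hw := by
    obtain ⟨a, ha, b, hb, rfl⟩ := Submodule.mem_sup.1 hw
    rw [smul_add]
    exact Submodule.add_mem_sup (hV.E_smul_mem i a ha) (hW.E_smul_mem i b hb)
  le_span := sup_le
    (hV.le_span.trans (Submodule.span_mono fun _ h => ⟨Submodule.mem_sup_left h.1, h.2⟩))
    (hW.le_span.trans (Submodule.span_mono fun _ h => ⟨Submodule.mem_sup_right h.1, h.2⟩))

theorem isBorelStable_bot : D.IsBorelStable (⊥ : Submodule ℂ M) where
  finiteDimensional := inferInstance
  E_smul_mem i w hw := by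
    rw [(Submodule.mem_bot ℂ).1 hw, smul_zero]; exact Submodule.zero_mem _
  le_span := bot_le

/-- The smallest E-stable subspace containing m works: the span of its weight vectors is again
E-stable and contains m, so by minimality it is everything. -/
theorem IsLFVector.exists_isBorelStable {m : M} (hm : D.IsLFVector m) {lam : Module.Dual ℂ 𝔥}
    (hw : m ∈ wtSpace 𝔥 M lam) : ∃ V : Submodule ℂ M, D.IsBorelStable V ∧ m ∈ V := by
  obtain ⟨W, hmW, hW, hWE⟩ := hm
  let N : Submodule ℂ M := sInf {V | m ∈ V ∧ ∀ i, ∀ w ∈ V, ι ℂ (D.E i) • w ∈ V}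
  have hmN : m ∈ N := Submodule.mem_sInf.2 fun V hV => hV.1
  have hNE : ∀ i, ∀ w ∈ N, ι ℂ (D.E i) • w ∈ N := fun i w hw =>
    Submodule.mem_sInf.2 fun V hV => hV.2 i w (Submodule.mem_sInf.1 hw V hV)
  refine ⟨N, ⟨?_, hNE, ?_⟩, hmN⟩
  · exact Submodule.finiteDimensional_of_le (S₂ := W) (sInf_le ⟨hmW, hWE⟩)
  · refine sInf_le ⟨Submodule.subset_span ⟨hmN, lam, hw⟩, fun i w hw => ?_⟩
    have : Submodule.span ℂ {w | w ∈ N ∧ ∃ μ : Module.Dual ℂ 𝔥, w ∈ wtSpace 𝔥 M μ} ≤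
        (Submodule.span ℂ {w | w ∈ N ∧ ∃ μ : Module.Dual ℂ 𝔥, w ∈ wtSpace 𝔥 M μ}).comap
          (lieAct M (D.E i)) := by
      refine Submodule.span_le.2 ?_
      rintro w ⟨hw, μ, hμ⟩
      exact Submodule.subset_span ⟨hNE i w hw, _, D.E_smul_mem_wtSpace i hμ⟩
    exact this hw

theorem exists_isBorelStable_of_finite (hW : IsWeight 𝔥 M) (hL : D.IsLF M) (s : Finset M) :
    ∃ V : Submodule ℂ M, D.IsBorelStable V ∧ (s : Set M) ⊆ V := by
  classical
  have h1 : ∀ m : M, ∃ V : Submodule ℂ M, D.IsBorelStable V ∧ m ∈ V := by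
    intro m
    obtain ⟨t, c, hc, rfl⟩ := hW.exists_sum m
    induction t using Finset.induction_on with
    | empty => exact ⟨⊥, isBorelStable_bot, by simp⟩
    | insert a t ha ih =>
      obtain ⟨V, hV, hV'⟩ := ih fun μ hμ => hc μ (Finset.mem_insert_of_mem hμ)
      obtain ⟨W, hW, hW'⟩ := (hL (c a)).exists_isBorelStable (hc a (Finset.mem_insert_self a t))
      refine ⟨W ⊔ V, hW.sup hV, ?_⟩
      rw [Finset.sum_insert ha]
      exact Submodule.add_mem_sup hW' hV'
  induction s using Finset.induction_on with
  | empty => exact ⟨⊥, isBorelStable_bot, by simp⟩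
  | insert a s ha ih =>
    obtain ⟨V, hV, hV'⟩ := ih
    obtain ⟨W, hW, hW'⟩ := h1 a
    refine ⟨W ⊔ V, hW.sup hV, ?_⟩
    rw [Finset.coe_insert]
    exact Set.insert_subset (Submodule.mem_sup_left hW')
      fun x hx => Submodule.mem_sup_right (hV' hx)

theorem exists_isBorelStable_span [Module.Finite U(𝔤) M] (hW : IsWeight 𝔥 M) (hL : D.IsLF M) :
    ∃ V : Submodule ℂ M, D.IsBorelStable V ∧ Submodule.span U(𝔤) (V : Set M) = ⊤ := by
  obtain ⟨s, hs⟩ := (Module.Finite.fg_top : (⊤ : Submodule U(𝔤) M).FG)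
  obtain ⟨V, hV, hsV⟩ := exists_isBorelStable_of_finite hW hL s
  exact ⟨V, hV, eq_top_iff.2 (hs ▸ Submodule.span_mono hsV)⟩

variable (D) in
/-- The vectors `F i₁ ⋯ F iₖ w`, for weight vectors `w` in `V`. -/
def loweringWords (V : Submodule ℂ M) : ℕ → Set M
  | 0 => {w | w ∈ V ∧ ∃ μ : Module.Dual ℂ 𝔥, w ∈ wtSpace 𝔥 M μ}
  | k + 1 => {w | ∃ i, ∃ w' ∈ loweringWords V k, w = ι ℂ (D.F i) • w'}

variable (D) in
/-- The span of the words of length at most `k` in the `F i` on a subspace. -/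
noncomputable def loweringSpan (V : Submodule ℂ M) (k : ℕ) : Submodule ℂ M :=
  Submodule.span ℂ {w | ∃ j ≤ k, w ∈ D.loweringWords V j}

theorem mem_loweringSpan {V : Submodule ℂ M} {j k : ℕ} (h : j ≤ k) {w : M}
    (hw : w ∈ D.loweringWords V j) : w ∈ D.loweringSpan V k :=
  Submodule.subset_span ⟨j, h, hw⟩

theorem loweringSpan_mono {V : Submodule ℂ M} {j k : ℕ} (h : j ≤ k) :
    D.loweringSpan V j ≤ D.loweringSpan V k :=
  Submodule.span_mono fun _ ⟨i, hi, hw⟩ => ⟨i, hi.trans h, hw⟩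

theorem F_smul_mem_loweringSpan {V : Submodule ℂ M} {k : ℕ} (i : D.I) :
    ∀ w ∈ D.loweringSpan V k, ι ℂ (D.F i) • w ∈ D.loweringSpan V (k + 1) := by
  have : D.loweringSpan V k ≤ (D.loweringSpan V (k + 1)).comap (lieAct M (D.F i)) := by
    refine Submodule.span_le.2 ?_
    rintro w ⟨j, hj, hw⟩
    exact mem_loweringSpan (Nat.succ_le_succ hj) ⟨i, w, hw, rfl⟩
  exact this

theorem IsBorelStable.loweringSpan_zero {V : Submodule ℂ M} (hV : D.IsBorelStable V) :
    D.loweringSpan V 0 = V := by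
  refine le_antisymm (Submodule.span_le.2 ?_) (hV.le_span.trans (Submodule.span_mono ?_))
  · rintro w ⟨j, hj, hw⟩
    obtain rfl := Nat.le_zero.1 hj
    exact hw.1
  · exact fun w hw => ⟨0, le_rfl, hw⟩

/-- A substitute for the PBW ordering. Moving h or E i past the leftmost F of a word costs a
commutator in 𝔤 applied to a shorter word, and by induction that raises the length by at most one.
The three claims have to be proved together. -/
theorem IsBorelStable.smul_mem_loweringSpan {V : Submodule ℂ M} (hV : D.IsBorelStable V) (k : ℕ) :
    (∀ x : 𝔤, ∀ w ∈ D.loweringSpan V k, ι ℂ x • w ∈ D.loweringSpan V (k + 1)) ∧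
    (∀ h : 𝔥, ∀ w ∈ D.loweringSpan V k, ι ℂ (h : 𝔤) • w ∈ D.loweringSpan V k) ∧
    (∀ i, ∀ w ∈ D.loweringSpan V k, ι ℂ (D.E i) • w ∈ D.loweringSpan V k) := by
  have key : ∀ k, (∀ h : 𝔥, ∀ w ∈ D.loweringSpan V k, ι ℂ (h : 𝔤) • w ∈ D.loweringSpan V k) →
      (∀ i, ∀ w ∈ D.loweringSpan V k, ι ℂ (D.E i) • w ∈ D.loweringSpan V k) →
      ∀ x : 𝔤, ∀ w ∈ D.loweringSpan V k, ι ℂ x • w ∈ D.loweringSpan V (k + 1) :=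
    fun k hh hE => D.ι_smul_mem_of
      (fun h w hw => loweringSpan_mono k.le_succ (hh h w hw))
      (fun i w hw => loweringSpan_mono k.le_succ (hE i w hw))
      (fun i w hw => F_smul_mem_loweringSpan i w hw)
  induction k with
  | zero =>
    have h1 : ∀ h : 𝔥, ∀ w ∈ D.loweringSpan V 0, ι ℂ (h : 𝔤) • w ∈ D.loweringSpan V 0 := by
      rw [hV.loweringSpan_zero]; exact hV.h_smul_mem
    have h2 : ∀ i, ∀ w ∈ D.loweringSpan V 0, ι ℂ (D.E i) • w ∈ D.loweringSpan V 0 := by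
      rw [hV.loweringSpan_zero]; exact hV.E_smul_mem
    exact ⟨key 0 h1 h2, h1, h2⟩
  | succ k ih =>
    obtain ⟨ih1, ih2, ih3⟩ := ih
    have step : ∀ x : 𝔤, (∀ w ∈ D.loweringSpan V k, ι ℂ x • w ∈ D.loweringSpan V k) →
        ∀ w ∈ D.loweringSpan V (k + 1), ι ℂ x • w ∈ D.loweringSpan V (k + 1) := by
      intro x hx
      have : D.loweringSpan V (k + 1) ≤ (D.loweringSpan V (k + 1)).comap (lieAct M x) := by
        refine Submodule.span_le.2 ?_
        rintro w ⟨j, hj, hw⟩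
        change ι ℂ x • w ∈ D.loweringSpan V (k + 1)
        rcases hj.lt_or_eq with hj | rfl
        · exact loweringSpan_mono k.le_succ (hx w (mem_loweringSpan (Nat.lt_succ_iff.1 hj) hw))
        · obtain ⟨i, w', hw', rfl⟩ := hw
          have hw'' := mem_loweringSpan le_rfl hw'
          rw [ι_smul_smul]
          exact Submodule.add_mem _ (ih1 _ _ hw'') (F_smul_mem_loweringSpan i _ (hx _ hw''))
      exact this
    have h1 := fun h : 𝔥 => step h (ih2 h)
    have h2 := fun i => step (D.E i) (ih3 i)
    exact ⟨key _ h1 h2, h1, h2⟩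

theorem IsBorelStable.span_loweringWords {V : Submodule ℂ M} (hV : D.IsBorelStable V)
    (hspan : Submodule.span U(𝔤) (V : Set M) = ⊤) :
    Submodule.span ℂ {w | ∃ k, w ∈ D.loweringWords V k} = ⊤ := by
  set S := Submodule.span ℂ {w | ∃ k, w ∈ D.loweringWords V k} with hS
  have hk : ∀ k, D.loweringSpan V k ≤ S := fun k =>
    Submodule.span_mono fun w ⟨j, _, hw⟩ => ⟨j, hw⟩
  have hst : ∀ (x : 𝔤), ∀ m ∈ S, ι ℂ x • m ∈ S := by
    intro x
    have : S ≤ S.comap (lieAct M x) := by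
      refine Submodule.span_le.2 ?_
      rintro w ⟨k, hw⟩
      exact hk _ ((hV.smul_mem_loweringSpan k).1 x w (mem_loweringSpan le_rfl hw))
    exact this
  have h1 : Submodule.span U(𝔤) (V : Set M) ≤ stableSubmodule S hst := by
    refine Submodule.span_le.2 fun v hv => mem_stableSubmodule.2 (hk 0 ?_)
    rw [hV.loweringSpan_zero]
    exact hv
  refine eq_top_iff.2 fun m _ => mem_stableSubmodule.1 (h1 ?_)
  rw [hspan]
  trivial

theorem IsBorelStable.finiteDimensional_loweringSpan {V : Submodule ℂ M}
    (hV : D.IsBorelStable V) (k : ℕ) : FiniteDimensional ℂ (D.loweringSpan V k) := by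
  induction k with
  | zero => rw [hV.loweringSpan_zero]; exact hV.finiteDimensional
  | succ k ih =>
    refine Submodule.finiteDimensional_of_le
      (S₂ := D.loweringSpan V k ⊔ ⨆ i, (D.loweringSpan V k).map (lieAct M (D.F i))) ?_
    refine Submodule.span_le.2 ?_
    rintro w ⟨j, hj, hw⟩
    rcases hj.lt_or_eq with hj | rfl
    · exact Submodule.mem_sup_left (mem_loweringSpan (Nat.lt_succ_iff.1 hj) hw)
    · obtain ⟨i, w', hw', rfl⟩ := hw
      exact Submodule.mem_sup_right (Submodule.mem_iSup_of_mem i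
        (Submodule.mem_map_of_mem (f := lieAct M (D.F i)) (mem_loweringSpan le_rfl hw')))

/-- Each letter lowers the ρ-eigenvalue by the height of its root, hence by at least 1; the total
drop n is therefore at least the length of the word. -/
theorem exists_of_mem_loweringWords {V : Submodule ℂ M} {k : ℕ} {w : M}
    (hw : w ∈ D.loweringWords V k) (hw0 : w ≠ 0) :
    ∃ (z : ℂ) (n : ℕ), (∃ v ∈ V, v ≠ 0 ∧ lieAct M (D.ρ : 𝔤) v = z • v) ∧ k ≤ n ∧
      lieAct M (D.ρ : 𝔤) w = (z - n) • w := by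
  induction k generalizing w with
  | zero =>
    obtain ⟨hwV, μ, hμ⟩ := hw
    exact ⟨μ D.ρ, 0, ⟨w, hwV, hw0, hμ D.ρ⟩, le_rfl, by
      rw [Nat.cast_zero, sub_zero]; exact hμ D.ρ⟩
  | succ k ih =>
    obtain ⟨i, w', hw', rfl⟩ := hw
    obtain ⟨z, n, hz, hn, h⟩ := ih hw' fun h => hw0 (by rw [h, smul_zero])
    refine ⟨z, n + D.ht i, hz, Nat.add_le_add hn (D.ht_pos i), ?_⟩
    rw [lieAct_apply] at h ⊢
    rw [ι_smul_smul, D.lie_F, h, ι_smul_smul_eq, smul_comm (ι ℂ (D.F i)), ← add_smul,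
      LinearMap.neg_apply, D.wt_ρ]
    congr 1
    push_cast
    ring

/-- The spanning eigenvectors with eigenvalue other than z contribute only to the other eigenspaces,
which are independent of the z-eigenspace. -/
theorem _root_.Module.End.eigenspace_le_of_span {W : Type*} [AddCommGroup W] [Module ℂ W]
    (T : Module.End ℂ W) {s : Set W} (hs : Submodule.span ℂ s = ⊤)
    (hT : ∀ w ∈ s, ∃ z : ℂ, T w = z • w) (z : ℂ) (V : Submodule ℂ W)
    (hV : ∀ w ∈ s, T w = z • w → w ∈ V) : T.eigenspace z ≤ V := by
  have h1 : (⊤ : Submodule ℂ W) ≤ (V ⊓ T.eigenspace z) ⊔ ⨆ (y : ℂ) (_ : y ≠ z), T.eigenspace y := by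
    rw [← hs]
    refine Submodule.span_le.2 fun w hw => ?_
    obtain ⟨y, hy⟩ := hT w hw
    by_cases h : y = z
    · subst h
      exact Submodule.mem_sup_left ⟨hV w hw hy, Module.End.mem_eigenspace_iff.2 hy⟩
    · exact Submodule.mem_sup_right (Submodule.mem_iSup_of_mem y (Submodule.mem_iSup_of_mem h
        (Module.End.mem_eigenspace_iff.2 hy)))
  intro m hm
  obtain ⟨a, ha, b, hb, rfl⟩ := Submodule.mem_sup.1 (h1 (Submodule.mem_top : m ∈ ⊤))
  have hb' : b ∈ T.eigenspace z := by
    have := Submodule.sub_mem _ hm ha.2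
    rwa [add_sub_cancel_left] at this
  have : b = 0 := (Submodule.disjoint_def.1 (Module.End.eigenspaces_iSupIndep T z)) b hb' hb
  rw [this, add_zero]
  exact ha.1

/-- The eigenspaces of the grading element on an object of `𝒪` are finite-dimensional. -/
theorem finiteDimensional_eigenspace [Module.Finite U(𝔤) M] (hW : IsWeight 𝔥 M) (hL : D.IsLF M)
    (z : ℂ) : FiniteDimensional ℂ ((lieAct M (D.ρ : 𝔤)).eigenspace z) := by
  obtain ⟨V, hV, hspan⟩ := exists_isBorelStable_span hW hL
  have := hV.finiteDimensional
  -- The bound `K` is on the distance from z to the eigenvalues of ρ on V. A nonzero word with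
  -- eigenvalue z has dropped from one of those eigenvalues y by exactly |y - z|, so its length is
  -- at most `K`.
  obtain ⟨K, hK⟩ := ((Module.End.finite_eigenvalues_of_finiteDimensional
    (lieAct M (D.ρ : 𝔤)) V).image fun y => ‖y - z‖).bddAbove
  obtain ⟨K', hK'⟩ := exists_nat_ge K
  have := hV.finiteDimensional_loweringSpan K'
  refine Submodule.finiteDimensional_of_le (S₂ := D.loweringSpan V K') ?_
  refine Module.End.eigenspace_le_of_span _ (hV.span_loweringWords hspan) ?_ z _ ?_
  · rintro w ⟨k, hw⟩
    by_cases hw0 : w = 0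
    · exact ⟨0, by rw [hw0, map_zero, smul_zero]⟩
    · obtain ⟨y, n, -, -, h⟩ := exists_of_mem_loweringWords hw hw0
      exact ⟨_, h⟩
  · rintro w ⟨k, hw⟩ hz
    by_cases hw0 : w = 0
    · rw [hw0]; exact Submodule.zero_mem _
    · obtain ⟨y, n, hy, hkn, h⟩ := exists_of_mem_loweringWords hw hw0
      refine mem_loweringSpan ?_ hw
      have h1 : y - n = z := smul_left_injective ℂ hw0 (h.symm.trans hz)
      have h2 : ‖y - z‖ = n := by
        rw [← h1, sub_sub_cancel, Complex.norm_natCast]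
      have h3 : (n : ℝ) ≤ K := h2 ▸ hK ⟨y, hy, rfl⟩
      exact hkn.trans (Nat.cast_le.1 (h3.trans hK'))

theorem wtSpace_le_eigenspace (μ : Module.Dual ℂ 𝔥) :
    wtSpace 𝔥 M μ ≤ (lieAct M (D.ρ : 𝔤)).eigenspace (μ D.ρ) :=
  fun _ hm => Module.End.mem_eigenspace_iff.2 (hm D.ρ)

theorem finiteDimensional_wtSpace [Module.Finite U(𝔤) M] (hW : IsWeight 𝔥 M) (hL : D.IsLF M)
    (μ : Module.Dual ℂ 𝔥) : FiniteDimensional ℂ (wtSpace 𝔥 M μ) :=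
  have := finiteDimensional_eigenspace hW hL (μ D.ρ)
  Submodule.finiteDimensional_of_le (wtSpace_le_eigenspace (D := D) μ)

/-- A submodule containing all weight vectors of a weight module is everything. -/
theorem eq_top_of_wtSpace_le (hW : IsWeight 𝔥 M) (K : Submodule U(𝔤) M)
    (hK : ∀ μ : Module.Dual ℂ 𝔥, ∀ m ∈ wtSpace 𝔥 M μ, m ∈ K) : K = ⊤ := by
  refine eq_top_iff.2 fun m _ => ?_
  obtain ⟨s, c, hc, rfl⟩ := hW.exists_sum m
  exact K.sum_mem fun μ hμ => hK μ _ (hc μ hμ)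

theorem smul_comm_aeval (r : Polynomial ℂ) (u : U(𝔤)) :
    u * Polynomial.aeval D.Ω r = Polynomial.aeval D.Ω r * u := by
  have h := UniversalEnvelopingAlgebra.eq_top_of_ι_mem
    (Subalgebra.centralizer ℂ {Polynomial.aeval D.Ω r}) fun x => by
      rw [Subalgebra.mem_centralizer_iff]
      rintro _ rfl
      exact (D.central_aeval r x).symm
  have hu : u ∈ Subalgebra.centralizer ℂ {Polynomial.aeval D.Ω r} := h.symm ▸ Algebra.mem_top
  exact ((Subalgebra.mem_centralizer_iff ℂ).1 hu _ rfl).symm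

/-- Ω is central, so it acts on the finite-dimensional weight space; its minimal polynomial there
serves. -/
theorem exists_aeval_smul_eq_zero_of_mem_wtSpace [Module.Finite U(𝔤) M] (hW : IsWeight 𝔥 M)
    (hL : D.IsLF M) {μ : Module.Dual ℂ 𝔥} {m : M} (hm : m ∈ wtSpace 𝔥 M μ) :
    ∃ r : Polynomial ℂ, r ≠ 0 ∧ Polynomial.aeval D.Ω r • m = 0 := by
  have := finiteDimensional_wtSpace hW hL μ
  let T : Module.End ℂ M := Algebra.lsmul ℂ ℂ M D.Ω
  have hT : ∀ m ∈ wtSpace 𝔥 M μ, T m ∈ wtSpace 𝔥 M μ := fun m hm =>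
    central_smul_mem_wtSpace D.central hm
  let T' := T.restrict hT
  refine ⟨minpoly ℂ T', minpoly.ne_zero (Algebra.IsIntegral.isIntegral T'), ?_⟩
  have h1 : ∀ r : Polynomial ℂ, ∀ m : wtSpace 𝔥 M μ,
      ((Polynomial.aeval T' r m : wtSpace 𝔥 M μ) : M) = Polynomial.aeval D.Ω r • (m : M) := by
    intro r m
    induction r using Polynomial.induction_on' with
    | add p q hp hq =>
      rw [map_add, map_add, LinearMap.add_apply, Submodule.coe_add, hp, hq, add_smul]
    | monomial n a =>
      induction n generalizing a m with
      | zero =>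
        rw [Polynomial.monomial_zero_left, Polynomial.aeval_C, Polynomial.aeval_C,
          algebraMap_smul]
        rfl
      | succ n ih =>
        rw [← Polynomial.monomial_mul_X, map_mul, map_mul, Polynomial.aeval_X, Polynomial.aeval_X,
          Module.End.mul_apply, ih, mul_smul]
        rfl
  have h2 := h1 (minpoly ℂ T') ⟨m, hm⟩
  rw [minpoly.aeval] at h2
  exact h2.symm

/-- An object of `𝒪` is killed by a nonzero polynomial in the Casimir element. -/
theorem exists_aeval_smul_eq_zero [Module.Finite U(𝔤) M] (hW : IsWeight 𝔥 M) (hL : D.IsLF M) :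
    ∃ r : Polynomial ℂ, r ≠ 0 ∧ ∀ m : M, Polynomial.aeval D.Ω r • m = 0 := by
  classical
  let K : Submodule U(𝔤) M :=
    { carrier := {m | ∃ r : Polynomial ℂ, r ≠ 0 ∧ Polynomial.aeval D.Ω r • m = 0}
      add_mem' := by
        rintro a b ⟨p, hp, hpa⟩ ⟨q, hq, hqb⟩
        refine ⟨p * q, mul_ne_zero hp hq, ?_⟩
        rw [smul_add, map_mul, mul_smul, mul_smul, hqb, smul_zero, add_zero, ← mul_smul,
          smul_comm_aeval, mul_smul, hpa, smul_zero]
      zero_mem' := ⟨1, one_ne_zero, smul_zero _⟩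
      smul_mem' := by
        rintro u a ⟨p, hp, hpa⟩
        exact ⟨p, hp, by rw [← mul_smul, ← smul_comm_aeval, mul_smul, hpa, smul_zero]⟩ }
  have hK : K = ⊤ := eq_top_of_wtSpace_le hW K fun μ m hm =>
    exists_aeval_smul_eq_zero_of_mem_wtSpace hW hL hm
  have hK' : ∀ m : M, ∃ r : Polynomial ℂ, r ≠ 0 ∧ Polynomial.aeval D.Ω r • m = 0 := fun m =>
    (hK ▸ Submodule.mem_top : m ∈ K)
  choose r hr hrm using hK'
  obtain ⟨s, hs⟩ := (Module.Finite.fg_top : (⊤ : Submodule U(𝔤) M).FG)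
  refine ⟨∏ m ∈ s, r m, Finset.prod_ne_zero_iff.2 fun m _ => hr m, fun m => ?_⟩
  have hm : m ∈ Submodule.span U(𝔤) (s : Set M) := hs ▸ Submodule.mem_top
  induction hm using Submodule.span_induction with
  | mem x hx =>
    rw [← Finset.prod_erase_mul s r hx, map_mul, mul_smul, hrm, smul_zero]
  | zero => exact smul_zero _
  | add x y _ _ hx hy => rw [smul_add, hx, hy, add_zero]
  | smul u x _ hx => rw [← mul_smul, ← smul_comm_aeval, mul_smul, hx, smul_zero]

/-- The weights of an object of `𝒪` lie in finitely many cosets of the root lattice. -/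
theorem exists_finset_weights [Module.Finite U(𝔤) M] (hW : IsWeight 𝔥 M) :
    ∃ L : Finset (Module.Dual ℂ 𝔥), ∀ (μ : Module.Dual ℂ 𝔥) (m : M), m ∈ wtSpace 𝔥 M μ → m ≠ 0 →
      ∃ lam ∈ L, μ - lam ∈ AddSubgroup.closure (Set.range D.wt) := by
  classical
  obtain ⟨s, hs⟩ := (Module.Finite.fg_top : (⊤ : Submodule U(𝔤) M).FG)
  choose t c hc hsum using hW.exists_sum
  -- The weights of the components of a finite generating set; every other weight differs from one
  -- of these by an element of the root lattice.
  let L := s.biUnion t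
  let p : Module.Dual ℂ 𝔥 → Prop := fun μ =>
    ∃ lam ∈ L, μ - lam ∈ AddSubgroup.closure (Set.range D.wt)
  have hwt : ∀ i, D.wt i ∈ AddSubgroup.closure (Set.range D.wt) := fun i =>
    AddSubgroup.subset_closure ⟨i, rfl⟩
  have hp : ∀ μ i, p μ → p (μ + D.wt i) := by
    rintro μ i ⟨lam, hlam, h⟩
    exact ⟨lam, hlam, by rw [add_sub_right_comm]; exact AddSubgroup.add_mem _ h (hwt i)⟩
  have hp' : ∀ μ i, p μ → p (μ + -D.wt i) := by
    rintro μ i ⟨lam, hlam, h⟩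
    exact ⟨lam, hlam, by
      rw [add_sub_right_comm]; exact AddSubgroup.add_mem _ h (AddSubgroup.neg_mem _ (hwt i))⟩
  have htop : D.wtSubmodule M p hp hp' = ⊤ := by
    refine eq_top_iff.2 (hs ▸ Submodule.span_le.2 fun m hm => mem_stableSubmodule.2 ?_)
    rw [← hsum m]
    refine Submodule.sum_mem _ fun μ hμ => Submodule.mem_iSup_of_mem μ
      (Submodule.mem_iSup_of_mem ⟨μ, Finset.mem_biUnion.2 ⟨m, hm, hμ⟩, ?_⟩ (hc m μ hμ))
    rw [sub_self]
    exact AddSubgroup.zero_mem _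
  refine ⟨L, fun μ m hm hm0 => ?_⟩
  by_contra hcon
  obtain ⟨s', c', hs', hc', h⟩ := exists_sum_of_mem_iSup_wtSpace
    (mem_stableSubmodule.1 (htop ▸ Submodule.mem_top : m ∈ D.wtSubmodule M p hp hp'))
  have hμs : μ ∉ s' := fun h => hcon (hs' μ h)
  -- The vector m has weight μ but is a sum of vectors of other weights; moving it to the other
  -- side, independence gives m = 0.
  have := mem_of_sum_mem (⊥ : Submodule U(𝔤) M) (insert μ s')
    (fun ν => if ν = μ then -m else c' ν) (fun ν hν => by
      split_ifs with h
      · rw [h]; exact Submodule.neg_mem _ hm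
      · exact hc' ν ((Finset.mem_insert.1 hν).resolve_left h)) (by
      have h1 : ∑ ν ∈ s', (if ν = μ then -m else c' ν) = m := by
        rw [← h]
        exact Finset.sum_congr rfl fun ν hν => if_neg fun he : ν = μ => hμs (he ▸ hν)
      rw [Finset.sum_insert hμs, if_pos rfl, h1, neg_add_cancel]
      exact Submodule.zero_mem _) μ (Finset.mem_insert_self μ s')
  rw [if_pos rfl] at this
  exact hm0 (neg_eq_zero.1 ((Submodule.mem_bot _).1 this))

/-- The objects of `𝒪` are noetherian. -/
theorem isNoetherian [Module.Finite U(𝔤) M] (hW : IsWeight 𝔥 M) (hL : D.IsLF M) :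
    IsNoetherian U(𝔤) M := by
  classical
  obtain ⟨L, hLw⟩ := exists_finset_weights (D := D) hW
  obtain ⟨r, hr0, hr⟩ := exists_aeval_smul_eq_zero hW hL
  choose N hN using D.bound
  -- The sum dominates every individual bound, over the finitely many cosets and the finitely many
  -- possible Casimir eigenvalues. All highest weight vectors of subquotients of M then have their
  -- ρ-eigenvalue in the finite set `Z`.
  let B : ℕ := ∑ lam ∈ L, ∑ a ∈ r.roots.toFinset, N lam a
  let Z : Finset ℂ := (L ×ˢ Finset.Icc (-(B : ℤ)) B).image fun p => p.1 D.ρ + p.2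
  let V : Submodule ℂ M := ⨆ z : Z, (lieAct M (D.ρ : 𝔤)).eigenspace z
  have hfin := fun z : ℂ => finiteDimensional_eigenspace hW hL z
  have hV : FiniteDimensional ℂ V := inferInstance
  let φ : Submodule U(𝔤) M → Submodule ℂ V := fun K =>
    { carrier := {v | (v : M) ∈ K}
      add_mem' := K.add_mem
      zero_mem' := K.zero_mem
      smul_mem' := fun c v hv => by
        change c • (v : M) ∈ K
        rw [← algebraMap_smul U(𝔤)]
        exact K.smul_mem _ hv }
  -- A submodule is controlled by its trace on the finite-dimensional V: if K₁ < K₂, a weight vector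
  -- of K₂ outside K₁ can be raised to one that is highest modulo K₁, and such a vector lies in V.
  have hφ : StrictMono φ := by
    intro K₁ K₂ hK
    refine lt_of_le_of_ne (fun v hv => hK.le hv) fun heq => ?_
    obtain ⟨m, hm2, hm1⟩ := SetLike.exists_of_lt hK
    obtain ⟨s, c, hcK, hc, rfl⟩ := hW.exists_sum_mem hm2
    obtain ⟨lam, hlam, hlam1⟩ : ∃ μ ∈ s, c μ ∉ K₁ := by
      by_contra hcon
      push Not at hcon
      exact hm1 (K₁.sum_mem hcon)
    obtain ⟨W, hmW, hW', hWE⟩ := hL (c lam)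
    have : FiniteDimensional ℂ W := hW'
    let W₂ : Submodule ℂ M :=
      { carrier := {w | w ∈ W ∧ w ∈ K₂}
        add_mem' := fun ha hb => ⟨W.add_mem ha.1 hb.1, K₂.add_mem ha.2 hb.2⟩
        zero_mem' := ⟨W.zero_mem, K₂.zero_mem⟩
        smul_mem' := fun a v hv => ⟨W.smul_mem a hv.1, by
          rw [← algebraMap_smul U(𝔤)]; exact K₂.smul_mem _ hv.2⟩ }
    have : FiniteDimensional ℂ W₂ := Submodule.finiteDimensional_of_le (S₂ := W) fun w hw => hw.1
    obtain ⟨γ, -, v, ⟨-, hv2⟩, hvw, hv1, hvE⟩ := D.exists_highest_weight K₁ W₂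
      (fun i w hw => ⟨hWE i w hw.1, K₂.smul_mem _ hw.2⟩) ⟨hmW, hcK lam hlam⟩ (hc lam hlam) hlam1
    set μ := lam + γ with hμ
    have hv0 : v ≠ 0 := fun h => hv1 (h ▸ K₁.zero_mem)
    -- Modulo K₁ the operator r(Ω) is the scalar r(χ μ) on v, but it kills M, while v is nonzero
    -- modulo K₁.
    have hroot : r.eval (D.χ μ) = 0 := by
      by_contra hne
      have h1 := D.aeval_smul_sub_mem r K₁ hvw hvE
      rw [hr, zero_sub] at h1
      have h2 := K₁.smul_mem (algebraMap ℂ U(𝔤) (r.eval (D.χ μ))⁻¹) (K₁.neg_mem h1)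
      rw [neg_neg, algebraMap_smul, smul_smul, inv_mul_cancel₀ hne, one_smul] at h2
      exact hv1 h2
    obtain ⟨lam', hlam', hcl⟩ := hLw μ v hvw hv0
    obtain ⟨k, hk⟩ := exists_int_of_mem_closure hcl
    have hbd := hN lam' (D.χ μ) _ hcl (by rw [add_sub_cancel]; rfl)
    have hk2 : |k| ≤ (B : ℤ) := by
      have h1 : (|k| : ℝ) ≤ N lam' (D.χ μ) := by
        rwa [hk, Complex.norm_intCast] at hbd
      have h2 : |k| ≤ (N lam' (D.χ μ) : ℤ) := by exact_mod_cast h1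
      refine h2.trans (Int.ofNat_le.2 ?_)
      calc N lam' (D.χ μ) ≤ ∑ a ∈ r.roots.toFinset, N lam' a :=
            Finset.single_le_sum (f := fun a => N lam' a) (fun _ _ => Nat.zero_le _)
              (Multiset.mem_toFinset.2 ((Polynomial.mem_roots hr0).2 hroot))
        _ ≤ B := Finset.single_le_sum (f := fun lam => ∑ a ∈ r.roots.toFinset, N lam a)
              (fun _ _ => Nat.zero_le _) hlam'
    have hz : μ D.ρ ∈ Z := Finset.mem_image.2 ⟨(lam', k), Finset.mem_product.2
      ⟨hlam', Finset.mem_Icc.2 (abs_le.1 hk2)⟩, by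
        change lam' D.ρ + (k : ℂ) = μ D.ρ
        rw [← hk, LinearMap.sub_apply, add_sub_cancel]⟩
    have hvV : v ∈ V := Submodule.mem_iSup_of_mem (⟨_, hz⟩ : Z) (wtSpace_le_eigenspace μ hvw)
    have : (⟨v, hvV⟩ : V) ∈ φ K₂ := hv2
    rw [← heq] at this
    exact hv1 this
  have := hφ.wellFoundedGT
  exact isNoetherian_iff'.2 this

end TriangularData

end FiniteLength

/-! ### Projective objects from truncated universal modules. -/

section ProjectiveGenerators

attribute [local instance 100] LieRing.ofAssociativeRing

local notation "U(" x ")" => UniversalEnvelopingAlgebra ℂ x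

open UniversalEnvelopingAlgebra (ι)

namespace TriangularData

variable {𝔤 : Type u} [LieRing 𝔤] [LieAlgebra ℂ 𝔤] {𝔥 : LieSubalgebra ℂ 𝔤} (D : TriangularData 𝔥)

/-- The module is finitely generated, a weight module, and locally `𝔫`-finite. -/
structure IsO (M : Type*) [AddCommGroup M] [Module ℂ M] [Module U(𝔤) M]
    [IsScalarTower ℂ U(𝔤) M] : Prop where
  finite : Module.Finite U(𝔤) M
  isWeight : IsWeight 𝔥 M
  isLF : D.IsLF M

section

variable {D}
variable {M : Type*} [AddCommGroup M] [Module ℂ M] [Module U(𝔤) M] [IsScalarTower ℂ U(𝔤) M]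
variable {N : Type*} [AddCommGroup N] [Module ℂ N] [Module U(𝔤) N] [IsScalarTower ℂ U(𝔤) N]

/-- Finite generation is the only condition that does not pass trivially to submodules; it comes
from noetherianity. -/
theorem IsO.of_injective (hN : D.IsO N) (φ : M →ₗ[U(𝔤)] N) (hφ : Function.Injective φ) :
    D.IsO M where
  finite := by
    have := hN.finite
    have := isNoetherian hN.isWeight hN.isLF
    exact Module.Finite.of_injective φ hφ
  isWeight := hN.isWeight.of_injective φ hφ
  isLF := hN.isLF.of_injective φ hφ

theorem IsO.of_surjective (hM : D.IsO M) (φ : M →ₗ[U(𝔤)] N) (hφ : Function.Surjective φ) :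
    D.IsO N where
  finite := have := hM.finite; Module.Finite.of_surjective φ hφ
  isWeight := hM.isWeight.of_surjective φ hφ
  isLF := hM.isLF.of_surjective φ hφ

end

/-- The product of the `E i` along a list of indices. -/
noncomputable def raisingWord (l : List D.I) : U(𝔤) := (l.map fun i => ι ℂ (D.E i)).prod

theorem raisingWord_cons (i : D.I) (l : List D.I) :
    D.raisingWord (i :: l) = ι ℂ (D.E i) * D.raisingWord l := by
  rw [raisingWord, List.map_cons, List.prod_cons]; rfl

/-- The relations of the universal module generated by a vector of weight `lam` that is killed by
the products of `N` of the `E i`. -/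
noncomputable def truncatedRelations (lam : Module.Dual ℂ 𝔥) (N : ℕ) : Submodule U(𝔤) U(𝔤) :=
  Submodule.span U(𝔤) ({u | ∃ l : List D.I, l.length = N ∧ u = D.raisingWord l} ∪
    {u | ∃ h : 𝔥, u = ι ℂ (h : 𝔤) - algebraMap ℂ U(𝔤) (lam h)})

/-- The universal module generated by a vector of weight `lam` that is killed by the products
of `N` of the `E i`. -/
abbrev TruncatedModule (lam : Module.Dual ℂ 𝔥) (N : ℕ) : Type u :=
  U(𝔤) ⧸ D.truncatedRelations lam N

/-- The generator of the truncated module. -/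
noncomputable def truncatedGen (lam : Module.Dual ℂ 𝔥) (N : ℕ) : D.TruncatedModule lam N :=
  Submodule.Quotient.mk 1

variable {D}

theorem span_truncatedGen (lam : Module.Dual ℂ 𝔥) (N : ℕ) :
    Submodule.span U(𝔤) {D.truncatedGen lam N} = ⊤ := by
  refine eq_top_iff.2 fun x _ => ?_
  obtain ⟨u, rfl⟩ := Submodule.Quotient.mk_surjective _ x
  refine Submodule.mem_span_singleton.2 ⟨u, ?_⟩
  rw [truncatedGen, ← Submodule.Quotient.mk_smul, smul_eq_mul, mul_one]

theorem truncatedGen_mem_wtSpace (lam : Module.Dual ℂ 𝔥) (N : ℕ) :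
    D.truncatedGen lam N ∈ wtSpace 𝔥 (D.TruncatedModule lam N) lam := fun h => by
  rw [← algebraMap_smul U(𝔤), truncatedGen, ← Submodule.Quotient.mk_smul,
    ← Submodule.Quotient.mk_smul, smul_eq_mul, smul_eq_mul, mul_one, mul_one]
  exact (Submodule.Quotient.eq _).2 (Submodule.subset_span (Or.inr ⟨h, rfl⟩))

theorem raisingWord_smul_truncatedGen (lam : Module.Dual ℂ 𝔥) {N : ℕ} {l : List D.I}
    (hl : l.length = N) : D.raisingWord l • D.truncatedGen lam N = 0 := by
  rw [truncatedGen, ← Submodule.Quotient.mk_smul, smul_eq_mul, mul_one]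
  exact (Submodule.Quotient.mk_eq_zero _).2 (Submodule.subset_span (Or.inl ⟨l, hl, rfl⟩))

section

variable {M : Type*} [AddCommGroup M] [Module ℂ M] [Module U(𝔤) M] [IsScalarTower ℂ U(𝔤) M]

theorem exists_truncatedModule_hom {lam : Module.Dual ℂ 𝔥} {N : ℕ} {x : M}
    (hx : x ∈ wtSpace 𝔥 M lam) (hN : ∀ l : List D.I, l.length = N → D.raisingWord l • x = 0) :
    ∃ ψ : D.TruncatedModule lam N →ₗ[U(𝔤)] M, ψ (D.truncatedGen lam N) = x := by
  refine ⟨Submodule.liftQ _ (LinearMap.toSpanSingleton U(𝔤) M x) (Submodule.span_le.2 ?_), ?_⟩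
  · rintro _ (⟨l, hl, rfl⟩ | ⟨h, rfl⟩)
    · exact hN l hl
    · change (ι ℂ (h : 𝔤) - algebraMap ℂ U(𝔤) (lam h)) • x = 0
      rw [sub_smul, algebraMap_smul, hx h, sub_self]
  · exact one_smul _ x

theorem isLFVector_of_raisingWord {N : ℕ} {x : M}
    (hN : ∀ l : List D.I, l.length = N → D.raisingWord l • x = 0) : D.IsLFVector x := by
  rcases N with _ | N
  · have hx : x = 0 := by simpa [raisingWord] using hN [] rfl
    exact hx ▸ ⟨⊥, Submodule.zero_mem _, inferInstance, fun i w hw => by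
      rw [(Submodule.mem_bot ℂ).1 hw, smul_zero]; exact Submodule.zero_mem _⟩
  let s : Set M := (fun l : List D.I => D.raisingWord l • x) '' {l | l.length < N + 1}
  have hs : s.Finite := (List.finite_length_lt D.I (N + 1)).image _
  refine ⟨Submodule.span ℂ s, Submodule.subset_span ⟨[], Nat.succ_pos N, one_smul _ x⟩,
    FiniteDimensional.span_of_finite ℂ hs, fun i => ?_⟩
  have : Submodule.span ℂ s ≤ (Submodule.span ℂ s).comap (lieAct M (D.E i)) := by
    refine Submodule.span_le.2 ?_
    rintro _ ⟨l, hl, rfl⟩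
    change ι ℂ (D.E i) • D.raisingWord l • x ∈ Submodule.span ℂ s
    rw [← mul_smul, ← raisingWord_cons]
    rcases (Nat.lt_succ_iff.1 hl).lt_or_eq with h | h
    · exact Submodule.subset_span ⟨i :: l, by simpa using h, rfl⟩
    · rw [hN (i :: l) (by simpa using h)]
      exact Submodule.zero_mem _
  exact this

theorem isO_truncatedModule [FiniteDimensional ℂ 𝔤] (lam : Module.Dual ℂ 𝔥) (N : ℕ) :
    D.IsO (D.TruncatedModule lam N) where
  finite := inferInstance
  isWeight := D.isWeight_of_span_eq_top (span_truncatedGen lam N) (by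
    rintro _ rfl
    exact Submodule.mem_iSup_of_mem lam (truncatedGen_mem_wtSpace lam N))
  isLF := D.isLF_of_span_eq_top (span_truncatedGen lam N) (by
    rintro _ rfl
    exact isLFVector_of_raisingWord fun l => raisingWord_smul_truncatedGen lam)

theorem raisingWord_smul_mem_wtSpace {lam : Module.Dual ℂ 𝔥} {x : M} (hx : x ∈ wtSpace 𝔥 M lam)
    (l : List D.I) : ∃ γ ∈ AddSubmonoid.closure (Set.range D.wt),
      (∃ n : ℕ, l.length ≤ n ∧ γ D.ρ = n) ∧ D.raisingWord l • x ∈ wtSpace 𝔥 M (lam + γ) := by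
  induction l with
  | nil =>
    exact ⟨0, AddSubmonoid.zero_mem _, ⟨0, le_rfl, by simp⟩, by
      rw [add_zero]
      exact (one_smul U(𝔤) x).symm ▸ hx⟩
  | cons i l ih =>
    obtain ⟨γ, hγ, ⟨n, hn, hγn⟩, h⟩ := ih
    refine ⟨γ + D.wt i, AddSubmonoid.add_mem _ hγ (AddSubmonoid.subset_closure ⟨i, rfl⟩),
      ⟨n + D.ht i, Nat.add_le_add hn (D.ht_pos i), ?_⟩, ?_⟩
    · rw [LinearMap.add_apply, hγn, D.wt_ρ, Nat.cast_add]
    · rw [raisingWord_cons, mul_smul, ← add_assoc]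
      exact D.E_smul_mem_wtSpace i h

end

/-- Long products of the `E i` kill the vectors of weight `lam` that are torsion for a given
polynomial in the Casimir element. -/
theorem exists_raisingWord_smul_eq_zero (lam : Module.Dual ℂ 𝔥) {r : Polynomial ℂ} (hr : r ≠ 0) :
    ∃ N : ℕ, ∀ (M : Type u) [AddCommGroup M] [Module ℂ M] [Module U(𝔤) M] [IsScalarTower ℂ U(𝔤) M],
      D.IsLF M → ∀ x ∈ wtSpace 𝔥 M lam, ∀ i : ℕ, (Polynomial.aeval D.Ω r) ^ i • x = 0 →
        ∀ l : List D.I, l.length = N → D.raisingWord l • x = 0 := by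
  choose N hN using D.bound lam
  -- The length exceeds the height bounds at all roots of r. It depends on neither the module nor
  -- the exponent i, because powers of r have the same roots.
  refine ⟨∑ a ∈ r.roots.toFinset, N a + 1, fun M _ _ _ _ hL x hx i hi l hl => ?_⟩
  by_contra hne
  obtain ⟨γ₀, hγ₀, ⟨n, hn, hγ₀n⟩, hw⟩ := raisingWord_smul_mem_wtSpace hx l
  obtain ⟨V, hmV, hV, hVE⟩ := hL (D.raisingWord l • x)
  have hcomm : ∀ u : U(𝔤), u * Polynomial.aeval D.Ω r ^ i = Polynomial.aeval D.Ω r ^ i * u := by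
    intro u
    rw [← map_pow, smul_comm_aeval]
  let V₂ : Submodule ℂ M :=
    { carrier := {w | w ∈ V ∧ Polynomial.aeval D.Ω r ^ i • w = 0}
      add_mem' := fun ha hb => ⟨V.add_mem ha.1 hb.1, by rw [smul_add, ha.2, hb.2, add_zero]⟩
      zero_mem' := ⟨V.zero_mem, smul_zero _⟩
      smul_mem' := fun c w hw => ⟨V.smul_mem c hw.1, by rw [smul_comm, hw.2, smul_zero]⟩ }
  have : FiniteDimensional ℂ V₂ := Submodule.finiteDimensional_of_le (S₂ := V) fun w hw => hw.1
  -- A nonzero raised vector can be raised further to a highest weight vector without leaving the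
  -- torsion for r(Ω)ⁱ. Its Casimir scalar is a root of r, but its height above lam is at least the
  -- length of the word.
  obtain ⟨γ, hγ, v, ⟨-, hv2⟩, hvw, hv0, hvE⟩ := D.exists_highest_weight (⊥ : Submodule U(𝔤) M) V₂
    (fun j w hw => ⟨hVE j w hw.1, by rw [← mul_smul, ← hcomm, mul_smul, hw.2, smul_zero]⟩)
    (w := D.raisingWord l • x)
    ⟨hmV, by rw [← mul_smul, ← hcomm, mul_smul, hi, smul_zero]⟩ hw
    (fun h => hne ((Submodule.mem_bot _).1 h))
  have hv0' : v ≠ 0 := fun h => hv0 ((Submodule.mem_bot _).2 h)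
  have hroot : r.eval (D.χ (lam + γ₀ + γ)) = 0 := by
    have h1 := D.aeval_smul_sub_mem (r ^ i) ⊥ hvw hvE
    rw [map_pow, hv2, zero_sub, Submodule.mem_bot, neg_eq_zero, Polynomial.eval_pow] at h1
    exact eq_zero_of_pow_eq_zero ((smul_eq_zero.1 h1).resolve_right hv0')
  have hγγ : γ₀ + γ ∈ AddSubmonoid.closure (Set.range D.wt) := AddSubmonoid.add_mem _ hγ₀ hγ
  have hbd := hN (D.χ (lam + γ₀ + γ)) (γ₀ + γ) (mem_closure_group_of_mem_closure hγγ)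
    (by rw [← add_assoc]; rfl)
  obtain ⟨k, hk⟩ := exists_nat_of_mem_closure hγ
  rw [LinearMap.add_apply, hγ₀n, hk, ← Nat.cast_add, Complex.norm_natCast] at hbd
  have h1 : n + k ≤ N (D.χ (lam + γ₀ + γ)) := by exact_mod_cast hbd
  have h2 : N (D.χ (lam + γ₀ + γ)) ≤ ∑ a ∈ r.roots.toFinset, N a :=
    Finset.single_le_sum (f := fun a => N a) (fun _ _ => Nat.zero_le _)
      (Multiset.mem_toFinset.2 ((Polynomial.mem_roots hr).2 hroot))
  omega

section Fitting

variable {M : Type*} [AddCommGroup M] [Module ℂ M] [Module U(𝔤) M] [IsScalarTower ℂ U(𝔤) M]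
variable {M' : Type*} [AddCommGroup M'] [Module ℂ M'] [Module U(𝔤) M'] [IsScalarTower ℂ U(𝔤) M']

/-- Multiplication by a central element on a weight space. -/
noncomputable def centralAct (M : Type*) [AddCommGroup M] [Module ℂ M] [Module U(𝔤) M]
    [IsScalarTower ℂ U(𝔤) M] {t : U(𝔤)} (ht : ∀ x : 𝔤, ι ℂ x * t = t * ι ℂ x)
    (lam : Module.Dual ℂ 𝔥) : Module.End ℂ (wtSpace 𝔥 M lam) :=
  (Algebra.lsmul ℂ ℂ M t).restrict fun _ hm => central_smul_mem_wtSpace ht hm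

theorem coe_centralAct_pow {t : U(𝔤)} (ht : ∀ x : 𝔤, ι ℂ x * t = t * ι ℂ x)
    (lam : Module.Dual ℂ 𝔥) (i : ℕ) (m : wtSpace 𝔥 M lam) :
    ((centralAct M ht lam ^ i) m : M) = t ^ i • (m : M) := by
  induction i generalizing m with
  | zero => rw [pow_zero, pow_zero, one_smul]; rfl
  | succ i ih => rw [pow_succ, pow_succ, mul_smul, Module.End.mul_apply, ih]; rfl

/-- The Fitting decomposition of a weight vector for a central element, and the fact that it is
compatible with homomorphisms. -/
theorem exists_fitting {t : U(𝔤)} (ht : ∀ x : 𝔤, ι ℂ x * t = t * ι ℂ x)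
    {lam : Module.Dual ℂ 𝔥} [FiniteDimensional ℂ (wtSpace 𝔥 M lam)] {y : M}
    (hy : y ∈ wtSpace 𝔥 M lam) :
    ∃ a ∈ wtSpace 𝔥 M lam, (∃ i : ℕ, t ^ i • a = 0) ∧
      ∀ (M' : Type u) [AddCommGroup M'] [Module ℂ M'] [Module U(𝔤) M'] [IsScalarTower ℂ U(𝔤) M']
        [FiniteDimensional ℂ (wtSpace 𝔥 M' lam)] (φ : M →ₗ[U(𝔤)] M'),
        (∃ i : ℕ, t ^ i • φ y = 0) → φ a = φ y := by
  have hc := LinearMap.isCompl_iSup_ker_pow_iInf_range_pow (centralAct M ht lam)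
  obtain ⟨a, ha, b, hb, hab⟩ := Submodule.mem_sup.1
    (hc.sup_eq_top ▸ Submodule.mem_top : (⟨y, hy⟩ : wtSpace 𝔥 M lam) ∈ _)
  obtain ⟨i, hi⟩ : ∃ i : ℕ, t ^ i • (a : M) = 0 := by
    obtain ⟨i, hi⟩ := (Submodule.mem_iSup_of_directed _
      (centralAct M ht lam).iterateKer.monotone.directed_le).1 ha
    exact ⟨i, by rw [← coe_centralAct_pow ht, show (centralAct M ht lam ^ i) a = 0 from hi]; rfl⟩
  have hab' : (a : M) + b = y := congrArg Subtype.val hab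
  refine ⟨a, a.2, ⟨i, hi⟩, fun M' _ _ _ _ _ φ ⟨j, hj⟩ => ?_⟩
  have hc' := LinearMap.isCompl_iSup_ker_pow_iInf_range_pow (centralAct M' ht lam)
  let b' : wtSpace 𝔥 M' lam := ⟨φ b, map_mem_wtSpace φ b.2⟩
  -- The image of b is torsion, as the difference of φ y and φ a. It is also infinitely divisible by
  -- t, as the image of b, so it vanishes by the Fitting decomposition of the target.
  have hb1 : b' ∈ ⨆ n : ℕ, LinearMap.ker (centralAct M' ht lam ^ n) := by
    refine Submodule.mem_iSup_of_mem (i + j) (LinearMap.mem_ker.2 (Subtype.ext ?_))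
    rw [coe_centralAct_pow]
    change t ^ (i + j) • φ b = 0
    rw [← add_sub_cancel_left (a : M) (b : M), hab', map_sub, smul_sub, pow_add, mul_smul, hj,
      smul_zero, ← pow_add, add_comm i j, pow_add, mul_smul, ← map_smul φ, hi, map_zero,
      smul_zero, sub_zero]
  have hb2 : b' ∈ ⨅ n : ℕ, LinearMap.range (centralAct M' ht lam ^ n) := by
    refine Submodule.mem_iInf _ |>.2 fun n => ?_
    obtain ⟨d, hd⟩ := (Submodule.mem_iInf _).1 hb n
    refine ⟨⟨φ d, map_mem_wtSpace φ d.2⟩, Subtype.ext ?_⟩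
    rw [coe_centralAct_pow]
    change t ^ n • φ d = φ b
    rw [← map_smul, ← coe_centralAct_pow ht, hd]
  have hb0 : φ b = 0 := congrArg Subtype.val (Submodule.disjoint_def.1 hc'.disjoint b' hb1 hb2)
  rw [← hab', map_add, hb0, add_zero]

end Fitting

/-- Every weight vector of an object of `𝒪` is in the image of a projective object of `𝒪`. -/
theorem exists_projective_generator [FiniteDimensional ℂ 𝔤] {M : Type u} [AddCommGroup M]
    [Module ℂ M] [Module U(𝔤) M] [IsScalarTower ℂ U(𝔤) M] (hM : D.IsO M)
    {lam : Module.Dual ℂ 𝔥} {x : M} (hx : x ∈ wtSpace 𝔥 M lam) :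
    ∃ (Q : Type u) (_ : AddCommGroup Q) (_ : Module ℂ Q) (_ : Module U(𝔤) Q)
      (_ : IsScalarTower ℂ U(𝔤) Q), D.IsO Q ∧ (∃ g : Q →ₗ[U(𝔤)] M, x ∈ LinearMap.range g) ∧
      ∀ (A B : Type u) [AddCommGroup A] [Module ℂ A] [Module U(𝔤) A] [IsScalarTower ℂ U(𝔤) A]
        [AddCommGroup B] [Module ℂ B] [Module U(𝔤) B] [IsScalarTower ℂ U(𝔤) B],
        D.IsO A → D.IsO B → ∀ φ : A →ₗ[U(𝔤)] B, Function.Surjective φ →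
          ∀ g : Q →ₗ[U(𝔤)] B, ∃ g' : Q →ₗ[U(𝔤)] A, φ ∘ₗ g' = g := by
  have fd : ∀ (A : Type u) [AddCommGroup A] [Module ℂ A] [Module U(𝔤) A] [IsScalarTower ℂ U(𝔤) A],
      D.IsO A → FiniteDimensional ℂ (wtSpace 𝔥 A lam) := fun A _ _ _ _ hA =>
    have := hA.finite
    finiteDimensional_wtSpace hA.isWeight hA.isLF lam
  obtain ⟨r, hr0, hr⟩ := have := hM.finite; exists_aeval_smul_eq_zero hM.isWeight hM.isLF
  obtain ⟨N, hN⟩ := exists_raisingWord_smul_eq_zero (D := D) lam hr0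
  have hQ := isO_truncatedModule (D := D) lam N
  have := fd _ hQ
  obtain ⟨a, ha, ⟨i, hi⟩, hfit⟩ := exists_fitting (D.central_aeval r)
    (truncatedGen_mem_wtSpace (D := D) lam N)
  -- The truncation length kills no relevant vector: the truncated module maps its generator to any
  -- vector of weight lam that is torsion for r(Ω). The Fitting component a has the same image as
  -- the generator.
  have key : ∀ (A : Type u) [AddCommGroup A] [Module ℂ A] [Module U(𝔤) A] [IsScalarTower ℂ U(𝔤) A],
      D.IsO A → ∀ x ∈ wtSpace 𝔥 A lam, (∃ i : ℕ, Polynomial.aeval D.Ω r ^ i • x = 0) →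
        ∃ ψ : D.TruncatedModule lam N →ₗ[U(𝔤)] A, ψ a = x := by
    rintro A _ _ _ _ hA x hx ⟨j, hj⟩
    have := fd A hA
    obtain ⟨ψ, hψ⟩ := exists_truncatedModule_hom hx (hN A hA.isLF x hx j hj)
    exact ⟨ψ, by rw [hfit A ψ ⟨j, by rw [hψ, hj]⟩, hψ]⟩
  let P := Submodule.span U(𝔤) {a}
  have haP : a ∈ P := Submodule.mem_span_singleton_self a
  refine ⟨P, inferInstance, inferInstance, inferInstance, inferInstance,
    hQ.of_injective P.subtype Subtype.val_injective, ?_, ?_⟩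
  · obtain ⟨ψ, hψ⟩ := key M hM x hx ⟨1, by rw [pow_one, hr]⟩
    exact ⟨ψ ∘ₗ P.subtype, ⟨a, haP⟩, hψ⟩
  · intro A B _ _ _ _ _ _ _ _ hA hB φ hφ g
    have hga : g ⟨a, haP⟩ ∈ wtSpace 𝔥 B lam :=
      map_mem_wtSpace g (mem_wtSpace_of_map_mem P.subtype Subtype.val_injective ha)
    have hgi : Polynomial.aeval D.Ω r ^ i • g ⟨a, haP⟩ = 0 := by
      rw [← map_smul, show Polynomial.aeval D.Ω r ^ i • (⟨a, haP⟩ : P) = 0 from Subtype.ext hi,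
        map_zero]
    -- A weight lift of g(a) need not be torsion, but its Fitting component is, and it still maps to
    -- g(a); `key` then produces the lifted homomorphism.
    obtain ⟨y, hy, hyg⟩ := hA.isWeight.exists_lift φ hφ hga
    have := fd A hA
    have := fd B hB
    obtain ⟨x, hx, hxi, hxfit⟩ := exists_fitting (D.central_aeval r) hy
    obtain ⟨ψ, hψ⟩ := key A hA x hx hxi
    refine ⟨ψ ∘ₗ P.subtype, LinearMap.ext fun p => ?_⟩
    obtain ⟨p, hp⟩ := p
    obtain ⟨u, rfl⟩ := Submodule.mem_span_singleton.1 hp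
    change φ (ψ (u • a)) = g (u • ⟨a, haP⟩)
    rw [map_smul, map_smul, map_smul, hψ, hxfit B φ ⟨i, by rw [hyg, hgi]⟩, hyg]

end TriangularData

end ProjectiveGenerators

/-! ### Distributions supported at a fixed point, and torsion-free covers. -/

section FunctionModules

attribute [local instance 100] LieRing.ofAssociativeRing

local notation "U(" x ")" => UniversalEnvelopingAlgebra ℂ x

open UniversalEnvelopingAlgebra (ι)

variable {𝔤 : Type u} [LieRing 𝔤] [LieAlgebra ℂ 𝔤]

/-- A `ℂ`-linear map commuting with `𝔤` is `U(𝔤)`-linear. -/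
def LinearMap.ofLieEquivariant {M N : Type*} [AddCommGroup M] [Module ℂ M] [Module U(𝔤) M]
    [IsScalarTower ℂ U(𝔤) M] [AddCommGroup N] [Module ℂ N] [Module U(𝔤) N] [IsScalarTower ℂ U(𝔤) N]
    (φ : M →ₗ[ℂ] N) (h : ∀ (x : 𝔤) (m : M), φ (ι ℂ x • m) = ι ℂ x • φ m) : M →ₗ[U(𝔤)] N where
  toFun := φ
  map_add' := map_add φ
  map_smul' := by
    let K : Subalgebra ℂ U(𝔤) :=
      { carrier := {r | ∀ m, φ (r • m) = r • φ m}
        mul_mem' := fun {a b} ha hb m => by rw [mul_smul, ha, hb, mul_smul]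
        add_mem' := fun {a b} ha hb m => by rw [add_smul, map_add, ha, hb, add_smul]
        algebraMap_mem' := fun c m => by rw [algebraMap_smul, algebraMap_smul, map_smul] }
    have hK : K = ⊤ := UniversalEnvelopingAlgebra.eq_top_of_ι_mem K h
    intro u m
    exact (hK ▸ Algebra.mem_top : u ∈ K) m

section JetIdeal

variable {A : Type*} [CommRing A] [Algebra ℂ A]

theorem Derivation.map_mem_pow (d : Derivation ℂ A A) (I : Ideal A) (k : ℕ) :
    ∀ p ∈ I ^ (k + 1), d p ∈ I ^ k := by
  induction k with
  | zero => intro p _; rw [pow_zero, Ideal.one_eq_top]; trivial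
  | succ k ih =>
    intro p hp
    rw [pow_succ] at hp
    induction hp using Submodule.mul_induction_on' with
    | mem_mul_mem a ha b hb =>
      rw [Derivation.leibniz, smul_eq_mul, smul_eq_mul]
      refine Ideal.add_mem _ (Ideal.mul_mem_right _ _ ha) ?_
      rw [pow_succ']
      exact Ideal.mul_mem_mul hb (ih a ha)
    | add x _ y _ hx hy => rw [map_add]; exact Ideal.add_mem _ hx hy

theorem Derivation.iterate_mem_pow (d : Derivation ℂ A A) (I : Ideal A) {k : ℕ} (j : ℕ) :
    ∀ p ∈ I ^ (k + j), d^[j] p ∈ I ^ k := by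
  induction j with
  | zero => intro p hp; exact hp
  | succ j ih =>
    intro p hp
    rw [Function.iterate_succ_apply]
    exact ih _ (d.map_mem_pow I (k + j) p hp)

/-- A derivation not vanishing at a point maps the powers of the maximal ideal onto each other,
up to higher order. -/
theorem Derivation.exists_add_of_mem_pow (d : Derivation ℂ A A) (ev : A →ₐ[ℂ] ℂ) {a : A}
    (ha : ev a = 0) (hda : ev (d a) ≠ 0) (k : ℕ) {p : A} (hp : p ∈ RingHom.ker ev ^ k) :
    ∃ q ∈ RingHom.ker ev ^ (k + 1), ∃ s ∈ RingHom.ker ev ^ (k + 1), p = d q + s := by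
  set I := RingHom.ker ev with hI
  have haI : a ∈ I := ha
  let S : Submodule ℂ A := ((I ^ (k + 1)).restrictScalars ℂ).map d.toLinearMap ⊔
    (I ^ (k + 1)).restrictScalars ℂ
  have hmem : ∀ j ≤ k, a ^ j * d^[j] p ∈ I ^ k := by
    intro j hj
    rw [show k = j + (k - j) by omega, pow_add]
    refine Ideal.mul_mem_mul (Ideal.pow_mem_pow haI j) (d.iterate_mem_pow I j p ?_)
    rwa [show k - j + j = k by omega]
  have hbase : a ^ (k + 1) * d^[k + 1] p ∈ S :=
    Submodule.mem_sup_right (Ideal.mul_mem_right _ _ (Ideal.pow_mem_pow haI (k + 1)))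
  -- Descending induction on j. By the Leibniz rule, d(a^(j+1) dʲp) equals (j+1) (da) aʲ dʲp +
  -- a^(j+1) d^(j+1)p. Modulo the maximal ideal da is a nonzero constant, and j + 1 is invertible in
  -- characteristic zero.
  have hstep : ∀ j ≤ k, a ^ (j + 1) * d^[j + 1] p ∈ S → a ^ j * d^[j] p ∈ S := by
    intro j hj hS
    have h1 : a ^ (j + 1) * d^[j] p ∈ I ^ (k + 1) := by
      rw [pow_succ' a, mul_assoc, pow_succ' I]
      exact Ideal.mul_mem_mul haI (hmem j hj)
    have h2 : d (a ^ (j + 1) * d^[j] p) ∈ S :=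
      Submodule.mem_sup_left (Submodule.mem_map_of_mem (f := d.toLinearMap) h1)
    have h3 : (d a - algebraMap ℂ A (ev (d a))) * (a ^ j * d^[j] p) ∈ I ^ (k + 1) := by
      rw [pow_succ']
      refine Ideal.mul_mem_mul ?_ (hmem j hj)
      rw [hI, RingHom.mem_ker, map_sub, AlgHom.commutes]
      exact sub_self _
    have h4 : (((j : ℂ) + 1) * ev (d a)) • (a ^ j * d^[j] p) ∈ S := by
      have h5 : (((j : ℂ) + 1) * ev (d a)) • (a ^ j * d^[j] p) =
          d (a ^ (j + 1) * d^[j] p) - a ^ (j + 1) * d^[j + 1] p -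
            ((j : ℂ) + 1) • ((d a - algebraMap ℂ A (ev (d a))) * (a ^ j * d^[j] p)) := by
        have hj : algebraMap ℂ A (j : ℂ) = (j : A) := _root_.map_natCast (algebraMap ℂ A) j
        rw [Derivation.leibniz, Derivation.leibniz_pow, Function.iterate_succ_apply']
        simp only [Algebra.smul_def (R := ℂ), smul_eq_mul, nsmul_eq_mul, map_mul, map_add,
          hj, map_one, Nat.add_sub_cancel, Nat.cast_add, Nat.cast_one]
        ring
      rw [h5]
      exact S.sub_mem (S.sub_mem h2 hS) (S.smul_mem _ (Submodule.mem_sup_right h3))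
    have h6 : ((j : ℂ) + 1) * ev (d a) ≠ 0 := mul_ne_zero (Nat.cast_add_one_ne_zero j) hda
    have := S.smul_mem (((j : ℂ) + 1) * ev (d a))⁻¹ h4
    rwa [smul_smul, inv_mul_cancel₀ h6, one_smul] at this
  have hall : ∀ i ≤ k + 1, a ^ (k + 1 - i) * d^[k + 1 - i] p ∈ S := by
    intro i
    induction i with
    | zero => intro _; exact hbase
    | succ i ih =>
      intro hi
      have h := ih (by omega)
      rw [show k + 1 - i = (k + 1 - (i + 1)) + 1 by omega] at h
      exact hstep _ (by omega) h
  have h0 := hall (k + 1) le_rfl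
  rw [Nat.sub_self, pow_zero, one_mul, Function.iterate_zero, id] at h0
  obtain ⟨_, ⟨q, hq, rfl⟩, s, hs, h⟩ := Submodule.mem_sup.1 h0
  exact ⟨q, hq, s, hs, h.symm⟩

end JetIdeal

variable {A : Type} [CommRing A] [Algebra ℂ A] (δ : 𝔤 →ₗ⁅ℂ⁆ Derivation ℂ A A)

/-- The linear maps `A → M`, with the action of `𝔤` coming from those on `A` and on `M`. -/
def FunctionModule (_δ : 𝔤 →ₗ⁅ℂ⁆ Derivation ℂ A A) (M : Type u) [AddCommGroup M] [Module ℂ M] :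
    Type u := A →ₗ[ℂ] M

namespace FunctionModule

variable (M : Type u) [AddCommGroup M] [Module ℂ M] [Module U(𝔤) M] [IsScalarTower ℂ U(𝔤) M]

instance : AddCommGroup (FunctionModule δ M) := inferInstanceAs (AddCommGroup (A →ₗ[ℂ] M))

instance : Module ℂ (FunctionModule δ M) := inferInstanceAs (Module ℂ (A →ₗ[ℂ] M))

variable {δ M} in
/-- An element of the function module as a linear map. -/
def toLinearMap (Φ : FunctionModule δ M) : A →ₗ[ℂ] M := Φ

/-- The action of `𝔤` on linear maps `A → M`. -/
noncomputable def lieHom : 𝔤 →ₗ⁅ℂ⁆ Module.End ℂ (A →ₗ[ℂ] M) where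
  toFun x :=
    { toFun := fun Φ => lieAct M x ∘ₗ Φ - Φ ∘ₗ (δ x).toLinearMap
      map_add' := fun Φ Ψ => by
        rw [LinearMap.comp_add, LinearMap.add_comp]; abel
      map_smul' := fun c Φ => by
        rw [LinearMap.comp_smul, LinearMap.smul_comp, RingHom.id_apply, smul_sub] }
  map_add' x y := by
    ext Φ p
    simp only [map_add, LinearMap.coe_mk, AddHom.coe_mk, LinearMap.sub_apply, LinearMap.comp_apply,
      LinearMap.add_apply, Derivation.coeFn_coe,
      Derivation.coe_add, Pi.add_apply]
    abel
  map_smul' c x := by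
    ext Φ p
    simp only [map_smul, LinearMap.coe_mk, AddHom.coe_mk, LinearMap.sub_apply,
      LinearMap.comp_apply, LinearMap.smul_apply,
      Derivation.coeFn_coe, Derivation.coe_smul, Pi.smul_apply, RingHom.id_apply, smul_sub]
  map_lie' {x y} := by
    ext Φ p
    rw [LieRing.of_associative_ring_bracket]
    simp only [LieHom.map_lie, LinearMap.coe_mk, AddHom.coe_mk, LinearMap.sub_apply,
      LinearMap.comp_apply, Module.End.mul_apply,
      Derivation.coeFn_coe, Derivation.commutator_apply, map_sub, lieAct_apply,
      LieRing.of_associative_ring_bracket, sub_smul, mul_smul]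
    abel

noncomputable instance : Module U(𝔤) (FunctionModule δ M) :=
  Module.compHom (A →ₗ[ℂ] M) (UniversalEnvelopingAlgebra.lift ℂ (lieHom δ M)).toRingHom

instance : IsScalarTower ℂ U(𝔤) (FunctionModule δ M) where
  smul_assoc c u Φ := by
    change UniversalEnvelopingAlgebra.lift ℂ (lieHom δ M) (c • u) Φ.toLinearMap =
      c • UniversalEnvelopingAlgebra.lift ℂ (lieHom δ M) u Φ.toLinearMap
    rw [map_smul, LinearMap.smul_apply]

variable {δ M}

/-- Evaluation of an element of the function module. -/
def eval (p : A) : FunctionModule δ M →ₗ[ℂ] M where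
  toFun Φ := Φ.toLinearMap p
  map_add' _ _ := rfl
  map_smul' _ _ := rfl

omit [Module U(𝔤) M] [IsScalarTower ℂ U(𝔤) M] in
theorem ext {Φ Ψ : FunctionModule δ M} (h : ∀ p, eval p Φ = eval p Ψ) : Φ = Ψ :=
  LinearMap.ext (f := Φ.toLinearMap) (g := Ψ.toLinearMap) h

omit [Module U(𝔤) M] [IsScalarTower ℂ U(𝔤) M] in
theorem eval_add_left (p q : A) (Φ : FunctionModule δ M) :
    eval (p + q) Φ = eval p Φ + eval q Φ := map_add Φ.toLinearMap p q

omit [Module U(𝔤) M] [IsScalarTower ℂ U(𝔤) M] in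
theorem eval_zero_left (Φ : FunctionModule δ M) : eval 0 Φ = 0 := map_zero Φ.toLinearMap

theorem eval_ι_smul (x : 𝔤) (Φ : FunctionModule δ M) (p : A) :
    eval p (ι ℂ x • Φ) = ι ℂ x • eval p Φ - eval (δ x p) Φ := by
  change UniversalEnvelopingAlgebra.lift ℂ (lieHom δ M) (ι ℂ x) Φ.toLinearMap p = _
  rw [UniversalEnvelopingAlgebra.lift_ι_apply]
  rfl

variable (δ M) in
/-- Evaluation at `1` as a map of `𝔤`-modules. -/
noncomputable def evalOne : FunctionModule δ M →ₗ[U(𝔤)] M :=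
  LinearMap.ofLieEquivariant (eval 1) fun x Φ => by
    rw [eval_ι_smul, Derivation.map_one_eq_zero, eval_zero_left, sub_zero]

variable (δ M) in
/-- The linear maps that vanish on a power of an ideal. -/
noncomputable def jets (I : Ideal A) : Submodule U(𝔤) (FunctionModule δ M) :=
  stableSubmodule
    { carrier := {Φ | ∃ k : ℕ, ∀ p ∈ I ^ k, eval p Φ = 0}
      add_mem' := by
        rintro Φ Ψ ⟨k, hk⟩ ⟨l, hl⟩
        refine ⟨k + l, fun p hp => ?_⟩
        rw [map_add, hk p (Ideal.pow_le_pow_right (Nat.le_add_right k l) hp),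
          hl p (Ideal.pow_le_pow_right (Nat.le_add_left l k) hp), add_zero]
      zero_mem' := ⟨0, fun p _ => map_zero _⟩
      smul_mem' := by
        rintro c Φ ⟨k, hk⟩
        exact ⟨k, fun p hp => by rw [map_smul, hk p hp, smul_zero]⟩ } (by
    rintro x Φ ⟨k, hk⟩
    refine ⟨k + 1, fun p hp => ?_⟩
    rw [eval_ι_smul, hk p (Ideal.pow_le_pow_right k.le_succ hp), smul_zero,
      hk _ ((δ x).map_mem_pow I k p hp), sub_zero])

/-- An element whose vector field does not vanish at a point acts injectively on the jets at
that point. -/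
theorem eq_zero_of_mem_jets (ev : A →ₐ[ℂ] ℂ) {f : 𝔤} {a : A} (ha : ev a = 0)
    (hfa : ev (δ f a) ≠ 0) {Φ : FunctionModule δ M} (hΦ : Φ ∈ jets δ M (RingHom.ker ev))
    (hf : ι ℂ f • Φ = 0) : Φ = 0 := by
  obtain ⟨k, hk⟩ := mem_stableSubmodule.1 hΦ
  induction k with
  | zero =>
    refine ext fun p => ?_
    rw [map_zero]
    exact hk p (by rw [pow_zero, Ideal.one_eq_top]; trivial)
  | succ k ih =>
    refine ih fun p hp => ?_
    -- Since fΦ = 0, the value of Φ at δ_f q is f times its value at q, which is zero. Thus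
    -- vanishing on the (k+1)-st power of the ideal forces vanishing on the k-th, down to the whole
    -- ring.
    obtain ⟨q, hq, s, hs, rfl⟩ := (δ f).exists_add_of_mem_pow ev ha hfa k hp
    have h1 := eval_ι_smul f Φ q
    rw [hf, map_zero, hk q hq, smul_zero, zero_sub, eq_comm, neg_eq_zero] at h1
    rw [eval_add_left, h1, hk s hs, add_zero]

variable (δ M) in
/-- The function `p ↦ p(pt) m`. -/
def pointMass (ev : A →ₐ[ℂ] ℂ) : M →ₗ[ℂ] FunctionModule δ M where
  toFun m := LinearMap.toSpanSingleton ℂ M m ∘ₗ ev.toLinearMap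
  map_add' a b := LinearMap.ext fun p : A => smul_add (ev p) a b
  map_smul' c a := LinearMap.ext fun p : A => smul_comm (ev p) c a

omit [Module U(𝔤) M] [IsScalarTower ℂ U(𝔤) M] in
theorem eval_pointMass (ev : A →ₐ[ℂ] ℂ) (m : M) (p : A) :
    eval p (pointMass δ M ev m) = ev p • m := rfl

theorem ι_smul_pointMass (ev : A →ₐ[ℂ] ℂ) {x : 𝔤} (hx : ∀ p, ev (δ x p) = 0) (m : M) :
    ι ℂ x • pointMass δ M ev m = pointMass δ M ev (ι ℂ x • m) := by
  refine ext fun p => ?_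
  rw [eval_ι_smul, eval_pointMass, eval_pointMass, eval_pointMass, hx, zero_smul, sub_zero,
    smul_comm]

theorem pointMass_mem_jets (ev : A →ₐ[ℂ] ℂ) (m : M) :
    pointMass δ M ev m ∈ jets δ M (RingHom.ker ev) := by
  refine mem_stableSubmodule.2 ⟨1, fun p hp => ?_⟩
  rw [pow_one] at hp
  rw [eval_pointMass, show ev p = 0 from hp, zero_smul]

end FunctionModule

namespace TriangularData

variable {𝔥 : LieSubalgebra ℂ 𝔤} {D : TriangularData 𝔥}

/-- The ambient module need not be a weight module; only the generators are assumed to be sums of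
weight vectors. -/
theorem isWeight_span {H : Type*} [AddCommGroup H] [Module ℂ H] [Module U(𝔤) H]
    [IsScalarTower ℂ U(𝔤) H] (D : TriangularData 𝔥) (s : Set H)
    (hs : ∀ x ∈ s, x ∈ ⨆ μ : Module.Dual ℂ 𝔥, wtSpace 𝔥 H μ) :
    IsWeight 𝔥 (Submodule.span U(𝔤) s) := by
  refine D.isWeight_of_span_eq_top (Submodule.span_span_coe_preimage (s := s)) fun x hx => ?_
  obtain ⟨t, c, -, hc, hsum⟩ := exists_sum_of_mem_iSup_wtSpace (𝔥 := 𝔥) (p := fun _ => True)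
    (m := (x : H)) (by simpa only [iSup_pos] using hs x hx)
  have hcK := mem_of_sum_mem (Submodule.span U(𝔤) s) t c hc (hsum ▸ x.2)
  choose! d hd using fun μ hμ => (⟨⟨c μ, hcK μ hμ⟩, rfl⟩ :
    ∃ d : Submodule.span U(𝔤) s, (d : H) = c μ)
  have : x = ∑ μ ∈ t, d μ := by
    refine Subtype.ext ?_
    rw [← hsum, Submodule.coe_sum]
    exact Finset.sum_congr rfl fun μ hμ => (hd μ hμ).symm
  rw [this]
  refine Submodule.sum_mem _ fun μ hμ => Submodule.mem_iSup_of_mem μ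
    (mem_wtSpace_of_map_mem (Submodule.subtype _) Subtype.val_injective ?_)
  rw [Submodule.subtype_apply, hd μ hμ]
  exact hc μ hμ

theorem IsLFVector.of_injective {M N : Type*} [AddCommGroup M] [Module ℂ M] [Module U(𝔤) M]
    [IsScalarTower ℂ U(𝔤) M] [AddCommGroup N] [Module ℂ N] [Module U(𝔤) N]
    [IsScalarTower ℂ U(𝔤) N] (φ : M →ₗ[U(𝔤)] N) (hφ : Function.Injective φ) {m : M}
    (h : D.IsLFVector (φ m)) : D.IsLFVector m := by
  obtain ⟨V, hm, hV, hVE⟩ := h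
  refine ⟨V.comap φ.toComplex, hm, ?_, ?_⟩
  · exact Module.Finite.of_injective
      (φ.toComplex.restrict (p := V.comap φ.toComplex) (q := V) fun _ h => h)
      fun a b hab => Subtype.ext (hφ (congrArg Subtype.val hab))
  · intro i w hw
    change φ _ ∈ V
    rw [map_smul]
    exact hVE i _ hw

open FunctionModule in
/-- Every object of `𝒪` is a quotient of one on which `f` acts injectively, if `f` moves a point
that is fixed by the Borel subalgebra. -/
theorem exists_torsionFree_cover [FiniteDimensional ℂ 𝔤] (ev : A →ₐ[ℂ] ℂ)
    (hh : ∀ (h : 𝔥) (p : A), ev (δ (h : 𝔤) p) = 0) (hE : ∀ i (p : A), ev (δ (D.E i) p) = 0)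
    {f : 𝔤} {a : A} (ha : ev a = 0) (hfa : ev (δ f a) ≠ 0)
    {M : Type u} [AddCommGroup M] [Module ℂ M] [Module U(𝔤) M] [IsScalarTower ℂ U(𝔤) M]
    (hM : D.IsO M) :
    ∃ (Q : Type u) (_ : AddCommGroup Q) (_ : Module ℂ Q) (_ : Module U(𝔤) Q)
      (_ : IsScalarTower ℂ U(𝔤) Q), D.IsO Q ∧ (∀ q : Q, ι ℂ f • q = 0 → q = 0) ∧
      ∃ g : Q →ₗ[U(𝔤)] M, Function.Surjective g := by
  obtain ⟨s, hs⟩ := hM.finite.fg_top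
  -- The full module of jets need not be finitely generated, so the cover is the submodule generated
  -- by finitely many point masses. Since 𝔥 and the E i fix the point, these generators inherit
  -- weights and local finiteness from M.
  let S : Set (FunctionModule δ M) := pointMass δ M ev '' s
  have hSj : Submodule.span U(𝔤) S ≤ jets δ M (RingHom.ker ev) := by
    refine Submodule.span_le.2 ?_
    rintro _ ⟨m, -, rfl⟩
    exact pointMass_mem_jets ev m
  have hfin : Module.Finite U(𝔤) (Submodule.span U(𝔤) S) :=
    Module.Finite.iff_fg.2 (Submodule.fg_span (s.finite_toSet.image _))
  refine ⟨Submodule.span U(𝔤) S, inferInstance, inferInstance, inferInstance, inferInstance,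
    ⟨hfin, ?_, ?_⟩, ?_, ?_⟩
  · refine D.isWeight_span S ?_
    rintro _ ⟨m, -, rfl⟩
    obtain ⟨t, c, hc, rfl⟩ := hM.isWeight.exists_sum m
    rw [map_sum]
    refine Submodule.sum_mem _ fun μ hμ => Submodule.mem_iSup_of_mem μ fun h => ?_
    rw [ι_smul_pointMass ev (hh h), hc μ hμ h, map_smul]
  · refine D.isLF_of_span_eq_top (Submodule.span_span_coe_preimage (s := S)) fun x hx =>
      IsLFVector.of_injective (Submodule.subtype _) Subtype.val_injective ?_
    obtain ⟨m, -, hm⟩ := hx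
    rw [Submodule.subtype_apply, ← hm]
    obtain ⟨V, hmV, hV, hVE⟩ := hM.isLF m
    refine ⟨V.map (pointMass δ M ev), Submodule.mem_map_of_mem hmV, inferInstance, ?_⟩
    rintro i _ ⟨w, hw, rfl⟩
    rw [ι_smul_pointMass ev (hE i)]
    exact Submodule.mem_map_of_mem (hVE i w hw)
  · intro q hq
    exact Subtype.ext (eq_zero_of_mem_jets ev ha hfa (hSj q.2) (congrArg Subtype.val hq))
  · refine ⟨evalOne δ M ∘ₗ Submodule.subtype _, LinearMap.range_eq_top.1 (eq_top_iff.2 ?_)⟩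
    rw [← hs]
    refine Submodule.span_le.2 fun m hm =>
      ⟨⟨pointMass δ M ev m, Submodule.subset_span ⟨m, hm, rfl⟩⟩, ?_⟩
    change eval 1 (pointMass δ M ev m) = m
    rw [eval_pointMass, map_one, one_smul]

end TriangularData

end FunctionModules

/-! ### Vector fields in a chart of a Grassmannian. -/

section RiccatiAction

attribute [local instance 100] LieRing.ofAssociativeRing

local notation "U(" x ")" => UniversalEnvelopingAlgebra ℂ x

open UniversalEnvelopingAlgebra (ι)

section

variable {n : Type}

local notation "𝒜" => MvPolynomial (n × n) ℂ

local notation "𝒳" => (Matrix.mvPolynomialX n n ℂ : Matrix n n 𝒜)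

/-- The entrywise Leibniz rule for a product of matrices. -/
theorem Derivation.matrix_map_mul [Fintype n] {A : Type*} [CommRing A] [Algebra ℂ A]
    (d : Derivation ℂ A A) (M N : Matrix n n A) : (M * N).map d = M.map d * N + M * N.map d := by
  ext i j
  simp only [Matrix.map_apply, Matrix.mul_apply, Matrix.add_apply, map_sum, Derivation.leibniz,
    smul_eq_mul, Finset.sum_add_distrib]
  rw [add_comm]
  congr 1
  exact Finset.sum_congr rfl fun _ _ => mul_comm _ _

theorem Derivation.matrix_map_C (d : Derivation ℂ 𝒜 𝒜) (a : Matrix n n ℂ) :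
    (a.map MvPolynomial.C).map d = 0 := by
  ext1 i j
  simp

variable [Fintype n]

/-- The matrix of the quadratic vector field `-(a X - X π a X)`. -/
noncomputable def riccatiMatrix (π a : Matrix n n ℂ) : Matrix n n 𝒜 :=
  𝒳 * π.map MvPolynomial.C * a.map MvPolynomial.C * 𝒳 - a.map MvPolynomial.C * 𝒳

theorem riccatiMatrix_smul (π a : Matrix n n ℂ) (r : ℂ) :
    riccatiMatrix π (r • a) = r • riccatiMatrix π a := by
  have : (r • a).map MvPolynomial.C = r • (a.map MvPolynomial.C : Matrix n n 𝒜) := by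
    ext1 i j
    simp [MvPolynomial.smul_eq_C_mul]
  rw [riccatiMatrix, this, riccatiMatrix, smul_sub, Matrix.mul_smul, Matrix.smul_mul,
    Matrix.smul_mul]

/-- The quadratic vector field on matrices which is the infinitesimal action of `a` in a chart of
a Grassmannian. -/
noncomputable def riccatiDerivation (π a : Matrix n n ℂ) : Derivation ℂ 𝒜 𝒜 :=
  MvPolynomial.mkDerivation ℂ fun ij => riccatiMatrix π a ij.1 ij.2

theorem riccatiDerivation_map (π a : Matrix n n ℂ) :
    (𝒳).map (riccatiDerivation π a) = riccatiMatrix π a := by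
  ext1 i j
  rw [Matrix.map_apply, Matrix.mvPolynomialX_apply]
  exact MvPolynomial.mkDerivation_X ℂ _ (i, j)

/-- Evaluation of polynomial functions at the matrix `π`. -/
noncomputable def evalAt (π : Matrix n n ℂ) : 𝒜 →ₐ[ℂ] ℂ := MvPolynomial.aeval fun ij => π ij.1 ij.2

theorem evalAt_riccatiMatrix {π : Matrix n n ℂ} (hπ : π * π = π) (a : Matrix n n ℂ) (i j : n) :
    evalAt π (riccatiMatrix π a i j) = (π * a * π - a * π) i j := by
  have hX : (𝒳).map (evalAt π) = π := by
    ext1 i j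
    simp [evalAt]
  have hC : ∀ a : Matrix n n ℂ, (a.map MvPolynomial.C : Matrix n n 𝒜).map (evalAt π) = a := by
    intro a
    ext1 i j
    rw [Matrix.map_apply, Matrix.map_apply]
    exact MvPolynomial.aeval_C _ _
  have : (riccatiMatrix π a).map (evalAt π) = π * a * π - a * π := by
    rw [riccatiMatrix, Matrix.map_sub _ (map_sub _)]
    simp only [Matrix.map_mul, hX, hC, hπ]
  rw [← this, Matrix.map_apply]

variable [DecidableEq n]

theorem riccatiMatrix_map (π a c : Matrix n n ℂ) :
    (riccatiMatrix π a).map (riccatiDerivation π c) =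
      riccatiMatrix π c * π.map MvPolynomial.C * a.map MvPolynomial.C * 𝒳 +
        𝒳 * π.map MvPolynomial.C * a.map MvPolynomial.C * riccatiMatrix π c -
        a.map MvPolynomial.C * riccatiMatrix π c := by
  rw [riccatiMatrix, Matrix.map_sub _ (map_sub _)]
  simp only [Derivation.matrix_map_mul, Derivation.matrix_map_C, riccatiDerivation_map, mul_zero,
    add_zero, zero_mul, zero_add]

/-- A polynomial identity in noncommuting X, π, a, c, valid for every π. The sign of the vector
field makes a ↦ XπaX - aX a homomorphism rather than an antihomomorphism. -/
theorem riccatiMatrix_lie (π a c : Matrix n n ℂ) :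
    (riccatiMatrix π c).map (riccatiDerivation π a) -
      (riccatiMatrix π a).map (riccatiDerivation π c) = riccatiMatrix π (a * c - c * a) := by
  rw [riccatiMatrix_map, riccatiMatrix_map]
  simp only [riccatiMatrix, Matrix.map_sub _ (map_sub MvPolynomial.C), Matrix.map_mul]
  noncomm_ring

theorem riccatiMatrix_add (π a c : Matrix n n ℂ) :
    riccatiMatrix π (a + c) = riccatiMatrix π a + riccatiMatrix π c := by
  simp only [riccatiMatrix, Matrix.map_add _ (map_add MvPolynomial.C)]
  noncomm_ring

/-- The action of a matrix Lie algebra by quadratic vector fields. -/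
noncomputable def riccatiAction {𝔤 : Type*} [LieRing 𝔤] [LieAlgebra ℂ 𝔤]
    (r : 𝔤 →ₗ⁅ℂ⁆ Matrix n n ℂ) (π : Matrix n n ℂ) : 𝔤 →ₗ⁅ℂ⁆ Derivation ℂ 𝒜 𝒜 where
  toFun x := riccatiDerivation π (r x)
  map_add' x y := MvPolynomial.derivation_ext fun ij => by
    rw [Derivation.add_apply, riccatiDerivation, riccatiDerivation, riccatiDerivation,
      MvPolynomial.mkDerivation_X, MvPolynomial.mkDerivation_X, MvPolynomial.mkDerivation_X,
      map_add, riccatiMatrix_add, Matrix.add_apply]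
  map_smul' c x := MvPolynomial.derivation_ext fun ij => by
    rw [Derivation.smul_apply, riccatiDerivation, riccatiDerivation,
      MvPolynomial.mkDerivation_X, MvPolynomial.mkDerivation_X,
      map_smul, riccatiMatrix_smul, Matrix.smul_apply, RingHom.id_apply]
  map_lie' {x y} := MvPolynomial.derivation_ext fun ij => by
    rw [Derivation.commutator_apply, LieHom.map_lie, LieRing.of_associative_ring_bracket]
    have h := congrFun (congrFun (riccatiMatrix_lie π (r x) (r y)) ij.1) ij.2
    rw [Matrix.sub_apply, Matrix.map_apply, Matrix.map_apply] at h
    have hX : ∀ a, riccatiDerivation π a (MvPolynomial.X ij) = riccatiMatrix π a ij.1 ij.2 :=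
      fun a => MvPolynomial.mkDerivation_X ℂ _ ij
    rw [hX, hX, hX, h]

theorem evalAt_riccatiAction_eq_zero {𝔤 : Type*} [LieRing 𝔤] [LieAlgebra ℂ 𝔤]
    (r : 𝔤 →ₗ⁅ℂ⁆ Matrix n n ℂ) {π : Matrix n n ℂ} (hπ : π * π = π) {x : 𝔤}
    (hx : π * r x * π = r x * π) (p : 𝒜) : evalAt π (riccatiAction r π x p) = 0 := by
  have hX : ∀ ij, evalAt π (riccatiAction r π x (MvPolynomial.X ij)) = 0 := fun ij => by
    have := evalAt_riccatiMatrix hπ (r x) ij.1 ij.2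
    rw [hx, sub_self] at this
    change evalAt π (riccatiDerivation π (r x) (MvPolynomial.X ij)) = 0
    rw [riccatiDerivation, MvPolynomial.mkDerivation_X]
    exact this
  induction p using MvPolynomial.induction_on with
  | C c => rw [MvPolynomial.derivation_C, map_zero]
  | add p q hp hq => rw [map_add, map_add, hp, hq, add_zero]
  | mul_X p i hp =>
    rw [Derivation.leibniz, map_add, smul_eq_mul, smul_eq_mul, map_mul, map_mul, hp, hX, mul_zero,
      mul_zero, add_zero]

theorem exists_evalAt_riccatiAction_ne_zero {𝔤 : Type*} [LieRing 𝔤] [LieAlgebra ℂ 𝔤]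
    (r : 𝔤 →ₗ⁅ℂ⁆ Matrix n n ℂ) {π : Matrix n n ℂ} (hπ : π * π = π) {x : 𝔤}
    (hx : π * r x * π ≠ r x * π) :
    ∃ p : 𝒜, evalAt π p = 0 ∧ evalAt π (riccatiAction r π x p) ≠ 0 := by
  by_contra! h
  refine hx (sub_eq_zero.1 ?_)
  ext1 i j
  rw [Matrix.zero_apply, ← evalAt_riccatiMatrix hπ]
  -- The coordinate functions centred at π detect a nonzero tangent vector.
  have := h (MvPolynomial.X (i, j) - MvPolynomial.C (π i j)) (by
    rw [map_sub, evalAt, MvPolynomial.aeval_X]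
    exact sub_eq_zero.2
      (MvPolynomial.aeval_C (R := ℂ) (fun ij : n × n => π ij.1 ij.2) (π i j)).symm)
  rw [map_sub, MvPolynomial.derivation_C, sub_zero] at this
  change evalAt π (riccatiDerivation π (r x) (MvPolynomial.X (i, j))) = 0 at this
  rwa [riccatiDerivation, MvPolynomial.mkDerivation_X] at this

end

variable {𝔤 : Type u} [LieRing 𝔤] [LieAlgebra ℂ 𝔤]

/-- The Lie algebra acts by derivations on a polynomial ring in such a way that the elements
which stabilize a given subspace of `𝔤` fix a point, and the others do not. -/
theorem exists_derivation_action [FiniteDimensional ℂ 𝔤] (W : Submodule ℂ 𝔤) :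
    ∃ (A : Type) (_ : CommRing A) (_ : Algebra ℂ A) (δ : 𝔤 →ₗ⁅ℂ⁆ Derivation ℂ A A)
      (ev : A →ₐ[ℂ] ℂ), (∀ x : 𝔤, (∀ w ∈ W, ⁅x, w⁆ ∈ W) → ∀ p, ev (δ x p) = 0) ∧
      (∀ x : 𝔤, (∃ w ∈ W, ⁅x, w⁆ ∉ W) → ∃ p, ev p = 0 ∧ ev (δ x p) ≠ 0) := by
  -- For a projection π onto W, the value of the vector field at X = π is πaπ - aπ, which is zero
  -- exactly when a preserves W.
  obtain ⟨W', hW'⟩ := W.exists_isCompl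
  let b := Module.finBasis ℂ 𝔤
  let m := LinearMap.toMatrixAlgEquiv b
  let q : Module.End ℂ 𝔤 := W.projection W' hW'
  have hq : q * q = q := Submodule.isIdempotentElem_projection hW'
  have hqW : ∀ w ∈ W, q w = w := fun w hw => Submodule.projection_apply_of_mem_left hW' hw
  have hqr : ∀ w, q w ∈ W := fun w => Submodule.projection_apply_mem hW' w
  let r : 𝔤 →ₗ⁅ℂ⁆ Matrix (Fin (Module.finrank ℂ 𝔤)) (Fin (Module.finrank ℂ 𝔤)) ℂ :=
    (m : Module.End ℂ 𝔤 →ₐ[ℂ] _).toLieHom.comp (LieAlgebra.ad ℂ 𝔤)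
  have hr : ∀ x, r x = m (LieAlgebra.ad ℂ 𝔤 x) := fun x => rfl
  have hπ : m q * m q = m q := by rw [← map_mul, hq]
  have key : ∀ x, (m q * r x * m q = r x * m q) ↔ ∀ w ∈ W, ⁅x, w⁆ ∈ W := by
    intro x
    rw [hr, ← map_mul, ← map_mul, ← map_mul, m.injective.eq_iff]
    constructor
    · intro h w hw
      have := LinearMap.congr_fun h w
      simp only [Module.End.mul_apply, hqW w hw, LieAlgebra.ad_apply] at this
      rw [← this]
      exact hqr _
    · intro h
      ext w
      exact hqW _ (h _ (hqr w))
  refine ⟨_, inferInstance, inferInstance, riccatiAction r (m q), evalAt (m q), ?_, ?_⟩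
  · intro x hx
    exact evalAt_riccatiAction_eq_zero r hπ ((key x).2 hx)
  · rintro x ⟨w, hw, hxw⟩
    exact exists_evalAt_riccatiAction_ne_zero r hπ fun h => hxw ((key x).1 h w hw)

namespace TriangularData

variable {𝔥 : LieSubalgebra ℂ 𝔤} (D : TriangularData 𝔥)

/-- The sum of the eigenspaces of `ad ρ` for positive integers. -/
def positivePart : Submodule ℂ 𝔤 :=
  ⨆ (n : ℕ) (_ : 0 < n), (LieAlgebra.ad ℂ 𝔤 (D.ρ : 𝔤)).eigenspace (n : ℂ)

theorem mem_positivePart {n : ℕ} (hn : 0 < n) {x : 𝔤} (hx : ⁅(D.ρ : 𝔤), x⁆ = (n : ℂ) • x) :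
    x ∈ D.positivePart :=
  Submodule.mem_iSup_of_mem n (Submodule.mem_iSup_of_mem hn (Module.End.mem_eigenspace_iff.2 hx))

theorem lie_mem_positivePart {x : 𝔤} (k : ℕ) (hx : ⁅(D.ρ : 𝔤), x⁆ = (k : ℂ) • x) {w : 𝔤}
    (hw : w ∈ D.positivePart) : ⁅x, w⁆ ∈ D.positivePart := by
  suffices h : D.positivePart ≤ D.positivePart.comap (LieAlgebra.ad ℂ 𝔤 x) from h hw
  refine iSup₂_le fun n hn w hw => ?_
  refine D.mem_positivePart (Nat.add_pos_right k hn) ?_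
  rw [Module.End.mem_eigenspace_iff, LieAlgebra.ad_apply] at hw
  rw [LieAlgebra.ad_apply, leibniz_lie, hx, hw, smul_lie, lie_smul, ← add_smul, Nat.cast_add]

theorem notMem_positivePart {x : 𝔤} (hx : ⁅(D.ρ : 𝔤), x⁆ = 0) (hx0 : x ≠ 0) :
    x ∉ D.positivePart := by
  intro h
  have hind := (LieAlgebra.ad ℂ 𝔤 (D.ρ : 𝔤)).eigenspaces_iSupIndep 0
  refine hx0 (Submodule.disjoint_def.1 hind x ?_ ?_)
  · rw [Module.End.mem_eigenspace_iff, LieAlgebra.ad_apply, hx, zero_smul]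
  · refine (iSup₂_le fun n hn => ?_ : D.positivePart ≤ _) h
    exact le_iSup₂_of_le (n : ℂ) (Nat.cast_ne_zero.2 hn.ne') le_rfl

/-- Every object of `𝒪` is a quotient of one on which `f` acts injectively, for `f` with
`⁅f, e⁆` a nonzero element of `𝔥` for some positive root vector `e`. -/
theorem IsO.exists_injective_cover [FiniteDimensional ℂ 𝔤] {D : TriangularData 𝔥} {M : Type u}
    [AddCommGroup M] [Module ℂ M] [Module U(𝔤) M] [IsScalarTower ℂ U(𝔤) M] (hM : D.IsO M)
    {e f : 𝔤} {k : ℕ}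
    (hk : 0 < k) (he : ⁅(D.ρ : 𝔤), e⁆ = (k : ℂ) • e) (hfe : ⁅f, e⁆ ∈ 𝔥) (hfe0 : ⁅f, e⁆ ≠ 0) :
    ∃ (Q : Type u) (_ : AddCommGroup Q) (_ : Module ℂ Q) (_ : Module U(𝔤) Q)
      (_ : IsScalarTower ℂ U(𝔤) Q), D.IsO Q ∧ (∀ q : Q, ι ℂ f • q = 0 → q = 0) ∧
      ∃ g : Q →ₗ[U(𝔤)] M, Function.Surjective g := by
  obtain ⟨A, _, _, δ, ev, h1, h2⟩ := exists_derivation_action D.positivePart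
  -- The vector e lies in the positive part, but [f, e] is a nonzero element of degree 0 for ad ρ;
  -- so f moves the point.
  obtain ⟨a, ha, hfa⟩ := h2 f ⟨e, D.mem_positivePart hk he,
    D.notMem_positivePart (D.lie_cartan _ ⟨_, hfe⟩) hfe0⟩
  refine exists_torsionFree_cover δ ev (fun h => h1 _ fun w hw => ?_)
    (fun i => h1 _ fun w hw => ?_) ha hfa hM
  · refine D.lie_mem_positivePart 0 ?_ hw
    rw [D.lie_cartan, Nat.cast_zero, zero_smul]
  · refine D.lie_mem_positivePart (D.ht i) ?_ hw
    rw [D.lie_E, D.wt_ρ]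

end TriangularData

end RiccatiAction

/-! ### Root vectors, heights and the Casimir element of a semisimple Lie algebra. -/

section SemisimpleData

attribute [local instance 100] LieRing.ofAssociativeRing

local notation "U(" x ")" => UniversalEnvelopingAlgebra ℂ x

open UniversalEnvelopingAlgebra (ι)

open LieAlgebra LieModule LieAlgebra.IsKilling

variable {𝔤 : Type u} [LieRing 𝔤] [LieAlgebra ℂ 𝔤]

/-- The Casimir element of a pair of families dual under the Killing form is central. -/
theorem ι_mul_sum_eq_of_dual [IsKilling ℂ 𝔤] {κ : Type*} [Fintype κ] {x y : κ → 𝔤}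
    (h : ∀ z, ∑ i, killingForm ℂ 𝔤 (x i) z • y i = z) (z : 𝔤) :
    ι ℂ z * ∑ i, ι ℂ (x i) * ι ℂ (y i) = (∑ i, ι ℂ (x i) * ι ℂ (y i)) * ι ℂ z := by
  have h' : ∀ z, ∑ i, killingForm ℂ 𝔤 z (y i) • x i = z := by
    intro z
    have : ∑ i, killingForm ℂ 𝔤 z (y i) • x i - z ∈ LinearMap.ker (killingForm ℂ 𝔤) := by
      rw [LinearMap.mem_ker]
      ext w
      rw [map_sub, LinearMap.sub_apply, LinearMap.zero_apply, sub_eq_zero]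
      conv_rhs => rw [← h w]
      simp only [map_sum, map_smul, LinearMap.sum_apply, LinearMap.smul_apply, smul_eq_mul]
      exact Finset.sum_congr rfl fun _ _ => mul_comm _ _
    rwa [ker_killingForm_eq_bot, Submodule.mem_bot, sub_eq_zero] at this
  have h1 : ∀ i, ι ℂ z * (ι ℂ (x i) * ι ℂ (y i)) - ι ℂ (x i) * ι ℂ (y i) * ι ℂ z =
      ι ℂ ⁅z, x i⁆ * ι ℂ (y i) + ι ℂ (x i) * ι ℂ ⁅z, y i⁆ := by
    intro i
    rw [LieHom.map_lie, LieHom.map_lie, LieRing.of_associative_ring_bracket,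
      LieRing.of_associative_ring_bracket]
    noncomm_ring
  have hx : ∀ i, ι ℂ ⁅z, x i⁆ * ι ℂ (y i) =
      ∑ j, killingForm ℂ 𝔤 ⁅z, x i⁆ (y j) • (ι ℂ (x j) * ι ℂ (y i)) := by
    intro i
    conv_lhs => rw [← h' ⁅z, x i⁆]
    rw [map_sum, Finset.sum_mul]
    exact Finset.sum_congr rfl fun _ _ => by rw [map_smul, smul_mul_assoc]
  have hy : ∀ i, ι ℂ (x i) * ι ℂ ⁅z, y i⁆ =
      ∑ j, killingForm ℂ 𝔤 (x j) ⁅z, y i⁆ • (ι ℂ (x i) * ι ℂ (y j)) := by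
    intro i
    conv_lhs => rw [← h ⁅z, y i⁆]
    rw [map_sum, Finset.mul_sum]
    exact Finset.sum_congr rfl fun _ _ => by rw [map_smul, mul_smul_comm]
  rw [← sub_eq_zero, Finset.mul_sum, Finset.sum_mul, ← Finset.sum_sub_distrib]
  -- Expanding both brackets in the dual families, the coefficient of x_j y_i is κ([z, x_i], y_j) +
  -- κ(x_i, [z, y_j]), which vanishes by invariance of the Killing form.
  simp_rw [h1, hx, hy]
  rw [Finset.sum_add_distrib, Finset.sum_comm, ← Finset.sum_add_distrib]
  refine Finset.sum_eq_zero fun j _ => ?_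
  rw [← Finset.sum_add_distrib]
  refine Finset.sum_eq_zero fun i _ => ?_
  rw [← add_smul, ← lie_skew, map_neg, LinearMap.neg_apply, killingForm, traceForm_apply_lie_apply,
    neg_add_cancel, zero_smul]

variable [FiniteDimensional ℂ 𝔤] [IsKilling ℂ 𝔤] {𝔥 : LieSubalgebra ℂ 𝔤} [𝔥.IsCartanSubalgebra]

theorem exists_rootVectors (β : 𝔥.root) : ∃ e f : 𝔤, e ∈ rootSpace 𝔥 (β : Weight ℂ 𝔥 𝔤) ∧
    f ∈ rootSpace 𝔥 (-(β : Weight ℂ 𝔥 𝔤)) ∧ killingForm ℂ 𝔤 e f = 1 := by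
  obtain ⟨e, he, he0⟩ := (β : Weight ℂ 𝔥 𝔤).exists_ne_zero
  obtain ⟨f, hf, hef⟩ : ∃ f ∈ rootSpace 𝔥 (-(β : Weight ℂ 𝔥 𝔤)), killingForm ℂ 𝔤 e f ≠ 0 := by
    contrapose! he0
    simpa using mem_ker_killingForm_of_mem_rootSpace_of_forall_rootSpace_neg ℂ 𝔤 𝔥 he he0
  exact ⟨e, (killingForm ℂ 𝔤 e f)⁻¹ • f, he, Submodule.smul_mem _ _ hf, by
    rw [map_smul, smul_eq_mul, inv_mul_cancel₀ hef]⟩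

theorem exists_eq_smul_of_mem_rootSpace {χ : Weight ℂ 𝔥 𝔤} (hχ : χ.IsNonZero) {e z : 𝔤}
    (he : e ∈ rootSpace 𝔥 χ) (he0 : e ≠ 0) (hz : z ∈ rootSpace 𝔥 χ) : ∃ c : ℂ, z = c • e := by
  obtain ⟨c, hc⟩ := (finrank_eq_one_iff_of_nonzero' (⟨e, he⟩ : rootSpace 𝔥 χ)
    (fun h => he0 (congrArg Subtype.val h))).1 (finrank_rootSpace_eq_one χ hχ) ⟨z, hz⟩
  exact ⟨c, (congrArg Subtype.val hc).symm⟩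

variable (b : (rootSystem 𝔥).Base)

/-- The functional equal to 1 on the simple roots, transported to 𝔥 through the double dual. -/
theorem exists_height_eq : ∃ ρ : 𝔥, ∀ β : 𝔥.root, (β : Weight ℂ 𝔥 𝔤) ρ = (b.height β : ℂ) := by
  let φ : Module.Dual ℂ (Module.Dual ℂ 𝔥) := b.toWeightBasis.constr ℂ fun _ => (1 : ℂ)
  refine ⟨(Module.evalEquiv ℂ 𝔥).symm φ, fun β => ?_⟩
  have hev : ∀ ψ : Module.Dual ℂ 𝔥, ψ ((Module.evalEquiv ℂ 𝔥).symm φ) = φ ψ := by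
    intro ψ
    conv_rhs => rw [← (Module.evalEquiv ℂ 𝔥).apply_symm_apply φ]
    rfl
  obtain ⟨f, -, -, hf⟩ := b.exists_root_eq_sum_int β
  rw [RootPairing.Base.height_eq_sum hf]
  have h1 : ∀ j ∈ b.support, φ ((rootSystem 𝔥).root j) = 1 := by
    intro j hj
    rw [← b.toWeightBasis_apply ⟨j, hj⟩, Module.Basis.constr_basis]
  change (rootSystem 𝔥).root β _ = _
  rw [hev, hf, map_sum, Int.cast_sum]
  refine Finset.sum_congr rfl fun j hj => ?_
  rw [map_zsmul, h1 j hj, zsmul_one]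

/-- The element of `𝔥` on which a root takes its height as value. -/
noncomputable def heightElement : 𝔥 := (exists_height_eq b).choose

theorem apply_heightElement (β : 𝔥.root) :
    (β : Weight ℂ 𝔥 𝔤) (heightElement b) = (b.height β : ℂ) := (exists_height_eq b).choose_spec β

theorem add_ne_zero_of_isPos {β γ : 𝔥.root} (hβ : b.IsPos β) (hγ : b.IsPos γ) :
    ((β : Weight ℂ 𝔥 𝔤) : 𝔥 → ℂ) + ((γ : Weight ℂ 𝔥 𝔤) : 𝔥 → ℂ) ≠ 0 := by
  intro h
  have := congrFun h (heightElement b)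
  rw [Pi.add_apply, apply_heightElement, apply_heightElement, Pi.zero_apply] at this
  have h' : b.height β + b.height γ = 0 := by exact_mod_cast this
  rw [RootPairing.Base.isPos_iff] at hβ hγ
  omega

theorem isPos_or_exists_eq_neg (β : 𝔥.root) :
    b.IsPos β ∨ ∃ γ : 𝔥.root, b.IsPos γ ∧ (β : Weight ℂ 𝔥 𝔤) = -(γ : Weight ℂ 𝔥 𝔤) := by
  refine or_iff_not_imp_left.2 fun h => ?_
  let γ : 𝔥.root := ⟨-(β : Weight ℂ 𝔥 𝔤),
    Finset.mem_filter.2 ⟨Finset.mem_univ _, (𝔥.isNonZero_coe_root β).neg⟩⟩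
  refine ⟨γ, ?_, (neg_neg _).symm⟩
  have h1 : (b.height γ : ℂ) = -b.height β := by
    rw [← apply_heightElement, ← apply_heightElement]
    rfl
  have h2 : b.height γ = -b.height β := by exact_mod_cast h1
  rw [RootPairing.Base.isPos_iff'] at h
  rw [RootPairing.Base.isPos_iff]
  omega

/-- The positive roots. -/
abbrev PosRoot : Type u := {β : 𝔥.root // b.IsPos β}

noncomputable instance : Fintype (PosRoot b) := Fintype.ofFinite _

variable {b}

/-- A root vector of a positive root. -/
noncomputable def posVector (β : PosRoot b) : 𝔤 := (exists_rootVectors β.1).choose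

/-- The negative root vector dual to `posVector`. -/
noncomputable def negVector (β : PosRoot b) : 𝔤 := (exists_rootVectors β.1).choose_spec.choose

theorem posVector_mem (β : PosRoot b) : posVector β ∈ rootSpace 𝔥 (β.1 : Weight ℂ 𝔥 𝔤) :=
  (exists_rootVectors β.1).choose_spec.choose_spec.1

theorem negVector_mem (β : PosRoot b) : negVector β ∈ rootSpace 𝔥 (-(β.1 : Weight ℂ 𝔥 𝔤)) :=
  (exists_rootVectors β.1).choose_spec.choose_spec.2.1

theorem killingForm_posVector_negVector (β : PosRoot b) :
    killingForm ℂ 𝔤 (posVector β) (negVector β) = 1 :=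
  (exists_rootVectors β.1).choose_spec.choose_spec.2.2

theorem lie_posVector_negVector (β : PosRoot b) : ⁅posVector β, negVector β⁆ =
    ((cartanEquivDual 𝔥).symm (β.1 : Weight ℂ 𝔥 𝔤).toLinear : 𝔤) := by
  rw [lie_eq_killingForm_smul_of_mem_rootSpace_of_mem_rootSpace_neg (posVector_mem β)
    (negVector_mem β), killingForm_posVector_negVector, one_smul]

omit [IsKilling ℂ 𝔤] in
theorem mem_rootSpace_zero (h : 𝔥) : (h : 𝔤) ∈ rootSpace 𝔥 (0 : 𝔥 → ℂ) := by
  rw [rootSpace_zero_eq]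
  exact h.2

omit [IsKilling ℂ 𝔤] in
theorem killingForm_cartan_eq_zero (h : 𝔥) {χ : 𝔥 → ℂ} (hχ : χ ≠ 0) {z : 𝔤}
    (hz : z ∈ rootSpace 𝔥 χ) : killingForm ℂ 𝔤 (h : 𝔤) z = 0 :=
  killingForm_apply_eq_zero_of_mem_rootSpace_of_add_ne_zero ℂ 𝔤 𝔥 (mem_rootSpace_zero h) hz
    (by rwa [zero_add])

variable (𝔥) in
/-- A basis of the Cartan subalgebra. -/
noncomputable def cartanBasis : Module.Basis (Fin (Module.finrank ℂ 𝔥)) ℂ 𝔥 :=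
  Module.finBasis ℂ 𝔥

variable (𝔥) in
/-- The basis of the Cartan subalgebra dual to `cartanBasis` under the Killing form. -/
noncomputable def dualCartanBasis (j : Fin (Module.finrank ℂ 𝔥)) : 𝔥 :=
  (cartanEquivDual 𝔥).symm ((cartanBasis 𝔥).coord j)

theorem killingForm_dualCartanBasis (j : Fin (Module.finrank ℂ 𝔥)) (h : 𝔥) :
    killingForm ℂ 𝔤 (dualCartanBasis 𝔥 j : 𝔤) (h : 𝔤) = (cartanBasis 𝔥).coord j h :=
  LinearMap.BilinForm.apply_toDual_symm_apply (hB := traceForm_cartan_nondegenerate ℂ 𝔤 𝔥) _ _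

/-- This turns the Cartan part of the Casimir scalar into the square length of μ, a form independent
of the basis. -/
theorem sum_apply_dualCartanBasis (μ : Module.Dual ℂ 𝔥) :
    ∑ j, μ (dualCartanBasis 𝔥 j) * μ (cartanBasis 𝔥 j) = μ ((cartanEquivDual 𝔥).symm μ) := by
  conv_rhs => rw [← (cartanBasis 𝔥).sum_dual_apply_smul_coord μ, map_sum, map_sum]
  refine Finset.sum_congr rfl fun j _ => ?_
  rw [(cartanBasis 𝔥).sum_dual_apply_smul_coord μ, map_smul, map_smul, smul_eq_mul, mul_comm]
  rfl

-- The families of Cartan elements and root vectors are dual under the Killing form. It suffices to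
-- check this on each root space, where orthogonality leaves a single term because root spaces of
-- nonzero weight are lines.
variable (b) in
theorem sum_killingForm_smul (z : 𝔤) :
    ∑ j, killingForm ℂ 𝔤 (dualCartanBasis 𝔥 j : 𝔤) z • (cartanBasis 𝔥 j : 𝔤) +
      (∑ β : PosRoot b, killingForm ℂ 𝔤 (posVector β) z • negVector β +
        ∑ β : PosRoot b, killingForm ℂ 𝔤 (negVector β) z • posVector β) = z := by
  let φ : 𝔤 →ₗ[ℂ] 𝔤 :=
    ∑ j, (killingForm ℂ 𝔤 (dualCartanBasis 𝔥 j : 𝔤)).smulRight (cartanBasis 𝔥 j : 𝔤) +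
      (∑ β : PosRoot b, (killingForm ℂ 𝔤 (posVector β)).smulRight (negVector β) +
        ∑ β : PosRoot b, (killingForm ℂ 𝔤 (negVector β)).smulRight (posVector β))
  have hφ : ∀ z, φ z = ∑ j, killingForm ℂ 𝔤 (dualCartanBasis 𝔥 j : 𝔤) z • (cartanBasis 𝔥 j : 𝔤) +
      (∑ β : PosRoot b, killingForm ℂ 𝔤 (posVector β) z • negVector β +
        ∑ β : PosRoot b, killingForm ℂ 𝔤 (negVector β) z • posVector β) := by
    intro z
    simp only [φ, LinearMap.add_apply, LinearMap.sum_apply, LinearMap.smulRight_apply]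
  rw [← hφ]
  have hne : ∀ β : PosRoot b, ((β.1 : Weight ℂ 𝔥 𝔤) : 𝔥 → ℂ) ≠ 0 :=
    fun β => 𝔥.isNonZero_coe_root β.1
  have hinj : ∀ β γ : PosRoot b,
      ((β.1 : Weight ℂ 𝔥 𝔤) : 𝔥 → ℂ) + -((γ.1 : Weight ℂ 𝔥 𝔤) : 𝔥 → ℂ) = 0 → β = γ := by
    intro β γ h
    exact Subtype.ext (Subtype.ext (DFunLike.coe_injective (add_neg_eq_zero.1 h)))
  suffices h : LinearMap.eqLocus φ LinearMap.id = ⊤ from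
    LinearMap.congr_fun (LinearMap.eqLocus_eq_top.1 h) z
  rw [eq_top_iff, ← LieSubmodule.top_toSubmodule (R := ℂ) (L := 𝔥) (M := 𝔤),
    ← iSup_genWeightSpace_eq_top' ℂ 𝔥 𝔤, LieSubmodule.iSup_toSubmodule]
  refine iSup_le fun χ z hz => ?_
  replace hz : z ∈ rootSpace 𝔥 χ := hz
  change φ z = z
  rw [hφ]
  by_cases hχ : χ.IsZero
  · rw [show (χ : 𝔥 → ℂ) = 0 from hχ, rootSpace_zero_eq] at hz
    lift z to 𝔥 using hz
    have h0 := fun β : PosRoot b => killingForm_cartan_eq_zero z (hne β) (posVector_mem β)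
    have h0' := fun β : PosRoot b => killingForm_cartan_eq_zero z (neg_ne_zero.2 (hne β))
      (negVector_mem β)
    simp only [killingForm, traceForm_comm ℂ 𝔤 𝔤 _ (z : 𝔤)] at h0 h0' ⊢
    simp only [h0, h0', zero_smul, Finset.sum_const_zero, add_zero]
    conv_rhs => rw [← (cartanBasis 𝔥).sum_repr z]
    rw [AddSubmonoidClass.coe_finsetSum]
    refine Finset.sum_congr rfl fun j _ => ?_
    rw [traceForm_comm ℂ 𝔤 𝔤]
    exact congrArg (· • _) (killingForm_dualCartanBasis j z)
  · have h0 : ∀ j, killingForm ℂ 𝔤 (dualCartanBasis 𝔥 j : 𝔤) z = 0 :=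
      fun j => killingForm_cartan_eq_zero _ hχ hz
    simp only [h0, zero_smul, Finset.sum_const_zero, zero_add]
    rcases isPos_or_exists_eq_neg b ⟨χ, by simpa using hχ⟩ with hp | ⟨γ, hγ, h⟩
    · have h1 : ∀ β : PosRoot b, killingForm ℂ 𝔤 (posVector β) z = 0 := fun β =>
        killingForm_apply_eq_zero_of_mem_rootSpace_of_add_ne_zero ℂ 𝔤 𝔥 (posVector_mem β) hz
          (add_ne_zero_of_isPos b β.2 hp)
      simp only [h1, zero_smul, Finset.sum_const_zero, zero_add]
      let r : PosRoot b := ⟨_, hp⟩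
      have hr : posVector r ≠ 0 := fun h => by
        simpa [h] using killingForm_posVector_negVector r
      obtain ⟨c, rfl⟩ := exists_eq_smul_of_mem_rootSpace hχ (posVector_mem r) hr hz
      rw [Finset.sum_eq_single r]
      · rw [map_smul, killingForm, traceForm_comm, ← killingForm,
          killingForm_posVector_negVector, smul_eq_mul, mul_one]
      · intro β _ hβ
        rw [killingForm_apply_eq_zero_of_mem_rootSpace_of_add_ne_zero ℂ 𝔤 𝔥 (negVector_mem β) hz,
          zero_smul]
        intro h
        exact hβ (hinj r β (by rw [add_comm]; exact h)).symm
      · intro h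
        exact absurd (Finset.mem_univ r) h
    · replace h : χ = -(γ : Weight ℂ 𝔥 𝔤) := h
      subst h
      have h1 : ∀ β : PosRoot b, killingForm ℂ 𝔤 (negVector β) z = 0 := fun β =>
        killingForm_apply_eq_zero_of_mem_rootSpace_of_add_ne_zero ℂ 𝔤 𝔥 (negVector_mem β) hz
          (by
            rw [Weight.coe_neg, ← neg_add, neg_ne_zero]
            exact add_ne_zero_of_isPos b β.2 hγ)
      simp only [h1, zero_smul, Finset.sum_const_zero, add_zero]
      let r : PosRoot b := ⟨γ, hγ⟩
      have hr : negVector r ≠ 0 := fun h => by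
        simpa [h] using killingForm_posVector_negVector r
      obtain ⟨c, rfl⟩ := exists_eq_smul_of_mem_rootSpace hχ (negVector_mem r) hr hz
      rw [Finset.sum_eq_single r]
      · rw [map_smul, killingForm_posVector_negVector, smul_eq_mul, mul_one]
      · intro β _ hβ
        rw [killingForm_apply_eq_zero_of_mem_rootSpace_of_add_ne_zero ℂ 𝔤 𝔥 (posVector_mem β) hz,
          zero_smul]
        exact fun h => hβ (hinj β r h)
      · intro h
        exact absurd (Finset.mem_univ r) h

end SemisimpleData

/-! ### Boundedness of heights for a given Casimir scalar. -/

section CasimirBound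

attribute [local instance 100] LieRing.ofAssociativeRing

local notation "U(" x ")" => UniversalEnvelopingAlgebra ℂ x

open UniversalEnvelopingAlgebra (ι)

open LieAlgebra LieModule LieAlgebra.IsKilling

/-- A positive definite quadratic form in real variables dominates complex linear forms. Completing
the square gives r w² + c²/(4r) ≥ c|w|, applied with c = |l| + |k| to absorb both the linear
perturbation and the form to be bounded. -/
theorem norm_sum_mul_le {κ : Type*} [Fintype κ] {r : κ → ℝ} (hr : ∀ i, 0 < r i) (l k : κ → ℂ)
    (w : κ → ℝ) : ‖∑ i, k i * w i‖ ≤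
      ‖∑ i, (r i : ℂ) * (w i : ℂ) ^ 2 + ∑ i, l i * w i‖ +
        ∑ i, (‖l i‖ + ‖k i‖) ^ 2 / (4 * r i) := by
  have h1 : ‖∑ i, (r i : ℂ) * (w i : ℂ) ^ 2‖ = ∑ i, r i * |w i| ^ 2 := by
    have : ∑ i, (r i : ℂ) * (w i : ℂ) ^ 2 = ((∑ i, r i * |w i| ^ 2 : ℝ) : ℂ) := by
      push_cast
      exact Finset.sum_congr rfl fun i _ => by
        rw [← Complex.ofReal_pow |w i|, sq_abs, Complex.ofReal_pow]
    rw [this, Complex.norm_real, Real.norm_of_nonneg]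
    exact Finset.sum_nonneg fun i _ => mul_nonneg (hr i).le (sq_nonneg _)
  have h2 : ∀ m : κ → ℂ, ‖∑ i, m i * w i‖ ≤ ∑ i, ‖m i‖ * |w i| := fun m =>
    (norm_sum_le _ _).trans (Finset.sum_le_sum fun i _ => by
      rw [norm_mul, Complex.norm_real, Real.norm_eq_abs])
  have h3 : ∑ i, r i * |w i| ^ 2 ≤
      ‖∑ i, (r i : ℂ) * (w i : ℂ) ^ 2 + ∑ i, l i * w i‖ + ∑ i, ‖l i‖ * |w i| := by
    rw [← h1]
    have := norm_sub_le (∑ i, (r i : ℂ) * (w i : ℂ) ^ 2 + ∑ i, l i * w i) (∑ i, l i * w i)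
    rw [add_sub_cancel_right] at this
    exact this.trans (add_le_add_right (h2 l) _)
  have h4 : ∑ i, (‖l i‖ * |w i| + ‖k i‖ * |w i|) ≤
      ∑ i, (r i * |w i| ^ 2 + (‖l i‖ + ‖k i‖) ^ 2 / (4 * r i)) := by
    refine Finset.sum_le_sum fun i _ => ?_
    have hri := hr i
    have : r i * |w i| ^ 2 + (‖l i‖ + ‖k i‖) ^ 2 / (4 * r i) - (‖l i‖ * |w i| + ‖k i‖ * |w i|) =
        (2 * r i * |w i| - (‖l i‖ + ‖k i‖)) ^ 2 / (4 * r i) := by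
      field_simp
      ring
    rw [← sub_nonneg, this]
    positivity
  rw [Finset.sum_add_distrib, Finset.sum_add_distrib] at h4
  linarith [h2 k]

variable {𝔤 : Type u} [LieRing 𝔤] [LieAlgebra ℂ 𝔤] [FiniteDimensional ℂ 𝔤] [IsKilling ℂ 𝔤]
  {𝔥 : LieSubalgebra ℂ 𝔤} [𝔥.IsCartanSubalgebra]

theorem apply_cartanEquivDual_symm_comm (μ ν : Module.Dual ℂ 𝔥) :
    μ ((cartanEquivDual 𝔥).symm ν) = ν ((cartanEquivDual 𝔥).symm μ) := by
  have h : ∀ (μ : Module.Dual ℂ 𝔥) (x : 𝔥),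
      traceForm ℂ 𝔥 𝔤 ((cartanEquivDual 𝔥).symm μ) x = μ x := fun μ x =>
    LinearMap.BilinForm.apply_toDual_symm_apply (hB := traceForm_cartan_nondegenerate ℂ 𝔤 𝔥) _ _
  rw [← h μ, ← h ν, traceForm_comm]

theorem traceForm_cartan_eq_sum (x y : 𝔥) : traceForm ℂ 𝔥 𝔤 x y =
    ∑ β : 𝔥.root, (β : Weight ℂ 𝔥 𝔤) x * (β : Weight ℂ 𝔥 𝔤) y := by
  have := LinearMap.congr_fun (LinearMap.congr_fun
    (restrict_killingForm_eq_sum (K := ℂ) (L := 𝔤) (H := 𝔥)) x) y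
  rw [restrict_killingForm] at this
  rw [this, Finset.sum_coe_sort 𝔥.root fun β : Weight ℂ 𝔥 𝔤 => β x * β y]
  simp only [LinearMap.sum_apply, LinearMap.smulRight_apply, LinearMap.smul_apply, smul_eq_mul]
  rfl

/-- The square length of the coroot is a sum N of squares of integers γ(β^∨), and it is also 4
divided by the square length of β; hence the latter is 4/N. -/
theorem exists_apply_cartanEquivDual_symm_eq (β : 𝔥.root) : ∃ r : ℝ, 0 < r ∧
    (β : Weight ℂ 𝔥 𝔤) ((cartanEquivDual 𝔥).symm (β : Weight ℂ 𝔥 𝔤).toLinear) = r := by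
  have hβ := 𝔥.isNonZero_coe_root β
  have h0 := root_apply_cartanEquivDual_symm_ne_zero hβ
  have h1 := traceForm_coroot (β : Weight ℂ 𝔥 𝔤) (coroot (β : Weight ℂ 𝔥 𝔤))
  rw [root_apply_coroot hβ, traceForm_cartan_eq_sum] at h1
  obtain ⟨N, hN⟩ : ∃ N : ℕ, ∑ γ : 𝔥.root, (γ : Weight ℂ 𝔥 𝔤) (coroot (β : Weight ℂ 𝔥 𝔤)) *
      (γ : Weight ℂ 𝔥 𝔤) (coroot (β : Weight ℂ 𝔥 𝔤)) = N := by
    refine ⟨∑ γ : 𝔥.root, ((chainBotCoeff β.1 γ.1 - chainTopCoeff β.1 γ.1 : ℤ).natAbs) ^ 2, ?_⟩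
    rw [Nat.cast_sum]
    refine Finset.sum_congr rfl fun γ _ => ?_
    rw [apply_coroot_eq_cast, sq, ← Int.cast_mul, ← Int.natAbs_mul_self]
    exact Int.cast_natCast _
  rw [hN] at h1
  have hN0 : N ≠ 0 := by
    rintro rfl
    rw [Nat.cast_zero, eq_comm, nsmul_eq_mul, smul_eq_mul] at h1
    simp only [Nat.cast_ofNat, mul_eq_zero, OfNat.ofNat_ne_zero, inv_eq_zero, false_or,
      or_false] at h1
    exact h0 h1
  refine ⟨4 / N, by positivity, ?_⟩
  rw [nsmul_eq_mul, smul_eq_mul] at h1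
  push_cast
  rw [h1]
  field_simp
  norm_num

theorem apply_cartanEquivDual_symm_root (μ : Module.Dual ℂ 𝔥) (β : 𝔥.root) :
    μ ((cartanEquivDual 𝔥).symm (β : Weight ℂ 𝔥 𝔤).toLinear) =
      (β : Weight ℂ 𝔥 𝔤) ((cartanEquivDual 𝔥).symm (β : Weight ℂ 𝔥 𝔤).toLinear) / 2 *
        μ (coroot (β : Weight ℂ 𝔥 𝔤)) := by
  have h0 := root_apply_cartanEquivDual_symm_ne_zero (𝔥.isNonZero_coe_root β)
  rw [coroot, map_nsmul, map_smul, nsmul_eq_mul, smul_eq_mul]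
  push_cast
  field_simp

/-- Restricted to 𝔥, the Killing form is the sum of β ⊗ β over the roots, and pairing μ with β is a
positive multiple of μ(β^∨). -/
theorem exists_quadratic_form : ∃ r : 𝔥.root → ℝ, (∀ β, 0 < r β) ∧ ∀ μ : Module.Dual ℂ 𝔥,
    μ ((cartanEquivDual 𝔥).symm μ) = ∑ β, (r β : ℂ) * μ (coroot (β : Weight ℂ 𝔥 𝔤)) ^ 2 := by
  choose s hs0 hs using exists_apply_cartanEquivDual_symm_eq (𝔥 := 𝔥)
  refine ⟨fun β => (s β / 2) ^ 2, fun β => by have := hs0 β; positivity, fun μ => ?_⟩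
  have h1 : traceForm ℂ 𝔥 𝔤 ((cartanEquivDual 𝔥).symm μ) ((cartanEquivDual 𝔥).symm μ) =
      μ ((cartanEquivDual 𝔥).symm μ) :=
    LinearMap.BilinForm.apply_toDual_symm_apply (hB := traceForm_cartan_nondegenerate ℂ 𝔤 𝔥) _ _
  rw [← h1, traceForm_cartan_eq_sum]
  refine Finset.sum_congr rfl fun β _ => ?_
  rw [← Weight.toLinear_apply, apply_cartanEquivDual_symm_comm, apply_cartanEquivDual_symm_root,
    hs]
  push_cast
  ring

theorem exists_eq_sum_smul_coroot (v : 𝔥) :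
    ∃ l : 𝔥.root → ℂ, v = ∑ β, l β • coroot (β : Weight ℂ 𝔥 𝔤) := by
  have : v ∈ Submodule.span ℂ (Set.range (rootSystem 𝔥).coroot) := by
    rw [RootPairing.IsRootSystem.span_coroot_eq_top]
    trivial
  obtain ⟨l, hl⟩ := Submodule.mem_span_range_iff_exists_fun ℂ |>.1 this
  exact ⟨l, hl.symm⟩

variable (b : (rootSystem 𝔥).Base)

theorem exists_int_apply_coroot {γ : Module.Dual ℂ 𝔥}
    (hγ : γ ∈ AddSubgroup.closure (Set.range fun β : PosRoot b =>
      (β.1 : Weight ℂ 𝔥 𝔤).toLinear)) (β : 𝔥.root) :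
    ∃ w : ℤ, γ (coroot (β : Weight ℂ 𝔥 𝔤)) = w := by
  induction hγ using AddSubgroup.closure_induction with
  | mem γ h =>
    obtain ⟨δ, rfl⟩ := h
    exact ⟨_, apply_coroot_eq_cast _ _⟩
  | zero => exact ⟨0, by simp⟩
  | add γ δ _ _ h h' =>
    obtain ⟨w, hw⟩ := h
    obtain ⟨w', hw'⟩ := h'
    exact ⟨w + w', by rw [LinearMap.add_apply, hw, hw', Int.cast_add]⟩
  | neg γ _ h =>
    obtain ⟨w, hw⟩ := h
    exact ⟨-w, by rw [LinearMap.neg_apply, hw, Int.cast_neg]⟩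

/-- The scalars by which the Casimir element acts on highest weight vectors take each value only
on boundedly many levels of a coset of the root lattice. -/
theorem exists_norm_apply_le (ρ τ : 𝔥) (lam : Module.Dual ℂ 𝔥) (a : ℂ) : ∃ N : ℕ,
    ∀ γ ∈ AddSubgroup.closure (Set.range fun β : PosRoot b => (β.1 : Weight ℂ 𝔥 𝔤).toLinear),
      (lam + γ) ((cartanEquivDual 𝔥).symm (lam + γ)) + (lam + γ) τ = a → ‖γ ρ‖ ≤ N := by
  obtain ⟨r, hr, hq⟩ := exists_quadratic_form (𝔥 := 𝔥)
  obtain ⟨l, hl⟩ := exists_eq_sum_smul_coroot ((2 : ℂ) • (cartanEquivDual 𝔥).symm lam + τ)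
  obtain ⟨k, hk⟩ := exists_eq_sum_smul_coroot ρ
  obtain ⟨N, hN⟩ := exists_nat_ge (‖a - (lam ((cartanEquivDual 𝔥).symm lam) + lam τ)‖ +
    ∑ i, (‖l i‖ + ‖k i‖) ^ 2 / (4 * r i))
  refine ⟨N, fun γ hγ h => le_trans ?_ hN⟩
  choose w hw using exists_int_apply_coroot b hγ
  have hlin : ∀ (v : 𝔥) (m : 𝔥.root → ℂ), v = ∑ β, m β • coroot (β : Weight ℂ 𝔥 𝔤) →
      γ v = ∑ β, m β * ((w β : ℝ) : ℂ) := by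
    rintro _ m rfl
    rw [map_sum]
    exact Finset.sum_congr rfl fun β _ => by
      rw [map_smul, hw, smul_eq_mul, Complex.ofReal_intCast]
  have hquad : γ ((cartanEquivDual 𝔥).symm γ) = ∑ β, (r β : ℂ) * ((w β : ℝ) : ℂ) ^ 2 := by
    rw [hq]
    exact Finset.sum_congr rfl fun β _ => by rw [hw, Complex.ofReal_intCast]
  -- The equation for the Casimir scalar, expanded around lam: a quadratic form plus a linear form
  -- in γ has a fixed value. The coroot coordinates of γ are integers, hence real, while the
  -- coefficients from lam may be complex.
  have heq : a - (lam ((cartanEquivDual 𝔥).symm lam) + lam τ) =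
      γ ((cartanEquivDual 𝔥).symm γ) + γ ((2 : ℂ) • (cartanEquivDual 𝔥).symm lam + τ) := by
    rw [← h]
    simp only [map_add, LinearMap.add_apply, map_smul, smul_eq_mul]
    rw [apply_cartanEquivDual_symm_comm lam γ]
    ring
  rw [heq, hquad, hlin _ l hl, hlin _ k hk]
  exact norm_sum_mul_le hr l k fun β => (w β : ℝ)

/-- The triangular decomposition of a semisimple Lie algebra. -/
noncomputable def triangularData : TriangularData 𝔥 where
  I := PosRoot b
  wt β := (β.1 : Weight ℂ 𝔥 𝔤).toLinear
  E := posVector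
  F := negVector
  lie_E β h := lie_eq_smul_of_mem_rootSpace (posVector_mem β) h
  lie_F β h := lie_eq_smul_of_mem_rootSpace (negVector_mem β) h
  lie_cartan h h' := congrArg Subtype.val (trivial_lie_zero 𝔥 𝔥 h h')
  span_eq_top S hh hE hF := by
    refine eq_top_iff.2 fun z _ => ?_
    rw [← sum_killingForm_smul b z]
    exact S.add_mem (S.sum_mem fun j _ => S.smul_mem _ (hh _))
      (S.add_mem (S.sum_mem fun β _ => S.smul_mem _ (hF β))
        (S.sum_mem fun β _ => S.smul_mem _ (hE β)))
  ρ := heightElement b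
  ht β := (b.height β.1).toNat
  ht_pos β := by have := (RootPairing.Base.isPos_iff b).1 β.2; omega
  wt_ρ β := by
    have := (RootPairing.Base.isPos_iff b).1 β.2
    rw [Weight.toLinear_apply, apply_heightElement, ← Int.cast_natCast, Int.toNat_of_nonneg this.le]
  Ω := ∑ j, ι ℂ (dualCartanBasis 𝔥 j : 𝔤) * ι ℂ (cartanBasis 𝔥 j : 𝔤) +
    (∑ β : PosRoot b, ι ℂ (posVector β) * ι ℂ (negVector β) +
      ∑ β : PosRoot b, ι ℂ (negVector β) * ι ℂ (posVector β))
  central z := by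
    have := ι_mul_sum_eq_of_dual
      (x := Sum.elim (fun j => (dualCartanBasis 𝔥 j : 𝔤))
        (Sum.elim (posVector (b := b)) (negVector (b := b))))
      (y := Sum.elim (fun j => (cartanBasis 𝔥 j : 𝔤))
        (Sum.elim (negVector (b := b)) (posVector (b := b)))) (fun z => by
        simpa only [Fintype.sum_sum_type, Sum.elim_inl, Sum.elim_inr] using
          sum_killingForm_smul b z) z
    simpa only [Fintype.sum_sum_type, Sum.elim_inl, Sum.elim_inr] using this
  n := Module.finrank ℂ 𝔥
  c := dualCartanBasis 𝔥
  c' := cartanBasis 𝔥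
  -- Rewriting e_β f_β as f_β e_β + [e_β, f_β] gives this linear term and doubles f_β e_β, whence
  -- the factor 2 in `G`.
  τ := ∑ β : PosRoot b, (cartanEquivDual 𝔥).symm (β.1 : Weight ℂ 𝔥 𝔤).toLinear
  G β := (2 : ℂ) • negVector β
  Ω_eq := by
    rw [add_assoc]
    congr 1
    rw [AddSubmonoidClass.coe_finsetSum, map_sum, ← Finset.sum_add_distrib,
      ← Finset.sum_add_distrib]
    refine Finset.sum_congr rfl fun β _ => ?_
    rw [← lie_posVector_negVector, LieHom.map_lie, LieRing.of_associative_ring_bracket, map_smul,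
      smul_mul_assoc, two_smul]
    abel
  bound lam a := by
    obtain ⟨N, hN⟩ := exists_norm_apply_le b (heightElement b)
      (∑ β : PosRoot b, (cartanEquivDual 𝔥).symm (β.1 : Weight ℂ 𝔥 𝔤).toLinear) lam a
    exact ⟨N, fun γ hγ h => hN γ hγ (by rwa [sum_apply_dualCartanBasis] at h)⟩

end CasimirBound

/-! ### Projective covers as finite products of projective generators. -/

section ProjectiveCovers

attribute [local instance 100] LieRing.ofAssociativeRing

local notation "U(" x ")" => UniversalEnvelopingAlgebra ℂ x

open UniversalEnvelopingAlgebra (ι)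

namespace TriangularData

variable {𝔤 : Type u} [LieRing 𝔤] [LieAlgebra ℂ 𝔤] [FiniteDimensional ℂ 𝔤]
  {𝔥 : LieSubalgebra ℂ 𝔤} {D : TriangularData 𝔥}

theorem IsO.pi {J : Type*} [Finite J] {M : J → Type*} [∀ j, AddCommGroup (M j)]
    [∀ j, Module ℂ (M j)] [∀ j, Module U(𝔤) (M j)] [∀ j, IsScalarTower ℂ U(𝔤) (M j)]
    (h : ∀ j, D.IsO (M j)) : D.IsO (∀ j, M j) := by
  classical
  have := Fintype.ofFinite J
  have := fun j => (h j).finite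
  refine ⟨Module.Finite.pi, isWeight_of_forall fun m => ?_, fun m => ?_⟩
  · rw [← Finset.univ_sum_single m]
    refine Submodule.sum_mem _ fun j _ => ?_
    obtain ⟨s, c, hc, hs⟩ := (h j).isWeight.exists_sum (m j)
    rw [← hs, ← LinearMap.single_apply (R := U(𝔤)), map_sum]
    exact Submodule.sum_mem _ fun μ hμ => Submodule.mem_iSup_of_mem μ (map_mem_wtSpace _ (hc μ hμ))
  · refine mem_stableSubmodule.1 (?_ : m ∈ D.lfSubmodule (∀ j, M j))
    rw [← Finset.univ_sum_single m]
    refine Submodule.sum_mem _ fun j _ => mem_stableSubmodule.2 ?_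
    exact ((h j).isLF (m j)).map (LinearMap.single U(𝔤) M j)

/-- Every object of `𝒪` is a quotient of a projective one. -/
theorem IsO.exists_projective_cover {M : Type u} [AddCommGroup M] [Module ℂ M] [Module U(𝔤) M]
    [IsScalarTower ℂ U(𝔤) M] (hM : D.IsO M) :
    ∃ (Q : Type u) (_ : AddCommGroup Q) (_ : Module ℂ Q) (_ : Module U(𝔤) Q)
      (_ : IsScalarTower ℂ U(𝔤) Q), D.IsO Q ∧
      (∃ g : Q →ₗ[U(𝔤)] M, Function.Surjective g) ∧
      ∀ (A B : Type u) [AddCommGroup A] [Module ℂ A] [Module U(𝔤) A] [IsScalarTower ℂ U(𝔤) A]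
        [AddCommGroup B] [Module ℂ B] [Module U(𝔤) B] [IsScalarTower ℂ U(𝔤) B],
        D.IsO A → D.IsO B → ∀ φ : A →ₗ[U(𝔤)] B, Function.Surjective φ →
          ∀ g : Q →ₗ[U(𝔤)] B, ∃ g' : Q →ₗ[U(𝔤)] A, φ ∘ₗ g' = g := by
  classical
  obtain ⟨s, hs⟩ := hM.finite.fg_top
  choose S c hc hsum using hM.isWeight.exists_sum
  let V : Finset M := s.biUnion fun m => (S m).image (c m)
  have hV : ∀ x : V, ∃ μ, (x : M) ∈ wtSpace 𝔥 M μ := by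
    rintro ⟨x, hx⟩
    obtain ⟨m, -, hx⟩ := Finset.mem_biUnion.1 hx
    obtain ⟨μ, hμ, rfl⟩ := Finset.mem_image.1 hx
    exact ⟨μ, hc m μ hμ⟩
  have hspan : Submodule.span U(𝔤) (V : Set M) = ⊤ := by
    rw [eq_top_iff, ← hs]
    refine Submodule.span_le.2 fun m hm => ?_
    rw [SetLike.mem_coe, ← hsum m]
    exact Submodule.sum_mem _ fun μ hμ => Submodule.subset_span
      (Finset.mem_biUnion.2 ⟨m, hm, Finset.mem_image_of_mem _ hμ⟩)
  choose μ hμ using hV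
  choose Q _ _ _ _ hQ g hlift using fun x : V => exists_projective_generator hM (hμ x)
  choose g hg using g
  refine ⟨∀ x, Q x, inferInstance, inferInstance, inferInstance, inferInstance, IsO.pi hQ,
    ⟨LinearMap.lsum U(𝔤) Q ℕ g, ?_⟩, ?_⟩
  · rw [← LinearMap.range_eq_top, eq_top_iff, ← hspan]
    refine Submodule.span_le.2 fun x hx => ?_
    obtain ⟨q, hq⟩ := hg ⟨x, hx⟩
    exact ⟨Pi.single ⟨x, hx⟩ q, by rw [LinearMap.lsum_piSingle, hq]⟩
  · intro A B _ _ _ _ _ _ _ _ hA hB φ hφ k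
    choose k' hk' using fun x => hlift x A B hA hB φ hφ (k ∘ₗ LinearMap.single U(𝔤) Q x)
    refine ⟨LinearMap.lsum U(𝔤) Q ℕ k', LinearMap.pi_ext fun x q => ?_⟩
    rw [LinearMap.comp_apply, LinearMap.lsum_piSingle, ← LinearMap.comp_apply, hk']
    rfl

end TriangularData

end ProjectiveCovers

/-! ### The abelian category 𝒪 and its projective objects. -/

section CategoryO

open LieAlgebra LieModule LieAlgebra.IsKilling

attribute [local instance 100] LieRing.ofAssociativeRing

local notation "U(" x ")" => UniversalEnvelopingAlgebra ℂ x

open UniversalEnvelopingAlgebra (ι)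

variable {𝔤 : Type u} [LieRing 𝔤] [LieAlgebra ℂ 𝔤] [FiniteDimensional ℂ 𝔤] [IsKilling ℂ 𝔤]
  {𝔥 : LieSubalgebra ℂ 𝔤} [𝔥.IsCartanSubalgebra] {b : (rootSystem 𝔥).Base}

/-- Stability under one root vector per positive root is enough: root spaces are lines, and the
elements of 𝔤 preserving a given subspace form a Lie subalgebra. -/
theorem categoryO_iff_isO (M : ModuleCat.{u} U(𝔤)) :
    categoryO b M ↔ (triangularData b).IsO M := by
  constructor
  · rintro ⟨h1, h2, h3⟩
    refine ⟨h1, h2, fun m => ?_⟩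
    obtain ⟨V, hm, hV, h⟩ := h3 m
    exact ⟨V, hm, hV, fun β => h _ (LieSubalgebra.subset_lieSpan ⟨β.1, β.2, posVector_mem β⟩)⟩
  · rintro ⟨h1, h2, h3⟩
    refine ⟨h1, h2, fun m => ?_⟩
    obtain ⟨V, hm, hV, h⟩ := h3 m
    refine ⟨V, hm, hV, ?_⟩
    let K : LieSubalgebra ℂ 𝔤 :=
      { carrier := {x | ∀ w ∈ V, ι ℂ x • w ∈ V}
        add_mem' := fun {x y} hx hy w hw => by
          rw [map_add, add_smul]; exact V.add_mem (hx w hw) (hy w hw)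
        zero_mem' := fun w _ => by rw [map_zero, zero_smul]; exact V.zero_mem
        smul_mem' := fun c x hx w hw => by
          rw [map_smul, smul_assoc]; exact V.smul_mem c (hx w hw)
        lie_mem' := fun {x y} hx hy w hw => by
          rw [LieHom.map_lie, LieRing.of_associative_ring_bracket, sub_smul, mul_smul, mul_smul]
          exact V.sub_mem (hx _ (hy w hw)) (hy _ (hx w hw)) }
    have hK : borelNilradical b ≤ K := by
      refine LieSubalgebra.lieSpan_le.2 ?_
      rintro x ⟨β, hβ, hx⟩
      have h0 : posVector (⟨β, hβ⟩ : PosRoot b) ≠ 0 := fun h => by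
        simpa [h] using killingForm_posVector_negVector (⟨β, hβ⟩ : PosRoot b)
      obtain ⟨c, rfl⟩ := exists_eq_smul_of_mem_rootSpace (𝔥.isNonZero_coe_root β)
        (posVector_mem (⟨β, hβ⟩ : PosRoot b)) h0 hx
      exact K.smul_mem c (h ⟨β, hβ⟩)
    exact fun x hx => hK hx

theorem categoryO_of_injective {M : ModuleCat.{u} U(𝔤)} {Q : Type u} [AddCommGroup Q] [Module ℂ Q]
    [Module U(𝔤) Q] [IsScalarTower ℂ U(𝔤) Q] (hQ : (triangularData b).IsO Q) (φ : M →ₗ[U(𝔤)] Q)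
    (hφ : Function.Injective φ) : categoryO b M :=
  (categoryO_iff_isO _).2 (hQ.of_injective φ hφ)

theorem categoryO_of {Q : Type u} [AddCommGroup Q] [Module ℂ Q] [Module U(𝔤) Q]
    [IsScalarTower ℂ U(𝔤) Q] (hQ : (triangularData b).IsO Q) :
    categoryO b (ModuleCat.of U(𝔤) Q) :=
  categoryO_of_injective hQ LinearMap.id Function.injective_id

/-- Together with the closure under quotients and finite products, this makes 𝒪 an abelian category
with kernels and cokernels computed on modules. -/
instance : (categoryO b).IsClosedUnderSubobjects where
  prop_of_mono f _ h := categoryO_of_injective ((categoryO_iff_isO _).1 h) f.hom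
    ((ModuleCat.mono_iff_injective f).1 ‹_›)

instance : (categoryO b).IsClosedUnderQuotients where
  prop_of_epi f _ h := (categoryO_iff_isO _).2
    (((categoryO_iff_isO _).1 h).of_surjective f.hom ((ModuleCat.epi_iff_surjective f).1 ‹_›))

instance : (categoryO b).IsClosedUnderFiniteProducts where
  isClosedUnderLimitsOfShape J _ :=
    ⟨by
      rintro X ⟨p⟩
      have hp := TriangularData.IsO.pi fun j : J =>
        (categoryO_iff_isO (b := b) _).1 (p.prop_diag_obj ⟨j⟩)
      refine categoryO_of_injective hp (LinearMap.pi fun j => (p.π.app ⟨j⟩).hom)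
        ((injective_iff_map_eq_zero _).2 fun x hx => ?_)
      -- An element of X is a map out of U(𝔤), to which the universal property of the limit applies.
      have h0 : ModuleCat.ofHom (LinearMap.toSpanSingleton U(𝔤) X x) = 0 := by
        refine p.isLimit.hom_ext fun j => ModuleCat.hom_ext (LinearMap.ext_ring ?_)
        have := congrFun hx j.as
        change (p.π.app j).hom ((1 : U(𝔤)) • x) = (p.π.app j).hom 0
        rw [one_smul, map_zero]
        exact this
      have := LinearMap.congr_fun (congrArg ModuleCat.Hom.hom h0) (1 : U(𝔤))
      change (1 : U(𝔤)) • x = 0 at this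
      rwa [one_smul] at this⟩

/-- The epimorphisms of `𝒪` are surjective. -/
theorem categoryO_surjective_of_epi {X Y : (categoryO b).FullSubcategory} (f : X ⟶ Y) [Epi f] :
    Function.Surjective f.hom.hom := by
  have := (categoryO b).preservesEpimorphisms_ι_of_isNormalMonoCategory
  exact (ModuleCat.epi_iff_surjective _).1 (inferInstance : Epi ((categoryO b).ι.map f))

theorem categoryO_epi_of_surjective {X Y : (categoryO b).FullSubcategory} (f : X ⟶ Y)
    (h : Function.Surjective f.hom.hom) : Epi f :=
  (categoryO b).ι.epi_of_epi_map ((ModuleCat.epi_iff_surjective f.hom).2 h)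

/-- Exactness in `𝒪` is exactness of the underlying modules. -/
theorem exists_eq_of_exact {S : ShortComplex (categoryO b).FullSubcategory} (hS : S.Exact)
    (x : S.X₂.obj) (hx : S.g.hom.hom x = 0) : ∃ y : S.X₁.obj, S.f.hom.hom y = x := by
  -- The module-theoretic kernel is an object of 𝒪, so exactness up to refinements applies to its
  -- inclusion; the refining epimorphism is surjective on elements.
  let K := LinearMap.ker S.g.hom.hom
  let A : (categoryO b).FullSubcategory := ⟨ModuleCat.of U(𝔤) K, categoryO_of_injective
    ((categoryO_iff_isO _).1 S.X₂.property) K.subtype Subtype.val_injective⟩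
  let k : A ⟶ S.X₂ := (categoryO b).homMk (ModuleCat.ofHom K.subtype)
  have hk : k ≫ S.g = 0 := by
    refine (categoryO b).ι.map_injective (ModuleCat.hom_ext (LinearMap.ext fun y => ?_))
    exact y.2
  obtain ⟨A', π, hπ, z, hz⟩ := hS.exact_up_to_refinements k hk
  obtain ⟨y, hy⟩ := categoryO_surjective_of_epi π ⟨x, hx⟩
  refine ⟨z.hom.hom y, ?_⟩
  have := LinearMap.congr_fun (congrArg (fun h => h.hom.hom) hz) y
  change k.hom.hom (π.hom.hom y) = S.f.hom.hom (z.hom.hom y) at this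
  rw [← this, hy]
  rfl

instance : EnoughProjectives (categoryO b).FullSubcategory where
  presentation M := by
    obtain ⟨Q, _, _, _, _, hQ, ⟨g, hg⟩, hlift⟩ :=
      ((categoryO_iff_isO _).1 M.property).exists_projective_cover
    refine ⟨{ p := ⟨ModuleCat.of U(𝔤) Q, categoryO_of hQ⟩
              projective := ⟨fun {E X} f e _ => ?_⟩
              f := (categoryO b).homMk (ModuleCat.ofHom g)
              epi := categoryO_epi_of_surjective _ hg }⟩
    obtain ⟨f', hf'⟩ := hlift E.obj X.obj ((categoryO_iff_isO _).1 E.property)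
      ((categoryO_iff_isO _).1 X.property) e.hom.hom (categoryO_surjective_of_epi e) f.hom.hom
    exact ⟨(categoryO b).homMk (ModuleCat.ofHom f'),
      (categoryO b).ι.map_injective (ModuleCat.hom_ext hf')⟩

/-- A negative root vector acts injectively on the projective objects of `𝒪`. -/
theorem eq_zero_of_ι_smul_eq_zero_of_projective {α : 𝔥.root} (hα : b.IsPos α) {e f : 𝔤}
    (he : e ∈ rootSpace 𝔥 (α : Weight ℂ 𝔥 𝔤))
    (hef : ⁅e, f⁆ = (coroot (α : Weight ℂ 𝔥 𝔤) : 𝔤)) (P : (categoryO b).FullSubcategory)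
    [Projective P] (p : P.obj) (hp : ι ℂ f • p = 0) : p = 0 := by
  have hα' := (RootPairing.Base.isPos_iff b).1 hα
  have hfe : ⁅f, e⁆ = -(coroot (α : Weight ℂ 𝔥 𝔤) : 𝔤) := by rw [← lie_skew, hef]
  obtain ⟨Q, _, _, _, _, hQ, hinj, g, hg⟩ :=
    ((categoryO_iff_isO _).1 P.property).exists_injective_cover (e := e) (f := f)
      (k := (b.height α).toNat) (by omega) (by
        rw [← Int.cast_natCast, Int.toNat_of_nonneg hα'.le, ← apply_heightElement]
        exact lie_eq_smul_of_mem_rootSpace he (heightElement b))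
      (hfe ▸ 𝔥.neg_mem (SetLike.coe_mem _)) (by
        rw [hfe, neg_ne_zero, ZeroMemClass.coe_eq_zero.ne]
        exact fun h => 𝔥.isNonZero_coe_root α (coroot_eq_zero_iff.1 h))
  let g' : (⟨ModuleCat.of U(𝔤) Q, categoryO_of hQ⟩ : (categoryO b).FullSubcategory) ⟶ P :=
    (categoryO b).homMk (ModuleCat.ofHom g)
  have : Epi g' := categoryO_epi_of_surjective g' hg
  -- Projectivity splits the torsion-free cover, so P embeds into `Q` and inherits injectivity of f.
  let s := Projective.factorThru (𝟙 P) g'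
  have hs : ∀ x : P.obj, g (s.hom.hom x) = x := fun x =>
    LinearMap.congr_fun (congrArg (fun h => h.hom.hom) (Projective.factorThru_comp (𝟙 P) g')) x
  have h0 : s.hom.hom p = 0 := hinj _ (by
    have := (s.hom.hom.map_smul (ι ℂ f) p).symm
    rw [hp, map_zero] at this
    exact this)
  rw [← hs p, h0, map_zero]

end CategoryO

/-! ### Freeness over the enveloping algebra of a line. -/

section FreeModules

attribute [local instance 100] LieRing.ofAssociativeRing

local notation "U(" x ")" => UniversalEnvelopingAlgebra ℂ x

open UniversalEnvelopingAlgebra (ι)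

variable {𝔤 : Type u} [LieRing 𝔤] [LieAlgebra ℂ 𝔤]

/-- The generator of the line `ℂ f`. -/
def lineGenerator (f : 𝔤) : lineSubalgebra f := ⟨f, Submodule.mem_span_singleton_self f⟩

theorem exists_smul_lineGenerator {f : 𝔤} (x : lineSubalgebra f) :
    ∃ c : ℂ, x = c • lineGenerator f := by
  obtain ⟨c, hc⟩ := Submodule.mem_span_singleton.1 x.2
  exact ⟨c, Subtype.ext hc.symm⟩

/-- The enveloping algebra of a line is a polynomial ring. -/
theorem ι_lineGenerator_mul_eq_zero {f : 𝔤} (hf : f ≠ 0) (r : U(lineSubalgebra f))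
    (h : ι ℂ (lineGenerator f) * r = 0) : r = 0 := by
  let e : (lineSubalgebra f).toSubmodule ≃ₗ[ℂ] ℂ :=
    (LinearEquiv.toSpanNonzeroSingleton ℂ 𝔤 f hf).symm
  have he : e (lineGenerator f) = 1 := LinearEquiv.coord_self ℂ 𝔤 f hf
  let l : (lineSubalgebra f).toSubmodule →ₗ[ℂ] Polynomial ℂ :=
    LinearMap.toSpanSingleton ℂ (Polynomial ℂ) (Polynomial.X : Polynomial ℂ) ∘ₗ e.toLinearMap
  have hl : l (lineGenerator f) = Polynomial.X := by
    change e (lineGenerator f) • (Polynomial.X : Polynomial ℂ) = Polynomial.X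
    rw [he, one_smul]
  let φ₀ : lineSubalgebra f →ₗ⁅ℂ⁆ Polynomial ℂ :=
    { l with
      map_lie' := fun {x y} => by
        obtain ⟨c, rfl⟩ := exists_smul_lineGenerator x
        obtain ⟨d, rfl⟩ := exists_smul_lineGenerator y
        rw [smul_lie, lie_smul, lie_self, smul_zero, smul_zero,
          LieRing.of_associative_ring_bracket, mul_comm, sub_self]
        exact l.map_zero }
  let φ : U(lineSubalgebra f) →ₐ[ℂ] Polynomial ℂ := UniversalEnvelopingAlgebra.lift ℂ φ₀
  have hφ : φ (ι ℂ (lineGenerator f)) = Polynomial.X := by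
    rw [UniversalEnvelopingAlgebra.lift_ι_apply]
    exact hl
  let ψ : Polynomial ℂ →ₐ[ℂ] U(lineSubalgebra f) := Polynomial.aeval (ι ℂ (lineGenerator f))
  have hψφ : ψ.comp φ = AlgHom.id ℂ _ := by
    refine UniversalEnvelopingAlgebra.hom_ext ℂ (LieHom.ext fun x => ?_)
    obtain ⟨c, rfl⟩ := exists_smul_lineGenerator x
    change ψ (φ (ι ℂ (c • lineGenerator f))) = ι ℂ (c • lineGenerator f)
    rw [map_smul, map_smul, map_smul, hφ, Polynomial.aeval_X]
  have h1 : Polynomial.X * φ r = 0 := by rw [← hφ, ← map_mul, h, map_zero]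
  have h2 : φ r = 0 := (mul_eq_zero.1 h1).resolve_left Polynomial.X_ne_zero
  have h3 := DFunLike.congr_fun hψφ r
  change ψ (φ r) = r at h3
  rw [← h3, h2, map_zero]

/-- In coordinates with respect to a basis, f acts as the generator of a polynomial ring, which is
not a zero divisor. -/
theorem IsFreeOver.eq_zero_of_ι_smul {f : 𝔤} (hf : f ≠ 0) {M : ModuleCat.{u} U(𝔤)}
    (hM : IsFreeOver (lineSubalgebra f) M) (m : M) (hm : ι ℂ f • m = 0) : m = 0 := by
  let : Module U(lineSubalgebra f) M :=
    Module.compHom M (envelopingIncl (lineSubalgebra f)).toRingHom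
  have : Module.Free U(lineSubalgebra f) M := hM
  have hι : envelopingIncl (lineSubalgebra f) (ι ℂ (lineGenerator f)) = ι ℂ f :=
    UniversalEnvelopingAlgebra.lift_ι_apply _ _ _
  have h1 : ι ℂ (lineGenerator f) • m = 0 := by
    rw [← hm, ← hι]
    rfl
  let B := Module.Free.chooseBasis U(lineSubalgebra f) M
  refine B.repr.map_eq_zero_iff.1 (Finsupp.ext fun i => ι_lineGenerator_mul_eq_zero hf _ ?_)
  rw [← smul_eq_mul, ← Finsupp.smul_apply, ← map_smul, h1, map_zero, Finsupp.zero_apply]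

end FreeModules

/-! ### Vanishing of the derived functors. -/

section DerivedFunctors

open LieAlgebra LieModule LieAlgebra.IsKilling

attribute [local instance 100] LieRing.ofAssociativeRing

local notation "U(" x ")" => UniversalEnvelopingAlgebra ℂ x

open UniversalEnvelopingAlgebra (ι)

theorem smul_pow_eq_zero_of_forall {R M : Type*} [Ring R] [AddCommGroup M] [Module R M] {t : R}
    (h : ∀ m : M, t • m = 0 → m = 0) (n : ℕ) (m : M) (hm : t ^ n • m = 0) : m = 0 := by
  induction n with
  | zero => rwa [pow_zero, one_smul] at hm
  | succ n ih => exact ih (h _ (by rwa [← mul_smul, ← pow_succ']))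

variable {𝔤 : Type u} [LieRing 𝔤] [LieAlgebra ℂ 𝔤] [FiniteDimensional ℂ 𝔤] [IsKilling ℂ 𝔤]
  {𝔥 : LieSubalgebra ℂ 𝔤} [𝔥.IsCartanSubalgebra] {b : (rootSystem 𝔥).Base} {α : 𝔥.root} {f : 𝔤}
  (hf : f ∈ rootSpace 𝔥 (-(α : Weight ℂ 𝔥 𝔤)))
include hf

/-- Vanishing of `L_{i+1} T_α`, when `f_α` acts injectively on the term in degree `i` and on its
quotient by the image of the differential. -/
theorem isZero_leftDerivedTwisting {M : (categoryO b).FullSubcategory} (P : ProjectiveResolution M)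
    (i : ℕ) (hinj : ∀ c : (P.complex.X i).obj, ι ℂ f • c = 0 → c = 0)
    (hC : ∀ (n : ℕ) (c : (P.complex.X i).obj) (y : (P.complex.X (i + 1)).obj),
      ι ℂ f ^ n • c = (P.complex.d (i + 1) i).hom.hom y →
        ∃ y', (P.complex.d (i + 1) i).hom.hom y' = c) :
    Limits.IsZero (leftDerivedTwisting b α hf P (i + 1)) := by
  refine ((HomologicalComplex.exactAt_iff_isZero_homology _ _).1
    ((HomologicalComplex.exactAt_iff' _ (i + 2) (i + 1) i (by simp only [ChainComplex.prev]; rfl)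
      (by simp)).2 ((ShortComplex.moduleCat_exact_iff _).2 fun z hz => ?_)))
  exact twistingFunctor_exact (isLocallyAdNilpotent_of_mem_rootSpace α hf)
    (P.complex.d (i + 2) (i + 1)).hom (P.complex.d (i + 1) i).hom
    (fun y hy => exists_eq_of_exact (P.exact_succ i) y hy) hC hinj z hz

variable (hα : b.IsPos α) {e : 𝔤} (he : e ∈ rootSpace 𝔥 (α : Weight ℂ 𝔥 𝔤))
  (hef : ⁅e, f⁆ = (coroot (α : Weight ℂ 𝔥 𝔤) : 𝔤))
include hα he hef

/-- The cokernel of each differential with target in positive degree embeds, by exactness, into the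
next term of the resolution, which is projective and hence f-torsion-free. -/
theorem isZero_leftDerivedTwisting_of_one_lt {M : (categoryO b).FullSubcategory}
    (P : ProjectiveResolution M) (i : ℕ) (hi : 1 < i) :
    Limits.IsZero (leftDerivedTwisting b α hf P i) := by
  obtain ⟨i, rfl⟩ := Nat.exists_eq_add_of_lt hi
  rw [show 1 + i + 1 = i + 1 + 1 by omega]
  have hinj := fun j => eq_zero_of_ι_smul_eq_zero_of_projective hα he hef (P.complex.X j)
  refine isZero_leftDerivedTwisting hf P (i + 1) (hinj _) fun n c y h => ?_
  refine exists_eq_of_exact (P.exact_succ i) c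
    (smul_pow_eq_zero_of_forall (hinj i) n _ ?_)
  have h2 : (P.complex.d (i + 1) i).hom.hom ((P.complex.d (i + 2) (i + 1)).hom.hom y) = 0 :=
    LinearMap.congr_fun (congrArg (fun g => g.hom.hom) (P.complex.d_comp_d (i + 2) (i + 1) i)) y
  rw [← h2, ← map_smul]
  exact congrArg _ h

/-- In the lowest degree the cokernel of the differential is M itself, so torsion-freeness has to be
assumed of M. -/
theorem isZero_leftDerivedTwisting_one {M : (categoryO b).FullSubcategory}
    (P : ProjectiveResolution M) (hM : ∀ m : M.obj, ι ℂ f • m = 0 → m = 0) :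
    Limits.IsZero (leftDerivedTwisting b α hf P 1) := by
  have hinj := fun j => eq_zero_of_ι_smul_eq_zero_of_projective hα he hef (P.complex.X j)
  refine isZero_leftDerivedTwisting hf P 0 (hinj _) fun n c y h => ?_
  let π : P.complex.X 0 ⟶ M := P.π.f 0
  refine exists_eq_of_exact P.exact₀ c
    (smul_pow_eq_zero_of_forall (M := M.obj) hM n (π.hom.hom c) ?_)
  have h2 : π.hom.hom ((P.complex.d 1 0).hom.hom y) = 0 :=
    LinearMap.congr_fun (congrArg (fun g => g.hom.hom) P.complex_d_comp_π_f_zero) y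
  rw [← h2, ← map_smul]
  exact congrArg _ h

end DerivedFunctors

theorem mainTheorem8 {𝔤 : Type u} [LieRing 𝔤] [LieAlgebra ℂ 𝔤] [FiniteDimensional ℂ 𝔤]
    [LieAlgebra.IsSemisimple ℂ 𝔤]
    (𝔥 : LieSubalgebra ℂ 𝔤) [𝔥.IsCartanSubalgebra]
    (b : (LieAlgebra.IsKilling.rootSystem 𝔥).Base)
    (α : 𝔥.root) (hα : b.IsPos α) (e f : 𝔤)
    (he : e ∈ LieAlgebra.rootSpace 𝔥 (α : LieModule.Weight ℂ 𝔥 𝔤))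
    (hf : f ∈ LieAlgebra.rootSpace 𝔥 (-(α : LieModule.Weight ℂ 𝔥 𝔤)))
    (hef : ⁅e, f⁆ = (LieAlgebra.IsKilling.coroot (α : LieModule.Weight ℂ 𝔥 𝔤) : 𝔤)) :
    CategoryTheory.HasProjectiveResolutions (categoryO b).FullSubcategory ∧
    (∀ (M : (categoryO b).FullSubcategory) (P : CategoryTheory.ProjectiveResolution M) (i : ℕ),
      1 < i → CategoryTheory.Limits.IsZero (leftDerivedTwisting b α hf P i)) ∧
    (∀ (M : (categoryO b).FullSubcategory) (P : CategoryTheory.ProjectiveResolution M),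
      IsFreeOver (lineSubalgebra f) M.obj →
        CategoryTheory.Limits.IsZero (leftDerivedTwisting b α hf P 1)) := by

  refine ⟨inferInstance, fun M P i hi => isZero_leftDerivedTwisting_of_one_lt hf hα he hef P i hi,
    fun M P hM => isZero_leftDerivedTwisting_one hf hα he hef P (hM.eq_zero_of_ι_smul ?_)⟩
  -- If f were zero, the coroot [e, f] would vanish, although α is a nonzero weight.
  rintro rfl
  rw [lie_zero, eq_comm, ZeroMemClass.coe_eq_zero, LieAlgebra.IsKilling.coroot_eq_zero_iff] at hef
  exact 𝔥.isNonZero_coe_root α hef
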